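/- Let $k$ be a field, $Q$ a quiver (not necessarily finite), and $\rho$ a set of paths of length $\ge 2$ in $Q$, such that $\Lambda=kQ/(\rho)$ is a string algebra: every vertex is the head of at most two arrows and the tail of at most two arrows, and for every arrow $y$ there is at most one path $xy$ of length $2$ with $xy\notin\rho$ and at most one path $yz$ of length $2$ with $yz\notin\rho$. (Paths are composed like functions: in $xy$ the tail of $x$ is the head of $y$.) Modules are left $\Lambda$-modules $M$ with $\Lambda M=M$; $e_v$ is the trivial path at the vertex $v$. A module $M$ is *finitely generated* if $M=\Lambda m_1+\dots+\Lambda m_n$ for some $m_1,\dots,m_n\in M$, *finitely controlled* if for every $a\in\Lambda$ the set $aM$ is contained in a finitely generated submodule, *supported at* $v$ if $e_vM\ne0$, and *indecomposable* if it is nonzero and not the direct sum of two nonzero submodules. *Words.* A letter is an arrow $x$ (direct) or its formal inverse $x^{-1}$ (inverse), where the head of $x^{-1}$ is the tail of $x$ and vice versa, and $(x^{-1})^{-1}=x$. Let $I$ be $\{0,\dots,n\}$ ($n\ge0$), $\mathbb N=\{0,1,2,\dots\}$, $-\mathbb N$ or $\mathbb Z$. For $I\ne\{0\}$ an $I$-word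 $C$ is a family of letters $C_i$, for all $i\in I$ with $i-1\in I$, such that for consecutive letters the tail of $C_i$ is the head of $C_{i+1}$ and $C_i^{-1}\ne C_{i+1}$, and such that no $x_1\cdots x_m\in\rho$ and no inverse $x_m^{-1}\cdots x_1^{-1}$ of such a path occurs as a sequence of consecutive letters in $C$. The $\{0\}$-words are the trivial words $1_{v,\epsilon}$ with $v$ a vertex and $\epsilon=\pm1$. For $i\in I$, the vertex $v_i(C)$ is the tail of $C_i$ or the head of $C_{i+1}$, or $v$ for $1_{v,\epsilon}$. The inverse $C^{-1}$ is obtained by inverting the letters and reversing their order, with $(C^{-1})_i=(C_{1-i})^{-1}$ for a $\mathbb Z$-word and $(1_{v,\epsilon})^{-1}=1_{v,-\epsilon}$. For a $\mathbb Z$-word, $C[n]$ is the word with $C[n]_i=C_{n+i}$; for all other words $C[n]=C$. Write $C\sim D$ if $D=C[n]$ or $D=(C^{-1})[n]$ for some $n\in\mathbb Z$. A $\mathbb Z$-word is periodic if $C=C[n]$ for some $n>0$; the least such $n$ is its period. A word $C$ is *eventually inverse* if only finitely many $C_i$ with $i>0$ are direct, and *vertex-finite* if for every vertex $v$ there are only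 finitely many $i>0$ in $I$ with $v_i(C)=v$. *String and band modules.* The string module $M(C)$ has $k$-basis $b_i$ ($i\in I$), where $e_vb_i$ is $b_i$ if $v_i(C)=v$ and $0$ otherwise, and, for an arrow $x$, $xb_i$ is $b_{i-1}$ if $C_i=x$, is $b_{i+1}$ if $C_{i+1}=x^{-1}$, and is $0$ otherwise. If $C$ is periodic of period $n$, then $M(C)$ is also a $k[T,T^{-1}]$-module, with $Tb_i=b_{i-n}$. A band module is a module $M(C,V)=M(C)\otimes_{k[T,T^{-1}]}V$ with $C$ a periodic $\mathbb Z$-word and $V$ a finite-dimensional indecomposable $k[T,T^{-1}]$-module. Let $V^{-1}$ be $V$ with the actions of $T$ and $T^{-1}$ exchanged. **Theorem.** (i) All string modules and all band modules are indecomposable. (ii) (a) $M(C)\cong M(D)$ if and only if $C\sim D$. (b) For band modules, $M(C,V)\cong M(D,U)$ if and only if either $D=C[n]$ for some $n$ and $U\cong V$, or $D=(C^{-1})[n]$ for some $n$ and $U\cong V^{-1}$. (c) No string module is isomorphic to a band module. (iii) A string module $M(C)$ is finitely generated if and only if both $C$ and $C^{-1}$ are eventually inverse. It is finitely controlled if and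 only if each of $C$ and $C^{-1}$ is eventually inverse or vertex-finite. (iv) A direct sum of a family of string and band modules is finitely generated if and only if all string modules among the summands are finitely generated and the family is finite. It is finitely controlled if and only if all string modules among the summands are finitely controlled and, for every vertex $v$, only finitely many summands are supported at $v$. -/

import Mathlib

open scoped TensorProduct LaurentPolynomial DirectSum

/-! ## Path algebras of (possibly infinite) quivers -/

section PathAlgebra

/-- The paths of the quiver `Q`, of arbitrary length and with arbitrary end points. -/
abbrev QPath (Q : Type*) [Quiver Q] := Σ a b : Q, Quiver.Path a b

/-- The path algebra `kQ`: the vector space with basis the paths of `Q`. -/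
def PathAlgebra (k Q : Type*) [Field k] [Quiver Q] := QPath Q →₀ k

namespace PathAlgebra

variable {k Q : Type*} [Field k] [Quiver Q]

noncomputable instance : AddCommGroup (PathAlgebra k Q) :=
  inferInstanceAs (AddCommGroup (QPath Q →₀ k))

noncomputable instance : Module k (PathAlgebra k Q) :=
  inferInstanceAs (Module k (QPath Q →₀ k))

/-- The basis element of `kQ` given by a path. -/
noncomputable def ofPath (p : QPath Q) : PathAlgebra k Q := Finsupp.single p (1 : k)

open Classical in
/-- The product `p q` of two paths: first `q`, then `p` (as for functions), and zero if `q` does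
not end where `p` starts. -/
noncomputable def pathMul (p q : QPath Q) : PathAlgebra k Q :=
  if h : q.2.1 = p.1 then ofPath ⟨q.1, p.2.1, (h ▸ q.2.2 : Quiver.Path q.1 p.1).comp p.2.2⟩ else 0

/-- The linear map with given values on the paths. -/
noncomputable def linExt {M : Type*} [AddCommGroup M] [Module k M] (f : QPath Q → M) :
    PathAlgebra k Q →ₗ[k] M :=
  Finsupp.linearCombination k f

theorem linExt_ofPath {M : Type*} [AddCommGroup M] [Module k M] (f : QPath Q → M) (p : QPath Q) :
    linExt (k := k) f (ofPath p) = f p :=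
  (Finsupp.linearCombination_single k (1 : k) p).trans (one_smul k (f p))

/-- The bilinear extension of the product of paths. -/
noncomputable def mulLin : PathAlgebra k Q →ₗ[k] PathAlgebra k Q →ₗ[k] PathAlgebra k Q :=
  linExt fun p => linExt fun q => pathMul p q

noncomputable instance : Mul (PathAlgebra k Q) := ⟨fun f g => mulLin f g⟩

theorem mul_def (f g : PathAlgebra k Q) : f * g = mulLin f g := rfl

theorem ofPath_mul_ofPath (p q : QPath Q) :
    (ofPath p * ofPath q : PathAlgebra k Q) = pathMul p q := by
  rw [mul_def, mulLin, linExt_ofPath, linExt_ofPath]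

theorem pathMul_comp {a b c : Q} (p : Quiver.Path b c) (q : Quiver.Path a b) :
    (pathMul ⟨b, c, p⟩ ⟨a, b, q⟩ : PathAlgebra k Q) = ofPath ⟨a, c, q.comp p⟩ := by
  simp [pathMul]

theorem pathMul_eq_zero {a b c d : Q} (p : Quiver.Path c d) (q : Quiver.Path a b) (h : b ≠ c) :
    (pathMul ⟨c, d, p⟩ ⟨a, b, q⟩ : PathAlgebra k Q) = 0 := by
  simp [pathMul, h]

/-- Linear maps out of `kQ` agree if they agree on paths. -/
theorem hom_ext {M : Type*} [AddCommGroup M] [Module k M] {f g : PathAlgebra k Q →ₗ[k] M}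
    (h : ∀ p, f (ofPath p) = g (ofPath p)) : f = g :=
  Finsupp.lhom_ext' fun p => LinearMap.ext_ring (h p)

theorem mulLin_ofPath (p q : QPath Q) :
    mulLin (ofPath p) (ofPath q) = (pathMul p q : PathAlgebra k Q) :=
  ofPath_mul_ofPath p q

theorem mul_assoc_ofPath (p q r : QPath Q) :
    (ofPath p * ofPath q * ofPath r : PathAlgebra k Q) = ofPath p * (ofPath q * ofPath r) := by
  obtain ⟨e, f, p⟩ := p
  obtain ⟨c, d, q⟩ := q
  obtain ⟨a, b, r⟩ := r
  rw [ofPath_mul_ofPath, ofPath_mul_ofPath]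
  by_cases h : d = e
  · subst h
    rw [pathMul_comp, ofPath_mul_ofPath]
    by_cases h' : b = c
    · subst h'
      rw [pathMul_comp, pathMul_comp, ofPath_mul_ofPath, pathMul_comp, Quiver.Path.comp_assoc]
    · rw [pathMul_eq_zero _ _ h', pathMul_eq_zero _ _ h', mul_def, map_zero]
  · rw [pathMul_eq_zero _ _ h, mul_def, map_zero, LinearMap.zero_apply]
    by_cases h' : b = c
    · subst h'
      rw [pathMul_comp, ofPath_mul_ofPath, pathMul_eq_zero _ _ h]
    · rw [pathMul_eq_zero _ _ h', mul_def, map_zero]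

theorem mul_assoc_aux (f g h : PathAlgebra k Q) : f * g * h = f * (g * h) := by
  have key : (LinearMap.llcomp k _ _ _ (mulLin (k := k) (Q := Q))).comp mulLin
      = (LinearMap.llcomp k _ _ _).flip (mulLin (k := k) (Q := Q)) ∘ₗ
          (LinearMap.llcomp k (PathAlgebra k Q) (PathAlgebra k Q) (PathAlgebra k Q)) ∘ₗ
            mulLin := by
    refine hom_ext fun p => hom_ext fun q => hom_ext fun r => ?_
    exact mul_assoc_ofPath p q r
  exact LinearMap.congr_fun (LinearMap.congr_fun (LinearMap.congr_fun key f) g) h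

noncomputable instance : NonUnitalRing (PathAlgebra k Q) :=
  { (inferInstance : AddCommGroup (PathAlgebra k Q)),
    (inferInstance : Mul (PathAlgebra k Q)) with
    left_distrib := fun f g h => map_add (mulLin f) g h
    right_distrib := fun f g h => by
      change mulLin (f + g) h = mulLin f h + mulLin g h
      rw [map_add, LinearMap.add_apply]
    zero_mul := fun f => by
      change mulLin 0 f = 0
      rw [map_zero, LinearMap.zero_apply]
    mul_zero := fun f => map_zero (mulLin f)
    mul_assoc := mul_assoc_aux }

instance : IsScalarTower k (PathAlgebra k Q) (PathAlgebra k Q) :=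
  ⟨fun c f g => by
    change mulLin (c • f) g = c • mulLin f g
    rw [map_smul, LinearMap.smul_apply]⟩

instance : SMulCommClass k (PathAlgebra k Q) (PathAlgebra k Q) :=
  ⟨fun c f g => (map_smul (mulLin f) c g).symm⟩

/-- The operator by which a path acts, if `e v` is the action of the trivial path at `v` and
`X x` that of the arrow `x`. -/
def pathOp {B : Type*} [Mul B] (e : Q → B) (X : Quiver.Total Q → B) {a : Q} :
    {b : Q} → Quiver.Path a b → B
  | _, .nil => e a
  | _, .cons p x => X ⟨_, _, x⟩ * pathOp e X p

section lift

variable {B : Type*} [Ring B] [Algebra k B] (e : Q → B) (X : Quiver.Total Q → B)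

theorem mul_pathOp (he : ∀ v, e v * e v = e v) (hX : ∀ x, e x.right * X x = X x) {a b : Q}
    (p : Quiver.Path a b) : e b * pathOp e X p = pathOp e X p := by
  cases p with
  | nil => exact he a
  | cons p x => rw [pathOp, ← mul_assoc, hX ⟨_, _, x⟩]

theorem pathOp_mul (he : ∀ v, e v * e v = e v) {a b : Q}
    (p : Quiver.Path a b) : pathOp e X p * e a = pathOp e X p := by
  induction p with
  | nil => exact he a
  | cons p x ih => rw [pathOp, mul_assoc, ih]

theorem pathOp_comp (he : ∀ v, e v * e v = e v) (hX : ∀ x, e x.right * X x = X x) {a b c : Q}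
    (p : Quiver.Path b c) (q : Quiver.Path a b) :
    pathOp e X (q.comp p) = pathOp e X p * pathOp e X q := by
  induction p with
  | nil => exact (mul_pathOp e X he hX q).symm
  | cons p x ih => rw [Quiver.Path.comp_cons, pathOp, pathOp, ih, mul_assoc]

/-- The homomorphism from `kQ` given by orthogonal idempotents `e v` for the vertices and elements
`X x` for the arrows. -/
noncomputable def lift (he : ∀ v, e v * e v = e v) (hne : ∀ v w, v ≠ w → e v * e w = 0)
    (hX : ∀ x, e x.right * X x = X x) : PathAlgebra k Q →ₙₐ[k] B :=
  let L : PathAlgebra k Q →ₗ[k] B := linExt fun p => pathOp e X p.2.2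
  { L with
    map_zero' := map_zero L
    map_mul' := by
      have hL : ∀ p : QPath Q, L (ofPath p) = pathOp e X p.2.2 := fun p =>
        linExt_ofPath _ p
      have key : (LinearMap.llcomp k _ _ _ L).comp mulLin
          = (LinearMap.llcomp k _ _ _).flip L ∘ₗ (LinearMap.mul k B) ∘ₗ L := by
        refine hom_ext fun p => hom_ext fun q => ?_
        obtain ⟨c, d, p⟩ := p
        obtain ⟨a, b, q⟩ := q
        change L (mulLin (ofPath _) (ofPath _)) = L (ofPath _) * L (ofPath _)
        rw [mulLin_ofPath, hL, hL]
        by_cases h : b = c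
        · subst h
          rw [pathMul_comp, hL, pathOp_comp e X he hX]
        · rw [pathMul_eq_zero _ _ h, map_zero, ← pathOp_mul e X he p,
            ← mul_pathOp e X he hX q, mul_assoc, ← mul_assoc (e c), hne c b (Ne.symm h),
            zero_mul, mul_zero]
      exact fun f g => LinearMap.congr_fun (LinearMap.congr_fun key f) g }

theorem lift_ofPath (he : ∀ v, e v * e v = e v) (hne : ∀ v w, v ≠ w → e v * e w = 0)
    (hX : ∀ x, e x.right * X x = X x) (p : QPath Q) :
    lift (k := k) e X he hne hX (ofPath p) = pathOp e X p.2.2 :=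
  linExt_ofPath (k := k) (fun p => pathOp e X p.2.2) p

end lift

end PathAlgebra

/-! ## The algebra `Λ = kQ/(ρ)` and its modules -/

variable (k : Type*) {Q : Type*} [Field k] [Quiver Q] (ρ : Set (QPath Q))

/-- The ideal `(ρ)` of `kQ` generated by the set of paths `ρ`. -/
noncomputable def relIdeal : Submodule k (PathAlgebra k Q) :=
  sInf {J | (∀ p ∈ ρ, PathAlgebra.ofPath p ∈ J) ∧ ∀ a, ∀ x ∈ J, a * x ∈ J ∧ x * a ∈ J}

variable {k ρ} in
theorem relIdeal_mul_left (a : PathAlgebra k Q) {x : PathAlgebra k Q} (hx : x ∈ relIdeal k ρ) :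
    a * x ∈ relIdeal k ρ := by
  rw [relIdeal, Submodule.mem_sInf] at hx ⊢
  exact fun J hJ => (hJ.2 a x (hx J hJ)).1

variable {k ρ} in
theorem relIdeal_mul_right (a : PathAlgebra k Q) {x : PathAlgebra k Q} (hx : x ∈ relIdeal k ρ) :
    x * a ∈ relIdeal k ρ := by
  rw [relIdeal, Submodule.mem_sInf] at hx ⊢
  exact fun J hJ => (hJ.2 a x (hx J hJ)).2

/-- The algebra `Λ = kQ/(ρ)`. It has a one only if `Q` has finitely many vertices. -/
def QuiverAlgebra := PathAlgebra k Q ⧸ relIdeal k ρ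

namespace QuiverAlgebra

noncomputable instance : AddCommGroup (QuiverAlgebra k ρ) :=
  inferInstanceAs (AddCommGroup (PathAlgebra k Q ⧸ relIdeal k ρ))

noncomputable instance : Module k (QuiverAlgebra k ρ) :=
  inferInstanceAs (Module k (PathAlgebra k Q ⧸ relIdeal k ρ))

/-- The canonical map `kQ → Λ`. -/
noncomputable def mk : PathAlgebra k Q →ₗ[k] QuiverAlgebra k ρ := (relIdeal k ρ).mkQ

theorem mk_surjective : Function.Surjective (mk k ρ) := (relIdeal k ρ).mkQ_surjective

theorem mk_eq_iff {x y : PathAlgebra k Q} : mk k ρ x = mk k ρ y ↔ x - y ∈ relIdeal k ρ :=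
  Submodule.Quotient.eq _

noncomputable instance : Mul (QuiverAlgebra k ρ) :=
  ⟨Quotient.map₂ (· * ·) fun a a' ha b b' hb => by
    have ha' : a - a' ∈ relIdeal k ρ := (Submodule.quotientRel_def _).1 ha
    have hb' : b - b' ∈ relIdeal k ρ := (Submodule.quotientRel_def _).1 hb
    refine (Submodule.quotientRel_def _).2 ?_
    have h : a * b - a' * b' = (a - a') * b + a' * (b - b') := by
      rw [sub_mul, mul_sub]; abel
    rw [h]
    exact add_mem (relIdeal_mul_right b ha') (relIdeal_mul_left a' hb')⟩

theorem mk_mul (x y : PathAlgebra k Q) : mk k ρ (x * y) = mk k ρ x * mk k ρ y := rfl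

noncomputable instance : NonUnitalRing (QuiverAlgebra k ρ) :=
  { (inferInstance : AddCommGroup (QuiverAlgebra k ρ)),
    (inferInstance : Mul (QuiverAlgebra k ρ)) with
    left_distrib := fun a b c => by
      obtain ⟨a, rfl⟩ := mk_surjective k ρ a
      obtain ⟨b, rfl⟩ := mk_surjective k ρ b
      obtain ⟨c, rfl⟩ := mk_surjective k ρ c
      simp only [← mk_mul, ← map_add, mul_add]
    right_distrib := fun a b c => by
      obtain ⟨a, rfl⟩ := mk_surjective k ρ a
      obtain ⟨b, rfl⟩ := mk_surjective k ρ b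
      obtain ⟨c, rfl⟩ := mk_surjective k ρ c
      simp only [← mk_mul, ← map_add, add_mul]
    zero_mul := fun a => by
      obtain ⟨a, rfl⟩ := mk_surjective k ρ a
      rw [← map_zero (mk k ρ), ← mk_mul, zero_mul]
    mul_zero := fun a => by
      obtain ⟨a, rfl⟩ := mk_surjective k ρ a
      rw [← map_zero (mk k ρ), ← mk_mul, mul_zero]
    mul_assoc := fun a b c => by
      obtain ⟨a, rfl⟩ := mk_surjective k ρ a
      obtain ⟨b, rfl⟩ := mk_surjective k ρ b
      obtain ⟨c, rfl⟩ := mk_surjective k ρ c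
      simp only [← mk_mul, mul_assoc] }

instance : IsScalarTower k (QuiverAlgebra k ρ) (QuiverAlgebra k ρ) :=
  ⟨fun c a b => by
    obtain ⟨a, rfl⟩ := mk_surjective k ρ a
    obtain ⟨b, rfl⟩ := mk_surjective k ρ b
    simp only [smul_eq_mul, ← mk_mul, ← map_smul, smul_mul_assoc]⟩

instance : SMulCommClass k (QuiverAlgebra k ρ) (QuiverAlgebra k ρ) :=
  ⟨fun c a b => by
    obtain ⟨a, rfl⟩ := mk_surjective k ρ a
    obtain ⟨b, rfl⟩ := mk_surjective k ρ b
    simp only [smul_eq_mul, ← mk_mul, ← map_smul, mul_smul_comm]⟩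

/-- The trivial path `e_v` as an idempotent of `Λ`. -/
noncomputable def idem (v : Q) : QuiverAlgebra k ρ :=
  mk k ρ (PathAlgebra.ofPath ⟨v, v, Quiver.Path.nil⟩)

variable {k ρ} in
/-- A homomorphism from `kQ` that kills the relations factors through `Λ`. -/
noncomputable def lift {B : Type*} [Ring B] [Algebra k B] (φ : PathAlgebra k Q →ₙₐ[k] B)
    (hφ : ∀ p ∈ ρ, φ (PathAlgebra.ofPath p) = 0) : QuiverAlgebra k ρ →ₙₐ[k] B :=
  let φ' : PathAlgebra k Q →ₗ[k] B := (φ : PathAlgebra k Q →ₗ[k] B)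
  let L : QuiverAlgebra k ρ →ₗ[k] B := (relIdeal k ρ).liftQ φ' (by
    refine sInf_le ⟨fun p hp => hφ p hp, fun a x hx => ?_⟩
    have hx' : φ x = 0 := hx
    refine ⟨?_, ?_⟩
    · change φ (a * x) = 0
      rw [map_mul, hx', mul_zero]
    · change φ (x * a) = 0
      rw [map_mul, hx', zero_mul])
  { L with
    map_zero' := map_zero L
    map_mul' := fun a b => by
      obtain ⟨a, rfl⟩ := mk_surjective k ρ a
      obtain ⟨b, rfl⟩ := mk_surjective k ρ b
      exact map_mul φ a b }

variable {k ρ} in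
theorem lift_mk {B : Type*} [Ring B] [Algebra k B] (φ : PathAlgebra k Q →ₙₐ[k] B)
    (hφ : ∀ p ∈ ρ, φ (PathAlgebra.ofPath p) = 0) (x : PathAlgebra k Q) :
    lift φ hφ (mk k ρ x) = φ x := rfl

end QuiverAlgebra

/-- `kQ/(ρ)` is a string algebra: `ρ` consists of paths of length at least two, any vertex is the
head of at most two arrows and the tail of at most two arrows, and for any arrow `y` there is at
most one path `xy` of length two, and at most one path `yz` of length two, outside `ρ`. -/
structure IsStringAlgebra {Q : Type*} [Quiver Q] (ρ : Set (QPath Q)) : Prop where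
  two_le_length : ∀ p ∈ ρ, 2 ≤ p.2.2.length
  heads : ∀ v : Q, {x : Quiver.Total Q | x.right = v}.encard ≤ 2
  tails : ∀ v : Q, {x : Quiver.Total Q | x.left = v}.encard ≤ 2
  unique_after : ∀ {a b c c' : Q} (y : a ⟶ b) (x : b ⟶ c) (x' : b ⟶ c'),
    (⟨a, c, y.toPath.cons x⟩ : QPath Q) ∉ ρ → (⟨a, c', y.toPath.cons x'⟩ : QPath Q) ∉ ρ →
      (⟨b, c, x⟩ : Quiver.Total Q) = ⟨b, c', x'⟩
  unique_before : ∀ {a a' b c : Q} (y : b ⟶ c) (z : a ⟶ b) (z' : a' ⟶ b),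
    (⟨a, c, z.toPath.cons y⟩ : QPath Q) ∉ ρ → (⟨a', c, z'.toPath.cons y⟩ : QPath Q) ∉ ρ →
      (⟨a, b, z⟩ : Quiver.Total Q) = ⟨a', b, z'⟩

/-- Left modules over the non-unital algebra `Λ` are the same as modules over the ring obtained
by adjoining a one to `Λ`; the element `a` of `Λ` acts as `(a : OneAdjoined k ρ)`. -/
abbrev OneAdjoined := Unitization k (QuiverAlgebra k ρ)

variable (M : Type*) [AddCommGroup M] [Module (OneAdjoined k ρ) M]

/-- `M = Λ m₁ + ⋯ + Λ mₙ` for some elements `m₁, …, mₙ` of `M`. -/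
def IsFinitelyGenerated : Prop :=
  ∃ (n : ℕ) (m : Fin n → M), ∀ z : M, ∃ a : Fin n → QuiverAlgebra k ρ,
    z = ∑ i, (a i : OneAdjoined k ρ) • m i

/-- For every `a` in `Λ`, the set `a M` is contained in a finitely generated submodule. -/
def IsFinitelyControlled : Prop :=
  ∀ a : QuiverAlgebra k ρ, ∃ N : Submodule (OneAdjoined k ρ) M,
    IsFinitelyGenerated k ρ N ∧ ∀ m : M, (a : OneAdjoined k ρ) • m ∈ N

/-- `M` is supported at the vertex `v`, that is, `e_v M ≠ 0`. -/
def IsSupportedAt (v : Q) : Prop :=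
  ∃ m : M, (QuiverAlgebra.idem k ρ v : OneAdjoined k ρ) • m ≠ 0

/-- A module is indecomposable if it is nonzero and not the direct sum of two nonzero
submodules. -/
def IsIndecomposableModule (R M : Type*) [Ring R] [AddCommGroup M] [Module R M] : Prop :=
  Nontrivial M ∧ ∀ N N' : Submodule R M, IsCompl N N' → N = ⊥ ∨ N' = ⊥

end PathAlgebra

/-! ## Words -/

section Words

/-- A letter is an arrow (a direct letter) or the formal inverse of an arrow (an inverse letter). -/
inductive Letter (Q : Type*) [Quiver Q]
  | direct (x : Quiver.Total Q)
  | inverse (x : Quiver.Total Q)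

namespace Letter

variable {Q : Type*} [Quiver Q]

def inv : Letter Q → Letter Q
  | direct x => inverse x
  | inverse x => direct x

def head : Letter Q → Q
  | direct x => x.right
  | inverse x => x.left

def tail : Letter Q → Q
  | direct x => x.left
  | inverse x => x.right

theorem inv_inv (l : Letter Q) : l.inv.inv = l := by cases l <;> rfl

theorem head_inv (l : Letter Q) : l.inv.head = l.tail := by cases l <;> rfl

theorem tail_inv (l : Letter Q) : l.inv.tail = l.head := by cases l <;> rfl

end Letter

/-- The possible index sets of words: `{0, …, n}`, `ℕ`, `-ℕ` and `ℤ`. -/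
inductive Shape
  | fin (n : ℕ)
  | nat
  | negNat
  | int

namespace Shape

/-- The index set `I`. -/
def idx : Shape → Set ℤ
  | fin n => Set.Icc 0 (n : ℤ)
  | nat => Set.Ici 0
  | negNat => Set.Iic 0
  | int => Set.univ

/-- The index set of the inverse of a word. -/
def inv : Shape → Shape
  | fin n => fin n
  | nat => negNat
  | negNat => nat
  | int => int

/-- Inverting a word sends the position `i` to the position `s.mirror - i`. -/
def mirror : Shape → ℤ
  | fin n => n
  | _ => 0

/-- The amount by which `C[n]` is shifted: `n` for `ℤ`-words, and `0` for all other words. -/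
def offset : Shape → ℤ → ℤ
  | int, n => n
  | _, _ => 0

theorem mem_idx_inv (s : Shape) (i : ℤ) : i ∈ s.inv.idx ↔ s.mirror - i ∈ s.idx := by
  cases s <;> simp [inv, mirror, idx]
  omega

theorem mem_idx_offset (s : Shape) (n i : ℤ) : i + s.offset n ∈ s.idx ↔ i ∈ s.idx := by
  cases s <;> simp [offset, idx]

end Shape

variable {Q : Type*} [Quiver Q]

/-- The arrows `x₁, …, xₘ` of a path `x₁ ⋯ xₘ`; the arrow passed last comes first. -/
def arrowList {a : Q} : {b : Q} → Quiver.Path a b → List (Quiver.Total Q)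
  | _, .nil => []
  | _, .cons p x => ⟨_, _, x⟩ :: arrowList p

/-- `w` occurs as a sequence of consecutive letters in `f`. -/
def OccursIn (w : List (Letter Q)) (f : ℤ → Option (Letter Q)) : Prop :=
  ∃ i : ℤ, ∀ j : ℕ, j < w.length → f (i + j) = w[j]?

/-- An `I`-word `C` for the relations `ρ`. The letter `C_i` is `letter i`, which is `none` unless
both `i` and `i - 1` are in `I`. A word without letters, `I = {0}`, is a trivial word `1_{v,ε}`,
and then `base` is `(v, ε)`. -/
@[ext]
structure Word (ρ : Set (QPath Q)) where
  shape : Shape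
  letter : ℤ → Option (Letter Q)
  base : Option (Q × ℤˣ)
  letter_isSome : ∀ i, (letter i).isSome ↔ i ∈ shape.idx ∧ i - 1 ∈ shape.idx
  base_isSome : base.isSome ↔ shape = Shape.fin 0
  composable : ∀ i l l', letter i = some l → letter (i + 1) = some l' → l.tail = l'.head
  reduced : ∀ i l l', letter i = some l → letter (i + 1) = some l' → l.inv ≠ l'
  no_relation : ∀ p ∈ ρ, ¬ OccursIn ((arrowList p.2.2).map Letter.direct) letter
  no_inverse_relation :
    ∀ p ∈ ρ, ¬ OccursIn ((arrowList p.2.2).map Letter.inverse).reverse letter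

theorem OccursIn.of_shift {w : List (Letter Q)} {f : ℤ → Option (Letter Q)} {n : ℤ}
    (h : OccursIn w fun i => f (i + n)) : OccursIn w f := by
  obtain ⟨i, hi⟩ := h
  refine ⟨i + n, fun j hj => ?_⟩
  rw [← hi j hj]
  congr 1
  ring

theorem OccursIn.of_inv {w : List (Letter Q)} {f : ℤ → Option (Letter Q)} {n : ℤ}
    (h : OccursIn w fun i => (f (n - i)).map Letter.inv) :
    OccursIn (w.map Letter.inv).reverse f := by
  obtain ⟨i, hi⟩ := h
  refine ⟨n - i - (w.length - 1), fun j hj => ?_⟩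
  rw [List.length_reverse, List.length_map] at hj
  have h1 := hi (w.length - 1 - j) (by omega)
  have h2 : n - (i + ((w.length - 1 - j : ℕ) : ℤ)) = n - i - (w.length - 1) + j := by omega
  beta_reduce at h1
  rw [h2] at h1
  rw [List.getElem?_reverse (by simpa using hj), List.length_map, List.getElem?_map, ← h1,
    Option.map_map]
  have h3 : (Letter.inv ∘ Letter.inv : Letter Q → Letter Q) = id :=
    funext fun l => Letter.inv_inv l
  rw [h3, Option.map_id_fun, id]

namespace Word

variable {ρ : Set (QPath Q)}

/-- The vertex `v_i(C)`, for `i` in `I`: the tail of `C_i` or the head of `C_{i+1}`, or `v` for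
`1_{v,ε}`. -/
def vertex (C : Word ρ) (i : ℤ) : Option Q :=
  match C.letter i, C.letter (i + 1) with
  | some l, _ => some l.tail
  | none, some l => some l.head
  | none, none => C.base.map Prod.fst

/-- The inverse word: the letters are inverted and their order is reversed, and the inverse of
`1_{v,ε}` is `1_{v,-ε}`. -/
def inv (C : Word ρ) : Word ρ where
  shape := C.shape.inv
  letter i := (C.letter (C.shape.mirror + 1 - i)).map Letter.inv
  base := C.base.map fun b => (b.1, -b.2)
  letter_isSome i := by
    rw [Option.isSome_map, C.letter_isSome, C.shape.mem_idx_inv, C.shape.mem_idx_inv, and_comm]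
    have h1 : C.shape.mirror + 1 - i - 1 = C.shape.mirror - i := by ring
    have h2 : C.shape.mirror + 1 - i = C.shape.mirror - (i - 1) := by ring
    rw [h1, h2]
  base_isSome := by
    rw [Option.isSome_map, C.base_isSome]
    cases C.shape <;> simp [Shape.inv]
  composable i l l' h h' := by
    obtain ⟨m, hm, rfl⟩ := Option.map_eq_some_iff.1 h
    obtain ⟨m', hm', rfl⟩ := Option.map_eq_some_iff.1 h'
    rw [Letter.tail_inv, Letter.head_inv]
    refine (C.composable _ _ _ hm' ?_).symm
    rw [← hm]; congr 1; ring
  reduced i l l' h h' := by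
    obtain ⟨m, hm, rfl⟩ := Option.map_eq_some_iff.1 h
    obtain ⟨m', hm', rfl⟩ := Option.map_eq_some_iff.1 h'
    rw [Letter.inv_inv]
    refine (C.reduced _ _ _ hm' ?_).symm
    rw [← hm]; congr 1; ring
  no_relation p hp h := by
    refine C.no_inverse_relation p hp ?_
    have := h.of_inv
    rwa [List.map_map] at this
  no_inverse_relation p hp h := by
    refine C.no_relation p hp ?_
    have := h.of_inv
    rwa [List.map_reverse, List.reverse_reverse, List.map_map] at this

/-- The shift `C[n]`, with `C[n]_i = C_{n+i}`, for a `ℤ`-word; all other words are unchanged. -/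
def shift (C : Word ρ) (n : ℤ) : Word ρ where
  shape := C.shape
  letter i := C.letter (i + C.shape.offset n)
  base := C.base
  letter_isSome i := by
    rw [C.letter_isSome, C.shape.mem_idx_offset, ← C.shape.mem_idx_offset n (i - 1)]
    have h : i + C.shape.offset n - 1 = i - 1 + C.shape.offset n := by ring
    rw [h]
  base_isSome := C.base_isSome
  composable i l l' h h' := by
    refine C.composable _ _ _ h ?_
    rw [← h']; congr 1; ring
  reduced i l l' h h' := by
    refine C.reduced _ _ _ h ?_
    rw [← h']; congr 1; ring
  no_relation p hp h := C.no_relation p hp h.of_shift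
  no_inverse_relation p hp h := C.no_inverse_relation p hp h.of_shift

/-- The equivalence relation on words. -/
def Equivalent (C D : Word ρ) : Prop :=
  ∃ n : ℤ, D = C.shift n ∨ D = C.inv.shift n

/-- `C` is a `ℤ`-word with `C = C[n]` for some `n > 0`. -/
def IsPeriodic (C : Word ρ) : Prop :=
  C.shape = Shape.int ∧ ∃ n : ℕ, 0 < n ∧ C.shift n = C

/-- The period of a periodic word: the least `n > 0` with `C = C[n]`. -/
noncomputable def period (C : Word ρ) : ℕ :=
  sInf {n : ℕ | 0 < n ∧ C.shift n = C}

/-- Only finitely many `C_i` with `i > 0` are direct letters. -/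
def EventuallyInverse (C : Word ρ) : Prop :=
  {i : ℤ | 0 < i ∧ ∃ x, C.letter i = some (Letter.direct x)}.Finite

/-- Every vertex `v` is `v_i(C)` for only finitely many `i > 0` in `I`. -/
def VertexFinite (C : Word ρ) : Prop :=
  ∀ v : Q, {i : ℤ | 0 < i ∧ i ∈ C.shape.idx ∧ C.vertex i = some v}.Finite

theorem mem_of_letter {C : Word ρ} {i : ℤ} {l : Letter Q} (h : C.letter i = some l) :
    i ∈ C.shape.idx ∧ i - 1 ∈ C.shape.idx :=
  (C.letter_isSome i).1 (by rw [h]; rfl)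

theorem mem_of_letter_succ {C : Word ρ} {i : ℤ} {l : Letter Q} (h : C.letter (i + 1) = some l) :
    i + 1 ∈ C.shape.idx :=
  (mem_of_letter h).1

theorem vertex_of_letter {C : Word ρ} {i : ℤ} {l : Letter Q} (h : C.letter i = some l) :
    C.vertex i = some l.tail := by
  simp [vertex, h]

theorem vertex_of_letter_succ {C : Word ρ} {i : ℤ} {l : Letter Q}
    (h : C.letter (i + 1) = some l) : C.vertex i = some l.head := by
  cases h' : C.letter i with
  | none => simp [vertex, h, h']
  | some l' => rw [vertex_of_letter h', C.composable i l' l h' h]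

end Word

end Words

/-! ## String modules -/

section StringModules

variable {Q : Type*} [Quiver Q] {ρ : Set (QPath Q)} (k : Type*) [Field k]

/-- The string module `M(C)`, the vector space with basis the symbols `b_i` for `i` in `I`. -/
def StringModule (C : Word ρ) := C.shape.idx →₀ k

namespace StringModule

variable (C : Word ρ)

noncomputable instance : AddCommGroup (StringModule k C) :=
  inferInstanceAs (AddCommGroup (C.shape.idx →₀ k))

noncomputable instance : Module k (StringModule k C) :=
  inferInstanceAs (Module k (C.shape.idx →₀ k))

variable {C} in
/-- The basis element `b_i`. -/
noncomputable def b (i : C.shape.idx) : StringModule k C := Finsupp.single i (1 : k)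

/-- The linear map with given values on the basis elements. -/
noncomputable def linExt {M : Type*} [AddCommGroup M] [Module k M] (f : C.shape.idx → M) :
    StringModule k C →ₗ[k] M :=
  Finsupp.linearCombination k f

variable {k C} in
theorem linExt_b {M : Type*} [AddCommGroup M] [Module k M] (f : C.shape.idx → M)
    (i : C.shape.idx) : linExt k C f (b k i) = f i :=
  (Finsupp.linearCombination_single k (1 : k) i).trans (one_smul k (f i))

variable {k C} in
theorem hom_ext {M : Type*} [AddCommGroup M] [Module k M] {f g : StringModule k C →ₗ[k] M}
    (h : ∀ i, f (b k i) = g (b k i)) : f = g :=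
  Finsupp.lhom_ext' fun i => LinearMap.ext_ring (h i)

open Classical in
/-- The action of the trivial path at `v`: `e_v b_i` is `b_i` if `v_i(C) = v`, and otherwise
zero. -/
noncomputable def vertexOp (v : Q) : Module.End k (StringModule k C) :=
  linExt k C fun i => if C.vertex i = some v then b k i else 0

open Classical in
/-- The action of the arrow `x`: `x b_i` is `b_{i-1}` if `C_i = x`, it is `b_{i+1}` if
`C_{i+1} = x⁻¹`, and otherwise zero. -/
noncomputable def arrowOp (x : Quiver.Total Q) : Module.End k (StringModule k C) :=
  linExt k C fun i =>
    if h : C.letter i = some (Letter.direct x) then b k ⟨i - 1, (Word.mem_of_letter h).2⟩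
    else if h : C.letter (i + 1) = some (Letter.inverse x) then
      b k ⟨i + 1, Word.mem_of_letter_succ h⟩
    else 0

variable {k C}

theorem vertexOp_b_of_eq {v : Q} {i : C.shape.idx} (h : C.vertex i = some v) :
    vertexOp k C v (b k i) = b k i := by
  rw [vertexOp, linExt_b, if_pos h]

theorem vertexOp_b_of_ne {v : Q} {i : C.shape.idx} (h : C.vertex i ≠ some v) :
    vertexOp k C v (b k i) = 0 := by
  rw [vertexOp, linExt_b, if_neg h]

theorem arrowOp_b_direct {x : Quiver.Total Q} {i : C.shape.idx}
    (h : C.letter i = some (Letter.direct x)) :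
    arrowOp k C x (b k i) = b k ⟨i - 1, (Word.mem_of_letter h).2⟩ := by
  rw [arrowOp, linExt_b, dif_pos h]

theorem arrowOp_b_inverse {x : Quiver.Total Q} {i : C.shape.idx}
    (h : C.letter (i + 1) = some (Letter.inverse x)) :
    arrowOp k C x (b k i) = b k ⟨i + 1, Word.mem_of_letter_succ h⟩ := by
  have h' : C.letter i ≠ some (Letter.direct x) := fun h' => C.reduced i _ _ h' h rfl
  rw [arrowOp, linExt_b, dif_neg h', dif_pos h]

theorem arrowOp_b_zero {x : Quiver.Total Q} {i : C.shape.idx}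
    (h : C.letter i ≠ some (Letter.direct x))
    (h' : C.letter (i + 1) ≠ some (Letter.inverse x)) : arrowOp k C x (b k i) = 0 := by
  rw [arrowOp, linExt_b, dif_neg h, dif_neg h']

theorem vertexOp_mul_self (v : Q) : vertexOp k C v * vertexOp k C v = vertexOp k C v := by
  refine hom_ext fun i => ?_
  rw [Module.End.mul_apply]
  by_cases h : C.vertex i = some v
  · simp only [vertexOp_b_of_eq h]
  · rw [vertexOp_b_of_ne h, map_zero]

theorem vertexOp_mul_of_ne (v w : Q) (hvw : v ≠ w) : vertexOp k C v * vertexOp k C w = 0 := by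
  refine hom_ext fun i => ?_
  rw [Module.End.mul_apply, LinearMap.zero_apply]
  by_cases h : C.vertex i = some w
  · rw [vertexOp_b_of_eq h, vertexOp_b_of_ne]
    rw [h]
    exact fun h' => hvw (Option.some.inj h').symm
  · rw [vertexOp_b_of_ne h, map_zero]

theorem vertexOp_mul_arrowOp (x : Quiver.Total Q) :
    vertexOp k C x.right * arrowOp k C x = arrowOp k C x := by
  refine hom_ext fun i => ?_
  rw [Module.End.mul_apply]
  by_cases h : C.letter i = some (Letter.direct x)
  · rw [arrowOp_b_direct h, vertexOp_b_of_eq]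
    exact Word.vertex_of_letter_succ (i := i - 1) (l := Letter.direct x)
      (by rw [sub_add_cancel]; exact h)
  · by_cases h' : C.letter (i + 1) = some (Letter.inverse x)
    · rw [arrowOp_b_inverse h', vertexOp_b_of_eq]
      exact Word.vertex_of_letter h'
    · rw [arrowOp_b_zero h h', map_zero]

/-- A path that does not kill `b_i` occurs in `C`, itself or as its inverse. -/
theorem pathOp_b {a c : Q} (p : Quiver.Path a c) (i : C.shape.idx) :
    PathAlgebra.pathOp (vertexOp k C) (arrowOp k C) p (b k i) = 0 ∨
    ∃ j : C.shape.idx,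
      PathAlgebra.pathOp (vertexOp k C) (arrowOp k C) p (b k i) = b k j ∧
      (((j : ℤ) + (arrowList p).length = i ∧ ∀ r : ℕ, r < (arrowList p).length →
          C.letter (j + 1 + r) = ((arrowList p).map Letter.direct)[r]?) ∨
        ((i : ℤ) + (arrowList p).length = j ∧ ∀ r : ℕ, r < (arrowList p).length →
          C.letter (i + 1 + r) = ((arrowList p).map Letter.inverse).reverse[r]?)) := by
  induction p with
  | nil =>
    by_cases h : C.vertex i = some a
    · exact Or.inr ⟨i, vertexOp_b_of_eq h, Or.inl (by simp [arrowList])⟩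
    · exact Or.inl (vertexOp_b_of_ne h)
  | @cons c d p x ih =>
    rw [PathAlgebra.pathOp, Module.End.mul_apply]
    rcases ih with ih | ⟨j, hj, ih⟩
    · left; rw [ih, map_zero]
    · rw [hj]
      by_cases h : C.letter j = some (Letter.direct ⟨c, d, x⟩)
      · right
        refine ⟨_, arrowOp_b_direct h, Or.inl ?_⟩
        have hd : (j : ℤ) + (arrowList p).length = i ∧ ∀ r : ℕ, r < (arrowList p).length →
            C.letter (j + 1 + r) = ((arrowList p).map Letter.direct)[r]? := by
          rcases ih with ih | ⟨ih1, ih2⟩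
          · exact ih
          · rcases Nat.eq_zero_or_pos (arrowList p).length with h0 | h0
            · refine ⟨by omega, fun r hr => by omega⟩
            · exfalso
              have h1 := ih2 ((arrowList p).length - 1) (by omega)
              have h2 : (i : ℤ) + 1 + (((arrowList p).length - 1 : ℕ) : ℤ) = j := by omega
              rw [h2, h, List.getElem?_reverse (by simp; omega), List.getElem?_map] at h1
              obtain ⟨y, -, hy⟩ := Option.map_eq_some_iff.1 h1.symm
              cases hy
        refine ⟨by rw [arrowList, List.length_cons]; push_cast; omega, fun r hr => ?_⟩
        rw [arrowList, List.length_cons] at hr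
        rw [arrowList, List.map_cons]
        cases r with
        | zero => simpa using h
        | succ r =>
          rw [List.getElem?_cons_succ, ← hd.2 r (by omega)]
          congr 1
          push_cast
          ring
      · by_cases h' : C.letter (j + 1) = some (Letter.inverse ⟨c, d, x⟩)
        · right
          refine ⟨_, arrowOp_b_inverse h', Or.inr ?_⟩
          have hd : (i : ℤ) + (arrowList p).length = j ∧ ∀ r : ℕ, r < (arrowList p).length →
              C.letter (i + 1 + r) = ((arrowList p).map Letter.inverse).reverse[r]? := by
            rcases ih with ⟨ih1, ih2⟩ | ih
            · rcases Nat.eq_zero_or_pos (arrowList p).length with h0 | h0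
              · refine ⟨by omega, fun r hr => by omega⟩
              · exfalso
                have h1 := ih2 0 h0
                rw [Nat.cast_zero, add_zero, h', List.getElem?_map] at h1
                obtain ⟨y, -, hy⟩ := Option.map_eq_some_iff.1 h1.symm
                cases hy
            · exact ih
          refine ⟨by rw [arrowList, List.length_cons]; push_cast; omega, fun r hr => ?_⟩
          rw [arrowList, List.length_cons] at hr
          rw [arrowList, List.map_cons, List.reverse_cons]
          rcases Nat.lt_or_ge r (arrowList p).length with hr' | hr'
          · rw [hd.2 r hr', List.getElem?_append_left (by simpa using hr')]
          · have hr2 : r = (arrowList p).length := by omega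
            subst hr2
            rw [List.getElem?_append_right (by simp)]
            have h3 : (i : ℤ) + 1 + (arrowList p).length = j + 1 := by omega
            rw [h3, h']
            simp
        · left
          exact arrowOp_b_zero h h'

theorem pathOp_relation (p : QPath Q) (hp : p ∈ ρ) :
    PathAlgebra.pathOp (vertexOp k C) (arrowOp k C) p.2.2 = 0 := by
  refine hom_ext fun i => ?_
  rcases pathOp_b (k := k) p.2.2 i with h | ⟨j, -, h | h⟩
  · exact h
  · exact absurd ⟨j + 1, fun r hr => h.2 r (by simpa using hr)⟩ (C.no_relation p hp)
  · exact absurd ⟨i + 1, fun r hr => h.2 r (by simpa using hr)⟩ (C.no_inverse_relation p hp)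

variable (k C)

/-- The action of `Λ` on `M(C)`. -/
noncomputable def action : QuiverAlgebra k ρ →ₙₐ[k] Module.End k (StringModule k C) :=
  QuiverAlgebra.lift
    (PathAlgebra.lift (vertexOp k C) (arrowOp k C) vertexOp_mul_self vertexOp_mul_of_ne
      vertexOp_mul_arrowOp)
    fun p hp => by rw [PathAlgebra.lift_ofPath, pathOp_relation p hp]

noncomputable instance : Module (OneAdjoined k ρ) (StringModule k C) :=
  Module.compHom (StringModule k C) (Unitization.lift (action k C)).toRingHom

variable {k C}

theorem smul_def (r : OneAdjoined k ρ) (m : StringModule k C) :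
    r • m = Unitization.lift (action k C) r m := rfl

theorem inl_smul (c : k) (m : StringModule k C) :
    (Unitization.inl c : OneAdjoined k ρ) • m = c • m := by
  rw [smul_def]
  simp [Unitization.lift, Algebra.algebraMap_eq_smul_one]

theorem inr_smul (a : QuiverAlgebra k ρ) (m : StringModule k C) :
    (a : OneAdjoined k ρ) • m = action k C a m := by
  rw [smul_def]
  simp [Unitization.lift]

theorem smul_smul_aux (c : k) (r : OneAdjoined k ρ) (m : StringModule k C) :
    (c • r) • m = c • r • m := by
  rw [smul_def, smul_def, map_smul, LinearMap.smul_apply]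

instance : IsScalarTower k (OneAdjoined k ρ) (StringModule k C) := ⟨smul_smul_aux⟩

/-- A linear endomorphism that commutes with the trivial paths and the arrows commutes with all
of `Λ`. -/
theorem map_smul_of_commute (f : Module.End k (StringModule k C))
    (hv : ∀ v, f * vertexOp k C v = vertexOp k C v * f)
    (hx : ∀ x, f * arrowOp k C x = arrowOp k C x * f) (r : OneAdjoined k ρ)
    (m : StringModule k C) : f (r • m) = r • f m := by
  have hp : ∀ {a c : Q} (p : Quiver.Path a c),
      f * PathAlgebra.pathOp (vertexOp k C) (arrowOp k C) p =
        PathAlgebra.pathOp (vertexOp k C) (arrowOp k C) p * f := by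
    intro a c p
    induction p with
    | nil => exact hv a
    | cons p x ih => rw [PathAlgebra.pathOp, ← mul_assoc, hx, mul_assoc, ih, mul_assoc]
  have ha : ∀ a : QuiverAlgebra k ρ, f * action k C a = action k C a * f := by
    intro a
    obtain ⟨a, rfl⟩ := QuiverAlgebra.mk_surjective k ρ a
    let φ : PathAlgebra k Q →ₙₐ[k] Module.End k (StringModule k C) :=
      PathAlgebra.lift (vertexOp k C) (arrowOp k C) vertexOp_mul_self vertexOp_mul_of_ne
        vertexOp_mul_arrowOp
    let φ' : PathAlgebra k Q →ₗ[k] Module.End k (StringModule k C) := φ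
    have key : (LinearMap.mulLeft k f).comp φ' = (LinearMap.mulRight k f).comp φ' := by
      refine PathAlgebra.hom_ext fun p => ?_
      change f * φ (PathAlgebra.ofPath p) = φ (PathAlgebra.ofPath p) * f
      rw [PathAlgebra.lift_ofPath, hp]
    exact LinearMap.congr_fun key a
  induction r using Unitization.ind with
  | inl_add_inr c a =>
    rw [add_smul, add_smul, inl_smul, inl_smul, inr_smul, inr_smul, map_add, map_smul]
    congr 1
    exact LinearMap.congr_fun (ha a) m

end StringModule

/-! ## Band modules -/

/-- The string module `M(C)` of a periodic word `C`, with its additional module structure over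
`k[T, T⁻¹]`. -/
def PeriodicStringModule {C : Word ρ} (_ : C.IsPeriodic) := StringModule k C

namespace PeriodicStringModule

variable {C : Word ρ} (hC : C.IsPeriodic)

noncomputable instance : AddCommGroup (PeriodicStringModule k hC) :=
  inferInstanceAs (AddCommGroup (StringModule k C))

noncomputable instance : Module k (PeriodicStringModule k hC) :=
  inferInstanceAs (Module k (StringModule k C))

noncomputable instance : Module (OneAdjoined k ρ) (PeriodicStringModule k hC) :=
  inferInstanceAs (Module (OneAdjoined k ρ) (StringModule k C))

instance : IsScalarTower k (OneAdjoined k ρ) (PeriodicStringModule k hC) :=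
  inferInstanceAs (IsScalarTower k (OneAdjoined k ρ) (StringModule k C))

variable {k hC}

theorem mem_idx (hC : C.IsPeriodic) (i : ℤ) : i ∈ C.shape.idx := by
  rw [hC.1]; exact Set.mem_univ i

theorem letter_add_mul_period (hC : C.IsPeriodic) (i m : ℤ) :
    C.letter (i + m * C.period) = C.letter i := by
  have hper : Function.Periodic C.letter (C.period : ℤ) := by
    intro i
    have h : C.shift C.period = C := (Nat.sInf_mem hC.2).2
    have h' := congrFun (congrArg Word.letter h) i
    simpa [Word.shift, hC.1, Shape.offset] using h'
  exact hper.int_mul m i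

theorem vertex_add_mul_period (hC : C.IsPeriodic) (i m : ℤ) :
    C.vertex (i + m * C.period) = C.vertex i := by
  have h : i + m * C.period + 1 = i + 1 + m * C.period := by ring
  rw [Word.vertex, Word.vertex, h, letter_add_mul_period hC, letter_add_mul_period hC]

variable (k hC)

/-- The linear map `b_i ↦ b_{i-mn}`, where `n` is the period of `C`. -/
noncomputable def shiftLin (m : ℤ) : Module.End k (StringModule k C) :=
  StringModule.linExt k C fun i => StringModule.b k ⟨i - m * C.period, mem_idx hC _⟩

variable {k hC}

theorem shiftLin_b (m : ℤ) (i : C.shape.idx) :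
    shiftLin k hC m (StringModule.b k i) =
      StringModule.b k ⟨i - m * C.period, mem_idx hC _⟩ :=
  StringModule.linExt_b _ i

theorem shiftLin_vertexOp (m : ℤ) (v : Q) :
    shiftLin k hC m * StringModule.vertexOp k C v =
      StringModule.vertexOp k C v * shiftLin k hC m := by
  refine StringModule.hom_ext fun i => ?_
  rw [Module.End.mul_apply, Module.End.mul_apply, shiftLin_b]
  have hv : C.vertex ((i : ℤ) - m * C.period) = C.vertex i := by
    rw [← vertex_add_mul_period hC _ m, sub_add_cancel]
  by_cases h : C.vertex i = some v
  · rw [StringModule.vertexOp_b_of_eq h, StringModule.vertexOp_b_of_eq (hv.trans h), shiftLin_b]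
  · rw [StringModule.vertexOp_b_of_ne h, map_zero, StringModule.vertexOp_b_of_ne]
    exact fun h' => h (hv.symm.trans h')

theorem shiftLin_arrowOp (m : ℤ) (x : Quiver.Total Q) :
    shiftLin k hC m * StringModule.arrowOp k C x =
      StringModule.arrowOp k C x * shiftLin k hC m := by
  refine StringModule.hom_ext fun i => ?_
  rw [Module.End.mul_apply, Module.End.mul_apply, shiftLin_b]
  have h1 : C.letter ((i : ℤ) - m * C.period) = C.letter i := by
    rw [← letter_add_mul_period hC _ m, sub_add_cancel]
  have h2 : C.letter ((i : ℤ) - m * C.period + 1) = C.letter (i + 1) := by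
    rw [← letter_add_mul_period hC _ m]; congr 1; ring
  by_cases h : C.letter i = some (Letter.direct x)
  · rw [StringModule.arrowOp_b_direct h, StringModule.arrowOp_b_direct (h1.trans h), shiftLin_b]
    congr 2; ring
  · by_cases h' : C.letter (i + 1) = some (Letter.inverse x)
    · rw [StringModule.arrowOp_b_inverse h', StringModule.arrowOp_b_inverse (h2.trans h'),
        shiftLin_b]
      congr 2; ring
    · rw [StringModule.arrowOp_b_zero h h', map_zero, StringModule.arrowOp_b_zero]
      · exact fun h'' => h (h1.symm.trans h'')
      · exact fun h'' => h' (h2.symm.trans h'')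

variable (k hC)

/-- The automorphism `b_i ↦ b_{i-mn}` of the `Λ`-module `M(C)`, where `n` is the period of `C`. -/
noncomputable def shiftEnd (m : ℤ) : Module.End (OneAdjoined k ρ) (PeriodicStringModule k hC) where
  toFun := shiftLin k hC m
  map_add' := map_add (shiftLin k hC m)
  map_smul' := StringModule.map_smul_of_commute _ (shiftLin_vertexOp m) (shiftLin_arrowOp m)

/-- The homomorphism `T^m ↦ (b_i ↦ b_{i-mn})`. -/
noncomputable def shiftHom :
    Multiplicative ℤ →* Module.End (OneAdjoined k ρ) (PeriodicStringModule k hC) where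
  toFun m := shiftEnd k hC m.toAdd
  map_one' := by
    have h : shiftLin k hC 0 = 1 := StringModule.hom_ext fun i => by
      rw [shiftLin_b, Module.End.one_apply]
      congr 2; ring
    exact LinearMap.ext fun z => LinearMap.congr_fun h z
  map_mul' m m' := by
    have h : shiftLin k hC (m.toAdd + m'.toAdd) =
        shiftLin k hC m.toAdd * shiftLin k hC m'.toAdd := StringModule.hom_ext fun i => by
      rw [Module.End.mul_apply, shiftLin_b, shiftLin_b, shiftLin_b]
      congr 2; ring
    exact LinearMap.ext fun z => LinearMap.congr_fun h z

/-- The action of `k[T, T⁻¹]` on `M(C)`: `T` acts as `b_i ↦ b_{i-n}`, where `n` is the period. -/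
noncomputable def laurentHom :
    k[T;T⁻¹] →ₐ[k] Module.End (OneAdjoined k ρ) (PeriodicStringModule k hC) :=
  AddMonoidAlgebra.lift k _ ℤ (shiftHom k hC)

noncomputable instance : Module k[T;T⁻¹] (PeriodicStringModule k hC) :=
  Module.compHom (PeriodicStringModule k hC) (laurentHom k hC).toRingHom

instance : SMulCommClass k[T;T⁻¹] (OneAdjoined k ρ) (PeriodicStringModule k hC) :=
  ⟨fun f r m => map_smul (laurentHom k hC f) r m⟩

instance : SMulCommClass (OneAdjoined k ρ) k[T;T⁻¹] (PeriodicStringModule k hC) :=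
  SMulCommClass.symm _ _ _

end PeriodicStringModule

/-- The module `M(C, V) = M(C) ⊗ V` over `Λ`, the tensor product over `k[T, T⁻¹]`. It is a band
module if `V` is finite-dimensional and indecomposable. -/
abbrev BandModule {C : Word ρ} (hC : C.IsPeriodic) (V : Type*) [AddCommGroup V]
    [Module k[T;T⁻¹] V] :=
  PeriodicStringModule k hC ⊗[k[T;T⁻¹]] V

/-- The `k[T, T⁻¹]`-module `V⁻¹`: it is `V` with the actions of `T` and `T⁻¹` exchanged. -/
def InvModule (V : Type*) := V

instance (V : Type*) [AddCommGroup V] : AddCommGroup (InvModule V) :=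
  inferInstanceAs (AddCommGroup V)

noncomputable instance (V : Type*) [AddCommGroup V] [Module k[T;T⁻¹] V] :
    Module k[T;T⁻¹] (InvModule V) :=
  Module.compHom V (LaurentPolynomial.invert (R := k)).toRingEquiv.toRingHom

/-- The `k[T, T⁻¹]`-module `V` is finite-dimensional over `k` and indecomposable. -/
def IsBandCoefficient (V : Type*) [AddCommGroup V] [Module k[T;T⁻¹] V] : Prop :=
  Module.Finite k (RestrictScalars k k[T;T⁻¹] V) ∧ IsIndecomposableModule k[T;T⁻¹] V

end StringModules

/-- `N` is isomorphic to a string module. -/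
def IsStringModule (k : Type*) [Field k] {Q : Type*} [Quiver Q] (ρ : Set (QPath Q))
    (N : Type*) [AddCommGroup N] [Module (OneAdjoined k ρ) N] : Prop :=
  ∃ C : Word ρ, Nonempty (N ≃ₗ[OneAdjoined k ρ] StringModule k C)

/-- `N` is isomorphic to a band module. -/
def IsBandModule.{w, u₁, u₂, u₃, u₄} (k : Type u₁) [Field k] {Q : Type u₂} [Quiver.{u₃} Q]
    (ρ : Set (QPath Q)) (N : Type u₄) [AddCommGroup N] [Module (OneAdjoined k ρ) N] : Prop :=
  ∃ (C : Word ρ) (hC : C.IsPeriodic) (V : Type w) (_ : AddCommGroup V) (_ : Module k[T;T⁻¹] V),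
    IsBandCoefficient k V ∧ Nonempty (N ≃ₗ[OneAdjoined k ρ] BandModule k hC V)


/-!
A string or band module has coordinates indexed by the positions of its word `C`, with coefficients
in `k` or in `V`, so a homomorphism has an entry for every pair of positions. A choice of signs for
the letters distinguishes the two half words that leave a position, and the half words of each sign
are ordered lexicographically, inverse letters coming first and direct letters last. If the entry
at a pair of positions is nonzero, then both half words at one position are below those at the
other: the entry is carried along the common part of the half words, and it would be killed by the
next arrow if they parted in the wrong direction. Homomorphisms are thus triangular, and their
diagonal consists of one map of coefficients, which for a periodic word commutes with `T`.

An isomorphism and its inverse have nonzero entries, which give comparisons in both directions, so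
the words are equivalent. An idempotent endomorphism vanishes if its diagonal does, so a module is
indecomposable as soon as every idempotent diagonal is `0` or `1`. The string module of a periodic
word is `M(C) ⊗ k[T, T⁻¹]`, hence it is indecomposable and not isomorphic to a band module.

For the finiteness conditions, the `b_i` up to a position before a direct letter span a submodule
of `M(C)`; infinitely many such letters give an increasing chain of proper submodules.
-/

section Generators

variable (k : Type*) {Q : Type*} [Field k] [Quiver Q] (ρ : Set (QPath Q))

namespace PathAlgebra

variable {k}

theorem ofPath_comp {a b c : Q} (p : Quiver.Path b c) (q : Quiver.Path a b) :
    (ofPath ⟨a, c, q.comp p⟩ : PathAlgebra k Q) = ofPath ⟨b, c, p⟩ * ofPath ⟨a, b, q⟩ := by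
  rw [ofPath_mul_ofPath, pathMul_comp]

@[elab_as_elim]
theorem induction_linear {P : PathAlgebra k Q → Prop} (x : PathAlgebra k Q) (zero : P 0)
    (add : ∀ x y, P x → P y → P (x + y)) (smul_ofPath : ∀ (c : k) p, P (c • ofPath p)) : P x := by
  induction x using Finsupp.induction_linear with
  | zero => exact zero
  | add x y hx hy => exact add x y hx hy
  | single p c =>
    have h : (Finsupp.single p c : PathAlgebra k Q) = c • ofPath p :=
      (Finsupp.smul_single_one p c).symm
    rw [h]
    exact smul_ofPath c p

end PathAlgebra

namespace QuiverAlgebra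

/-- The arrow `x` as an element of `Λ`. -/
noncomputable def arrow (x : Quiver.Total Q) : QuiverAlgebra k ρ :=
  mk k ρ (PathAlgebra.ofPath ⟨x.left, x.right, x.hom.toPath⟩)

variable {k ρ}

@[elab_as_elim]
theorem generator_induction {P : OneAdjoined k ρ → Prop} (r : OneAdjoined k ρ)
    (scalar : ∀ c : k, P (Unitization.inl c)) (idem : ∀ v, P (idem k ρ v : OneAdjoined k ρ))
    (arrow : ∀ x, P (arrow k ρ x : OneAdjoined k ρ)) (add : ∀ r s, P r → P s → P (r + s))
    (mul : ∀ r s, P r → P s → P (r * s)) : P r := by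
  have path {a b : Q} (p : Quiver.Path a b) :
      P (mk k ρ (PathAlgebra.ofPath ⟨a, b, p⟩) : OneAdjoined k ρ) := by
    induction p with
    | nil => exact idem a
    | @cons b c p x ih =>
      rw [← Quiver.Path.comp_toPath_eq_cons, PathAlgebra.ofPath_comp, mk_mul, Unitization.inr_mul]
      exact mul _ _ (arrow ⟨b, c, x⟩) ih
  induction r using Unitization.ind with
  | inl_add_inr c a =>
    refine add _ _ (scalar c) ?_
    obtain ⟨a, rfl⟩ := mk_surjective k ρ a
    induction a using PathAlgebra.induction_linear with
    | zero => simpa using scalar 0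
    | add x y hx hy => simpa using add _ _ hx hy
    | smul_ofPath c p =>
      rw [map_smul, ← Unitization.inl_mul_inr]
      exact mul _ _ (scalar c) (path p.2.2)

variable {M : Type*} [AddCommGroup M] [Module (OneAdjoined k ρ) M]

theorem smul_mem_of_generators (P : AddSubgroup M)
    (hc : ∀ (c : k), ∀ m ∈ P, (Unitization.inl c : OneAdjoined k ρ) • m ∈ P)
    (he : ∀ v, ∀ m ∈ P, (idem k ρ v : OneAdjoined k ρ) • m ∈ P)
    (hx : ∀ x, ∀ m ∈ P, (arrow k ρ x : OneAdjoined k ρ) • m ∈ P) (r : OneAdjoined k ρ) :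
    ∀ m ∈ P, r • m ∈ P := by
  induction r using generator_induction with
  | scalar c => exact hc c
  | idem v => exact he v
  | arrow x => exact hx x
  | add r s hr hs => exact fun m hm => add_smul r s m ▸ P.add_mem (hr m hm) (hs m hm)
  | mul r s hr hs => exact fun m hm => mul_smul r s m ▸ hr _ (hs m hm)

theorem map_smul_of_generators {M' : Type*} [AddCommGroup M'] [Module (OneAdjoined k ρ) M']
    (f : M →+ M')
    (hc : ∀ (c : k) m, f ((Unitization.inl c : OneAdjoined k ρ) • m) =
      (Unitization.inl c : OneAdjoined k ρ) • f m)
    (he : ∀ v m, f ((idem k ρ v : OneAdjoined k ρ) • m) = (idem k ρ v : OneAdjoined k ρ) • f m)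
    (hx : ∀ x m, f ((arrow k ρ x : OneAdjoined k ρ) • m) =
      (arrow k ρ x : OneAdjoined k ρ) • f m) (r : OneAdjoined k ρ) :
    ∀ m, f (r • m) = r • f m := by
  induction r using generator_induction with
  | scalar c => exact hc c
  | idem v => exact he v
  | arrow x => exact hx x
  | add r s hr hs => exact fun m => by rw [add_smul, add_smul, map_add, hr, hs]
  | mul r s hr hs => exact fun m => by rw [mul_smul, mul_smul, hr, hs]

end QuiverAlgebra

open QuiverAlgebra Filter

/-- The idempotent `∑ e_v` of `Λ`, the sum being over the vertices `v` in the finite set `S`.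
These elements are local units for `Λ`. -/
noncomputable def localUnit (S : Finset Q) : QuiverAlgebra k ρ := ∑ v ∈ S, idem k ρ v

theorem eventually_localUnit_mul (a : QuiverAlgebra k ρ) :
    ∀ᶠ S in atTop, localUnit k ρ S * a = a := by
  obtain ⟨a, rfl⟩ := mk_surjective k ρ a
  induction a using PathAlgebra.induction_linear with
  | zero => simp only [map_zero, mul_zero, eventually_true]
  | add x y hx hy =>
    filter_upwards [hx, hy] with S hx hy
    rw [map_add, mul_add, hx, hy]
  | smul_ofPath c p =>
    obtain ⟨a, b, p⟩ := p
    filter_upwards [eventually_ge_atTop {b}] with S hb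
    rw [map_smul, mul_smul_comm, localUnit, Finset.sum_mul,
      Finset.sum_eq_single_of_mem b (hb (Finset.mem_singleton_self b))]
    · rw [idem, ← mk_mul, ← PathAlgebra.ofPath_comp, Quiver.Path.comp_nil]
    · intro v _ hv
      rw [idem, ← mk_mul, PathAlgebra.ofPath_mul_ofPath, PathAlgebra.pathMul_eq_zero _ _ hv.symm,
        map_zero]

variable {k ρ} in
theorem localUnit_smul {M : Type*} [AddCommGroup M] [Module (OneAdjoined k ρ) M] (S : Finset Q)
    (m : M) : (localUnit k ρ S : OneAdjoined k ρ) • m =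
      ∑ v ∈ S, (idem k ρ v : OneAdjoined k ρ) • m := by
  rw [← Finset.sum_smul]
  exact congrArg (· • m) (map_sum (Unitization.inrHom k k (QuiverAlgebra k ρ)) _ S)

/-- The condition `Λ M = M` on a module `M`, in the form that every element of `M` is fixed by
all sufficiently large local units. -/
def IsUnitalModule (M : Type*) [AddCommGroup M] [Module (OneAdjoined k ρ) M] : Prop :=
  ∀ m : M, ∀ᶠ S in atTop, (localUnit k ρ S : OneAdjoined k ρ) • m = m

variable {k ρ}

namespace IsUnitalModule

variable {M N : Type*} [AddCommGroup M] [Module (OneAdjoined k ρ) M]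
  [AddCommGroup N] [Module (OneAdjoined k ρ) N]

theorem submodule (hM : IsUnitalModule k ρ M) (N : Submodule (OneAdjoined k ρ) M) :
    IsUnitalModule k ρ N :=
  fun m => (hM m).mono fun _ hS => Subtype.ext hS

theorem of_linearEquiv (hM : IsUnitalModule k ρ M) (e : M ≃ₗ[OneAdjoined k ρ] N) :
    IsUnitalModule k ρ N :=
  fun m => (hM (e.symm m)).mono fun _ hS => e.symm.injective (by rw [map_smul, hS])

theorem directSum {ι : Type*} {N : ι → Type*} [∀ i, AddCommGroup (N i)]
    [∀ i, Module (OneAdjoined k ρ) (N i)] (h : ∀ i, IsUnitalModule k ρ (N i)) :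
    IsUnitalModule k ρ (⨁ i, N i) := by
  classical
  intro m
  induction m using DirectSum.induction_on with
  | zero => exact .of_forall fun _ => smul_zero _
  | add x y hx hy =>
    filter_upwards [hx, hy] with S hx hy
    rw [smul_add, hx, hy]
  | of i x =>
    filter_upwards [h i x] with S hS
    rw [← DirectSum.lof_eq_of (OneAdjoined k ρ), ← map_smul, hS]

theorem isFinitelyGenerated_iff (hM : IsUnitalModule k ρ M) :
    IsFinitelyGenerated k ρ M ↔ Module.Finite (OneAdjoined k ρ) M := by
  classical
  constructor
  · rintro ⟨n, m, hm⟩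
    refine ⟨⟨Finset.univ.image m, eq_top_iff.2 fun z _ => ?_⟩⟩
    obtain ⟨a, rfl⟩ := hm z
    exact Submodule.sum_mem _ fun i _ => Submodule.smul_mem _ _ (Submodule.subset_span (by simp))
  · intro h
    obtain ⟨n, m, hm⟩ := Module.Finite.exists_fin (R := OneAdjoined k ρ) (M := M)
    refine ⟨n, m, fun z => ?_⟩
    obtain ⟨S, hS⟩ := (hM z).exists
    have hz : z ∈ Submodule.span (OneAdjoined k ρ) (Set.range m) := hm ▸ Submodule.mem_top
    obtain ⟨r, hr⟩ := (Submodule.mem_span_range_iff_exists_fun _).1 hz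
    -- `Λ` is an ideal of `OneAdjoined k ρ`, so a local unit turns the coefficients into elements
    -- of `Λ`.
    have coeff_mem (i : Fin n) : ∃ a : QuiverAlgebra k ρ, (a : OneAdjoined k ρ) =
        (localUnit k ρ S : OneAdjoined k ρ) * r i := by
      refine ⟨(r i).fst • localUnit k ρ S + localUnit k ρ S * (r i).snd, ?_⟩
      ext <;> simp
    choose a ha using coeff_mem
    refine ⟨a, ?_⟩
    rw [← hS, ← hr, Finset.smul_sum]
    exact Finset.sum_congr rfl fun i _ => by rw [ha, mul_smul]

theorem isFinitelyGenerated_submodule_iff (hM : IsUnitalModule k ρ M)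
    (N : Submodule (OneAdjoined k ρ) M) : IsFinitelyGenerated k ρ N ↔ N.FG := by
  rw [(hM.submodule N).isFinitelyGenerated_iff, Module.Finite.iff_fg]

theorem isFinitelyControlled_iff (hM : IsUnitalModule k ρ M) :
    IsFinitelyControlled k ρ M ↔ ∀ v : Q, ∃ N : Submodule (OneAdjoined k ρ) M,
      N.FG ∧ ∀ m : M, (idem k ρ v : OneAdjoined k ρ) • m ∈ N := by
  classical
  constructor
  · intro h v
    obtain ⟨N, hN, hm⟩ := h (idem k ρ v)
    exact ⟨N, (hM.isFinitelyGenerated_submodule_iff N).1 hN, hm⟩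
  · intro h a
    choose N hN hm using h
    obtain ⟨S, hS⟩ := (eventually_localUnit_mul k ρ a).exists
    refine ⟨⨆ v ∈ S, N v, (hM.isFinitelyGenerated_submodule_iff _).2
      (Submodule.fg_biSup S N fun v _ => hN v), fun m => ?_⟩
    rw [← hS, Unitization.inr_mul, mul_smul, localUnit_smul]
    exact Submodule.sum_mem _ fun v hv =>
      Submodule.mem_iSup_of_mem v (Submodule.mem_iSup_of_mem hv (hm v _))

end IsUnitalModule

end Generators

/-! ## Walking along words -/

section WordCombinatorics

variable {Q : Type*} [Quiver Q] {ρ : Set (QPath Q)}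

/-- The step to the right (`true`) or to the left (`false`). -/
def dirStep (δ : Bool) : ℤ := cond δ 1 (-1)

@[simp] theorem dirStep_true : dirStep true = 1 := rfl

@[simp] theorem dirStep_false : dirStep false = -1 := rfl

theorem dirStep_not (δ : Bool) : dirStep (!δ) = -dirStep δ := by cases δ <;> rfl

theorem dirStep_mul_self (δ : Bool) : dirStep δ * dirStep δ = 1 := by cases δ <;> rfl

theorem Letter.inv_ne (l : Letter Q) : l.inv ≠ l := by
  cases l <;> simp [Letter.inv]

theorem Letter.map_inv_map_inv (o : Option (Letter Q)) :
    (o.map Letter.inv).map Letter.inv = o := by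
  cases o <;> simp [Letter.inv_inv]

theorem Shape.zero_mem_idx (s : Shape) : (0 : ℤ) ∈ s.idx := by
  cases s <;> simp [Shape.idx]

theorem Shape.ordConnected_idx (s : Shape) : s.idx.OrdConnected := by
  cases s <;> simp only [Shape.idx] <;> infer_instance

theorem Shape.eq_of_translate {s t : Shape} {i j : ℤ} (h : ∀ m, i + m ∈ s.idx ↔ j + m ∈ t.idx) :
    t = s ∧ (i = j ∨ s = int) := by
  have h1 := h (-i)
  have h2 := h (-i - 1)
  have h3 := h (-j)
  have h4 := h (-j - 1)
  have h5 := h (s.mirror - i)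
  have h6 := h (s.mirror + 1 - i)
  have h7 := h (t.mirror - j)
  have h8 := h (t.mirror + 1 - j)
  cases s <;> cases t <;>
    simp only [idx, mirror, Set.mem_Icc, Set.mem_Ici, Set.mem_Iic, Set.mem_univ, iff_true,
      true_iff, reduceCtorEq, fin.injEq, or_false, or_true, and_true, true_and, false_and]
      at h1 h2 h3 h4 h5 h6 h7 h8 ⊢ <;>
    omega

namespace Word

variable (C D : Word ρ)

/-- The letter with which a walk along `C` leaves the position `i` in the direction `δ`. -/
def side (δ : Bool) (i : ℤ) : Option (Letter Q) :=
  match δ with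
  | true => C.letter (i + 1)
  | false => (C.letter i).map Letter.inv

variable {C D}

theorem side_step (δ : Bool) (i : ℤ) :
    C.side (!δ) (i + dirStep δ) = (C.side δ i).map Letter.inv := by
  cases δ
  · simp only [side, Bool.not_false, dirStep_false, Letter.map_inv_map_inv]
    congr 1; ring
  · rfl

theorem side_step_of_eq {δ : Bool} {i : ℤ} {l : Letter Q} (h : C.side δ i = some l) :
    C.side (!δ) (i + dirStep δ) = some l.inv := by
  rw [side_step, h]; rfl

theorem side_ne_side {δ : Bool} {i : ℤ} {l : Letter Q} (h : C.side δ i = some l) :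
    C.side (!δ) i ≠ some l := by
  intro h'
  cases δ
  · obtain ⟨m, hm, rfl⟩ := Option.map_eq_some_iff.1 h
    exact C.reduced i _ _ hm h' rfl
  · obtain ⟨m, hm, rfl⟩ := Option.map_eq_some_iff.1 h'
    exact C.reduced i _ _ hm h rfl

theorem eq_of_side_eq {δ δ' : Bool} {i : ℤ} {l : Letter Q} (h : C.side δ i = some l)
    (h' : C.side δ' i = some l) : δ' = δ := by
  by_contra hne
  rw [Bool.eq_not_of_ne hne] at h'
  exact side_ne_side h h'

theorem mem_of_side {δ : Bool} {i : ℤ} {l : Letter Q} (h : C.side δ i = some l) :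
    i ∈ C.shape.idx ∧ i + dirStep δ ∈ C.shape.idx := by
  cases δ
  · obtain ⟨m, hm, rfl⟩ := Option.map_eq_some_iff.1 h
    exact mem_of_letter hm
  · have := mem_of_letter (C := C) (i := i + 1) h
    rw [add_sub_cancel_right] at this
    exact this.symm

theorem dirStep_mul_mem_of_le {δ : Bool} {m n : ℤ} (h0 : 0 ≤ m) (hmn : m ≤ n)
    (h : dirStep δ * n ∈ C.shape.idx) : dirStep δ * m ∈ C.shape.idx := by
  cases δ
  · exact C.shape.ordConnected_idx.out h C.shape.zero_mem_idx ⟨by simpa, by simpa⟩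
  · exact C.shape.ordConnected_idx.out C.shape.zero_mem_idx h ⟨by simpa, by simpa⟩

theorem exists_side {δ : Bool} {i : ℤ} (h : i ∈ C.shape.idx) (h' : i + dirStep δ ∈ C.shape.idx) :
    ∃ l, C.side δ i = some l := by
  cases δ
  · obtain ⟨l, hl⟩ := Option.isSome_iff_exists.1 ((C.letter_isSome i).2 ⟨h, h'⟩)
    exact ⟨l.inv, by simp [side, hl]⟩
  · exact Option.isSome_iff_exists.1 ((C.letter_isSome (i + 1)).2 ⟨h', by simpa using h⟩)

theorem exists_vertex {i : ℤ} (hi : i ∈ C.shape.idx) : ∃ v, C.vertex i = some v := by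
  cases h : C.letter i with
  | some l => exact ⟨_, vertex_of_letter h⟩
  | none =>
    cases h' : C.letter (i + 1) with
    | some l => exact ⟨_, vertex_of_letter_succ h'⟩
    | none =>
      have h1 : ¬ (i ∈ C.shape.idx ∧ i - 1 ∈ C.shape.idx) := by
        rw [← C.letter_isSome, h]; simp
      have h2 : ¬ (i + 1 ∈ C.shape.idx ∧ i + 1 - 1 ∈ C.shape.idx) := by
        rw [← C.letter_isSome, h']; simp
      have h3 : C.shape = Shape.fin 0 := by
        cases hs : C.shape <;> rw [hs] at h1 h2 hi <;> simp [Shape.idx] at h1 h2 hi ⊢ <;> omega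
      obtain ⟨b, hb⟩ := Option.isSome_iff_exists.1 (C.base_isSome.2 h3)
      exact ⟨b.1, by simp [vertex, h, h', hb]⟩

theorem inv_inv : C.inv.inv = C := by
  obtain ⟨s, letter, base⟩ := C
  ext1
  · cases s <;> rfl
  · funext i
    have h : s.inv.mirror = s.mirror := by cases s <;> rfl
    simp only [inv, Letter.map_inv_map_inv, h]
    congr 1; ring
  · cases base <;> simp [inv]

variable (C) in
/-- Translation by `j - i` preserves the letters of `C`. -/
def SameAt (i j : ℤ) : Prop :=
  i ∈ C.shape.idx ∧ j ∈ C.shape.idx ∧ ∀ m, C.letter (i + m) = C.letter (j + m)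

theorem SameAt.refl {i : ℤ} (hi : i ∈ C.shape.idx) : C.SameAt i i := ⟨hi, hi, fun _ => rfl⟩

theorem SameAt.symm {i j : ℤ} (h : C.SameAt i j) : C.SameAt j i :=
  ⟨h.2.1, h.1, fun m => (h.2.2 m).symm⟩

theorem SameAt.trans {i j l : ℤ} (h : C.SameAt i j) (h' : C.SameAt j l) : C.SameAt i l :=
  ⟨h.1, h'.2.1, fun m => (h.2.2 m).trans (h'.2.2 m)⟩

theorem SameAt.side {i j : ℤ} (h : C.SameAt i j) (δ : Bool) : C.side δ i = C.side δ j := by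
  cases δ
  · have := h.2.2 0
    simp only [add_zero] at this
    simp only [Word.side, this]
  · exact h.2.2 1

theorem SameAt.vertex {i j : ℤ} (h : C.SameAt i j) : C.vertex i = C.vertex j := by
  have h0 := h.2.2 0
  simp only [add_zero] at h0
  simp only [Word.vertex, h0, h.2.2 1]

theorem SameAt.step {i j : ℤ} (h : C.SameAt i j) {δ : Bool} {l : Letter Q}
    (hl : C.side δ i = some l) : C.SameAt (i + dirStep δ) (j + dirStep δ) :=
  ⟨(mem_of_side hl).2, (mem_of_side ((h.side δ).symm.trans hl)).2, fun m => by
    rw [add_assoc, h.2.2, add_assoc]⟩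

theorem sameAt_iff_side {i j : ℤ} : C.SameAt i j ↔
    i ∈ C.shape.idx ∧ j ∈ C.shape.idx ∧ ∀ δ m, C.side δ (i + m) = C.side δ (j + m) := by
  refine and_congr_right fun _ => and_congr_right fun _ => ⟨fun h δ m => ?_, fun h m => ?_⟩
  · cases δ
    · simp only [Word.side, h m]
    · simp only [Word.side, add_assoc, h (m + 1)]
  · have h' := h true (m - 1)
    simpa only [Word.side, add_assoc, sub_add_cancel] using h'

theorem mem_iff_of_letter_eq {i j : ℤ} (hi : i ∈ C.shape.idx) (hj : j ∈ D.shape.idx)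
    (hl : ∀ m, C.letter (i + m) = D.letter (j + m)) (m : ℤ) :
    i + m ∈ C.shape.idx ↔ j + m ∈ D.shape.idx := by
  have hsome : ∀ m, (i + m ∈ C.shape.idx ∧ i + m - 1 ∈ C.shape.idx) ↔
      (j + m ∈ D.shape.idx ∧ j + m - 1 ∈ D.shape.idx) := fun m => by
    rw [← C.letter_isSome, ← D.letter_isSome, hl]
  have hC := C.shape.ordConnected_idx
  have hD := D.shape.ordConnected_idx
  rcases lt_trichotomy m 0 with hm | rfl | hm
  · have h := hsome (m + 1)
    rw [← add_assoc, ← add_assoc, add_sub_cancel_right, add_sub_cancel_right] at h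
    exact ⟨fun hm' => (h.1 ⟨hC.out hm' hi ⟨by omega, by omega⟩, hm'⟩).2,
      fun hm' => (h.2 ⟨hD.out hm' hj ⟨by omega, by omega⟩, hm'⟩).2⟩
  · simp only [add_zero, hi, hj]
  · exact ⟨fun hm' => ((hsome m).1 ⟨hm', hC.out hi hm' ⟨by omega, by omega⟩⟩).1,
      fun hm' => ((hsome m).2 ⟨hm', hD.out hj hm' ⟨by omega, by omega⟩⟩).1⟩

theorem SameAt.isPeriodic {i j : ℤ} (h : C.SameAt i j) (hij : i ≠ j) : C.IsPeriodic := by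
  wlog hlt : i < j generalizing i j
  · exact this h.symm hij.symm (by omega)
  have hshape : C.shape = Shape.int :=
    (Shape.eq_of_translate (mem_iff_of_letter_eq h.1 h.2.1 h.2.2)).2.resolve_left hij
  refine ⟨hshape, (j - i).toNat, by omega, ?_⟩
  ext1
  · rfl
  · funext m
    have hm := h.2.2 (m - i)
    rw [add_sub_cancel, show j + (m - i) = m + (j - i) by ring] at hm
    simp only [shift, hshape, Shape.offset, Int.toNat_of_nonneg (sub_nonneg.2 hlt.le), hm]
  · rfl

variable (C D) in
/-- A translation or a reflection of `ℤ` that identifies the words `C` and `D`. -/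
structure Match where
  flip : Bool
  offset : ℤ
  side_eq : ∀ δ i, C.side δ i = D.side (xor δ flip) (offset + dirStep (!flip) * i)
  vertex_eq : ∀ i, C.vertex i = D.vertex (offset + dirStep (!flip) * i)
  mem_iff : ∀ i, i ∈ C.shape.idx ↔ offset + dirStep (!flip) * i ∈ D.shape.idx

/-- The position of `D` that corresponds to the position `i` of `C`. -/
def Match.pos (e : Match C D) (i : ℤ) : ℤ := e.offset + dirStep (!e.flip) * i

theorem Match.pos_step (e : Match C D) (δ : Bool) (i : ℤ) :
    e.pos (i + dirStep δ) = e.pos i + dirStep (xor δ e.flip) := by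
  unfold Match.pos
  cases δ <;> cases e.flip <;> simp <;> ring

theorem Match.pos_add (e : Match C D) (i m : ℤ) :
    e.pos (i + m) = e.pos i + dirStep (!e.flip) * m := by
  unfold Match.pos; ring

theorem Match.side_eq_pos (e : Match C D) (δ : Bool) (i : ℤ) :
    C.side δ i = D.side (xor δ e.flip) (e.pos i) := e.side_eq δ i

theorem Match.mem_iff_pos (e : Match C D) (i : ℤ) :
    i ∈ C.shape.idx ↔ e.pos i ∈ D.shape.idx := e.mem_iff i

theorem Match.sameAt_iff (e : Match C D) {i j : ℤ} :
    C.SameAt i j ↔ D.SameAt (e.pos i) (e.pos j) := by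
  rw [sameAt_iff_side, sameAt_iff_side, ← e.mem_iff_pos, ← e.mem_iff_pos]
  refine and_congr_right fun _ => and_congr_right fun _ => ⟨fun h δ m => ?_, fun h δ m => ?_⟩
  · have h' := h (xor δ e.flip) (dirStep (!e.flip) * m)
    simpa only [e.side_eq_pos, e.pos_add, Bool.xor_assoc, Bool.xor_self, Bool.xor_false,
      ← mul_assoc, dirStep_mul_self, one_mul] using h'
  · rw [e.side_eq_pos, e.side_eq_pos, e.pos_add, e.pos_add, h]

theorem Match.pos_injective (e : Match C D) : Function.Injective e.pos := fun i j h => by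
  have h' := congrArg (dirStep (!e.flip) * ·) (add_left_cancel h)
  simpa only [← mul_assoc, dirStep_mul_self, one_mul] using h'

theorem Match.pos_surjective (e : Match C D) : Function.Surjective e.pos := fun j => by
  unfold Match.pos
  cases e.flip
  · exact ⟨j - e.offset, by simp⟩
  · exact ⟨e.offset - j, by simp⟩

variable (C) in
/-- The identification of `C` with `C[n]`. -/
def Match.shift (n : ℤ) : Match C (C.shift n) where
  flip := false
  offset := -C.shape.offset n
  side_eq δ i := by
    cases δ <;> simp only [side, Word.shift, Bool.not_false, dirStep_true, Bool.xor_false] <;>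
      congr 1
    · congr 1; ring
    · ring
  vertex_eq i := by
    simp only [vertex, Word.shift, Bool.not_false, dirStep_true]
    rw [show -C.shape.offset n + 1 * i + C.shape.offset n = i by ring,
      show -C.shape.offset n + 1 * i + 1 + C.shape.offset n = i + 1 by ring]
  mem_iff i := by
    change _ ↔ _ ∈ C.shape.idx
    rw [← C.shape.mem_idx_offset n (_ + _)]
    simp only [Bool.not_false, dirStep_true]
    rw [show -C.shape.offset n + 1 * i + C.shape.offset n = i by ring]

theorem vertex_inv (i : ℤ) : C.inv.vertex (C.shape.mirror - i) = C.vertex i := by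
  have h1 : C.inv.letter (C.shape.mirror - i) = (C.letter (i + 1)).map Letter.inv := by
    simp only [inv]; congr 2; ring
  have h2 : C.inv.letter (C.shape.mirror - i + 1) = (C.letter i).map Letter.inv := by
    simp only [inv]; congr 2; ring
  cases h : C.letter i with
  | some l =>
    rw [h] at h2
    rw [vertex_of_letter_succ h2, vertex_of_letter h, Letter.head_inv]
  | none =>
    cases h' : C.letter (i + 1) with
    | some l =>
      rw [h'] at h1
      rw [vertex_of_letter h1, vertex_of_letter_succ h', Letter.tail_inv]
    | none =>
      rw [h] at h2
      rw [h'] at h1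
      rw [vertex, h1, h2, vertex, h, h']
      cases hb : C.base <;> simp [inv, hb]

variable (C) in
/-- The identification of `C` with `C⁻¹[n]`. -/
def Match.invShift (n : ℤ) : Match C (C.inv.shift n) where
  flip := true
  offset := C.shape.mirror - C.inv.shape.offset n
  side_eq δ i := by
    cases δ
    · simp only [side, Word.shift, inv, Bool.not_true, dirStep_false, Bool.false_xor]
      congr 2; ring
    · simp only [side, Word.shift, inv, Bool.not_true, dirStep_false, Bool.xor_self,
        Letter.map_inv_map_inv]
      congr 1; ring
  vertex_eq i := by
    rw [← vertex_inv]
    simp only [vertex, Word.shift, Bool.not_true, dirStep_false]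
    rw [show C.shape.mirror - C.inv.shape.offset n + -1 * i + C.inv.shape.offset n =
        C.shape.mirror - i by ring,
      show C.shape.mirror - C.inv.shape.offset n + -1 * i + 1 + C.inv.shape.offset n =
        C.shape.mirror - i + 1 by ring]
  mem_iff i := by
    change _ ↔ _ ∈ C.inv.shape.idx
    rw [← C.inv.shape.mem_idx_offset n (_ + _)]
    change _ ↔ _ ∈ C.shape.inv.idx
    rw [C.shape.mem_idx_inv]
    simp only [Bool.not_true, dirStep_false]
    rw [show C.shape.mirror - (C.shape.mirror - C.inv.shape.offset n + -1 * i +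
      C.inv.shape.offset n) = i by ring]

theorem Equivalent.nonempty_match (h : C.Equivalent D) : Nonempty (Match C D) := by
  obtain ⟨n, rfl | rfl⟩ := h
  exacts [⟨Match.shift C n⟩, ⟨Match.invShift C n⟩]

theorem letter_eq_none (h : C.shape = Shape.fin 0) (m : ℤ) : C.letter m = none := by
  rw [← Option.not_isSome_iff_eq_none, C.letter_isSome, h]
  simp only [Shape.idx, Set.mem_Icc]
  omega

theorem equivalent_of_shape_eq_fin_zero (hC : C.shape = Shape.fin 0) (hD : D.shape = Shape.fin 0)
    {i j : ℤ} (hv : C.vertex i = D.vertex j) : C.Equivalent D := by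
  obtain ⟨⟨v, ε⟩, hb⟩ := Option.isSome_iff_exists.1 (C.base_isSome.2 hC)
  obtain ⟨⟨w, ε'⟩, hb'⟩ := Option.isSome_iff_exists.1 (D.base_isSome.2 hD)
  obtain rfl : v = w := by simpa [vertex, letter_eq_none hC, letter_eq_none hD, hb, hb'] using hv
  have hε : ε' = ε ∨ ε' = -ε := by
    rcases Int.units_eq_one_or ε with rfl | rfl <;>
      rcases Int.units_eq_one_or ε' with rfl | rfl <;> simp
  refine ⟨0, hε.imp ?_ ?_⟩ <;> rintro rfl <;> ext1
  · exact hD.trans hC.symm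
  · funext m
    exact (letter_eq_none hD m).trans (letter_eq_none (C := C.shift 0) hC m).symm
  · exact hb'.trans hb.symm
  · change D.shape = C.shape.inv
    rw [hD, hC, Shape.inv]
  · funext m
    rw [letter_eq_none hD, shift, inv]
    simp [letter_eq_none hC]
  · rw [hb', shift, inv]
    simp [hb]

theorem equivalent_of_letter_eq {i j : ℤ} (hi : i ∈ C.shape.idx) (hj : j ∈ D.shape.idx)
    (hl : ∀ m, C.letter (i + m) = D.letter (j + m)) (hv : C.vertex i = D.vertex j) :
    C.Equivalent D := by
  obtain ⟨hshape, hij⟩ := Shape.eq_of_translate (mem_iff_of_letter_eq hi hj hl)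
  by_cases h0 : C.shape = Shape.fin 0
  · exact equivalent_of_shape_eq_fin_zero h0 (hshape.trans h0) hv
  have hoffset : C.shape.offset (i - j) = i - j := by
    rcases hij with rfl | hC
    · cases C.shape <;> simp [Shape.offset]
    · rw [hC, Shape.offset]
  have hbase : C.base = none := by rwa [← Option.not_isSome_iff_eq_none, C.base_isSome]
  have hbase' : D.base = none := by
    rwa [← Option.not_isSome_iff_eq_none, D.base_isSome, hshape]
  refine ⟨i - j, Or.inl ?_⟩
  ext1
  · exact hshape
  · funext m
    have h := hl (m - j)
    rw [add_sub_cancel] at h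
    rw [← h]
    change _ = C.letter (m + C.shape.offset (i - j))
    rw [hoffset]
    congr 1; ring
  · exact hbase'.trans hbase.symm

theorem equivalent_of_inv_equivalent (h : C.inv.Equivalent D) : C.Equivalent D := by
  obtain ⟨n, h | h⟩ := h
  · exact ⟨n, Or.inr h⟩
  · rw [inv_inv] at h
    exact ⟨n, Or.inl h⟩

end Word

theorem exists_injOn_bool {α : Type*} {s : Set α} (hs : s.encard ≤ 2) :
    ∃ f : α → Bool, Set.InjOn f s := by
  classical
  rcases s.eq_empty_or_nonempty with rfl | ⟨a, ha⟩
  · exact ⟨fun _ => true, Set.injOn_empty _⟩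
  · refine ⟨fun x => decide (x = a), fun x hx y hy hxy => ?_⟩
    have hxy' : x = a ↔ y = a := by simpa using hxy
    by_contra hne
    have hxa : x ≠ a := fun h => hne (h.trans (hxy'.1 h).symm)
    have hya : y ≠ a := fun h => hxa (hxy'.2 h)
    have h3 : ({x, y, a} : Set α).encard = 3 := Set.encard_eq_three.2 ⟨x, y, a, hne, hxa, hya, rfl⟩
    have h4 : ({x, y, a} : Set α).encard ≤ s.encard := Set.encard_le_encard (by
      rintro z (rfl | rfl | rfl) <;> assumption)
    rw [h3] at h4
    exact absurd (h4.trans hs) (by decide)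

variable (ρ) in
/-- A choice of signs for the letters such that two letters with the same head and the same sign
are equal, or of the form `x⁻¹` and `y` with `xy` in `ρ`. -/
structure IsLetterSign (σ : Letter Q → Bool) : Prop where
  direct : ∀ x y : Quiver.Total Q, x.right = y.right → x ≠ y →
    σ (.direct x) ≠ σ (.direct y)
  inverse : ∀ x y : Quiver.Total Q, x.left = y.left → x ≠ y →
    σ (.inverse x) ≠ σ (.inverse y)
  mixed : ∀ {a b c : Q} (y : a ⟶ b) (x : b ⟶ c), (⟨a, c, y.toPath.cons x⟩ : QPath Q) ∉ ρ →
    σ (.direct ⟨a, b, y⟩) ≠ σ (.inverse ⟨b, c, x⟩)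

theorem IsStringAlgebra.exists_sign_tails (hρ : IsStringAlgebra ρ) {b : Q}
    {f : Quiver.Total Q → Bool} (hf : Set.InjOn f {x | x.right = b}) :
    ∃ g : Quiver.Total Q → Bool, Set.InjOn g {x | x.left = b} ∧
      ∀ {a c : Q} (y : a ⟶ b) (x : b ⟶ c), (⟨a, c, y.toPath.cons x⟩ : QPath Q) ∉ ρ →
        f ⟨a, b, y⟩ ≠ g ⟨b, c, x⟩ := by
  obtain ⟨g, hg⟩ := exists_injOn_bool (hρ.tails b)
  by_cases h : ∃ (a c : Q) (y : a ⟶ b) (x : b ⟶ c), (⟨a, c, y.toPath.cons x⟩ : QPath Q) ∉ ρ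
  · obtain ⟨a, c, y, x, hyx⟩ := h
    -- One of `g` and its negation separates `y` from `x`, and hence every other such pair.
    let t : Bool := xor (f ⟨a, b, y⟩) (!g ⟨b, c, x⟩)
    refine ⟨fun z => xor t (g z), fun z hz w hw hzw => hg hz hw (by simpa using hzw), ?_⟩
    intro a' c' y' x' h'
    by_cases hx : (⟨b, c, x⟩ : Quiver.Total Q) = ⟨b, c', x'⟩
    · cases hx
      rw [← hρ.unique_before x y y' hyx h']
      simp [t]
    · have hy : (⟨a, b, y⟩ : Quiver.Total Q) ≠ ⟨a', b, y'⟩ := fun hy => by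
        cases hy
        exact hx (hρ.unique_after y x x' hyx h')
      have hfy : f ⟨a', b, y'⟩ = !f ⟨a, b, y⟩ :=
        Bool.eq_not_of_ne fun h => hy (hf rfl rfl h.symm)
      have hgx : g ⟨b, c', x'⟩ = !g ⟨b, c, x⟩ :=
        Bool.eq_not_of_ne fun h => hx (hg rfl rfl h.symm)
      simp [t, hfy, hgx]
  · exact ⟨g, hg, fun y x hyx => absurd ⟨_, _, y, x, hyx⟩ h⟩

theorem IsStringAlgebra.exists_isLetterSign (hρ : IsStringAlgebra ρ) :
    ∃ σ : Letter Q → Bool, IsLetterSign ρ σ := by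
  choose f hf using fun v => exists_injOn_bool (hρ.heads v)
  choose g hg hfg using fun v => hρ.exists_sign_tails (hf v)
  refine ⟨fun | .direct x => f x.right x | .inverse x => g x.left x, ?_, ?_,
    fun y x h => hfg _ y x h⟩
  · intro x y hxy hne h
    simp only [← hxy] at h
    exact hne (hf x.right rfl hxy.symm h)
  · intro x y hxy hne h
    simp only [← hxy] at h
    exact hne (hg x.left rfl hxy.symm h)

theorem IsLetterSign.ne {σ : Letter Q → Bool} (hσ : IsLetterSign ρ σ) {C : Word ρ} {i : ℤ}
    {l l' : Letter Q} (h : C.letter i = some l) (h' : C.letter (i + 1) = some l') :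
    σ l.inv ≠ σ l' := by
  have hred := C.reduced i l l' h h'
  have hcomp := C.composable i l l' h h'
  cases l with
  | direct x =>
    cases l' with
    | direct y =>
      obtain ⟨b, c, x⟩ := x
      obtain ⟨a, b', y⟩ := y
      cases hcomp
      refine (hσ.mixed y x fun hρ => C.no_relation _ hρ ⟨i, fun r hr => ?_⟩).symm
      have hr' : r < 2 := hr
      interval_cases r
      · simpa [arrowList, Quiver.Hom.toPath] using h
      · simpa [arrowList, Quiver.Hom.toPath] using h'
    | inverse y =>
      exact hσ.inverse x y hcomp fun h => hred (by rw [h]; rfl)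
  | inverse x =>
    cases l' with
    | direct y =>
      exact hσ.direct x y hcomp fun h => hred (by rw [h]; rfl)
    | inverse y =>
      obtain ⟨a, b, x⟩ := x
      obtain ⟨b', c, y⟩ := y
      cases hcomp
      refine hσ.mixed x y fun hρ => C.no_inverse_relation _ hρ ⟨i, fun r hr => ?_⟩
      have hr' : r < 2 := by simpa [arrowList, Quiver.Hom.toPath] using hr
      interval_cases r
      · simpa [arrowList, Quiver.Hom.toPath] using h
      · simpa [arrowList, Quiver.Hom.toPath] using h'

theorem IsLetterSign.side_ne {σ : Letter Q → Bool} (hσ : IsLetterSign ρ σ) {C : Word ρ} {δ : Bool}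
    {i : ℤ} {l l' : Letter Q} (h : C.side δ i = some l) (h' : C.side (!δ) i = some l') :
    σ l ≠ σ l' := by
  cases δ
  · obtain ⟨m, hm, rfl⟩ := Option.map_eq_some_iff.1 h
    exact hσ.ne hm h'
  · obtain ⟨m, hm, rfl⟩ := Option.map_eq_some_iff.1 h'
    exact (hσ.ne hm h).symm

end WordCombinatorics

/-! ## The order on half words -/

section HalfWords

variable {Q : Type*} [Quiver Q] {ρ : Set (QPath Q)}

/-- The position of a letter, or of the end of a word (`none`), in the order in which inverse
letters come first and direct letters come last. -/
def letterRank : Option (Letter Q) → ℕ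
  | some (.inverse _) => 0
  | none => 1
  | some (.direct _) => 2

/-- Letters of the same rank are incomparable, so that half words, ordered lexicographically, are
incomparable where they first differ in two inverse or in two direct letters. -/
instance : PartialOrder (Option (Letter Q)) where
  le a b := a = b ∨ letterRank a < letterRank b
  lt a b := letterRank a < letterRank b
  le_refl _ := Or.inl rfl
  le_trans a b c := by grind
  le_antisymm a b := by grind
  lt_iff_le_not_ge a b := by grind

theorem letter_le_of_imp {a b : Option (Letter Q)}
    (hdirect : ∀ x, a = some (.direct x) → b = some (.direct x))
    (hinverse : ∀ x, b = some (.inverse x) → a = some (.inverse x)) : a ≤ b := by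
  by_cases h : a = b
  · exact h.le
  refine Or.inr ?_
  rcases a with - | (x | x) <;> rcases b with - | (y | y) <;> simp_all [letterRank]

theorem toLex_le_of_forall_eq_imp_le {ι α : Type*} [LinearOrder ι] [WellFoundedLT ι]
    [PartialOrder α] {a b : ι → α} (h : ∀ r, (∀ s < r, a s = b s) → a r ≤ b r) :
    toLex a ≤ toLex b := by
  by_cases hab : a = b
  · exact (congrArg toLex hab).le
  obtain ⟨r, hr, hmin⟩ := WellFounded.has_min wellFounded_lt {r | a r ≠ b r}
    (Function.ne_iff.1 hab)
  have heq : ∀ s < r, a s = b s := fun s hs => not_not.1 fun hne => hmin s hne hs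
  exact le_of_lt ⟨r, heq, (h r heq).lt_of_ne hr⟩

namespace Word

variable (C D : Word ρ)

/-- The letters of a walk along `C` from the position `i` in the direction `δ`. -/
def half (δ : Bool) (i : ℤ) : ℕ → Option (Letter Q) := fun r => C.side δ (i + dirStep δ * r)

variable (σ : Letter Q → Bool)

/-- The sign of the side `δ` of the position `i` of `C`. -/
def sideSign (δ : Bool) (i : ℤ) : Bool :=
  match C.side δ i, C.side (!δ) i with
  | some l, _ => σ l
  | none, some l => !σ l
  | none, none => δ

variable {C D σ}

theorem sideSign_of_side {δ : Bool} {i : ℤ} {l : Letter Q} (h : C.side δ i = some l) :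
    C.sideSign σ δ i = σ l := by
  simp [sideSign, h]

theorem sideSign_not (hσ : IsLetterSign ρ σ) (δ : Bool) (i : ℤ) :
    C.sideSign σ (!δ) i = !C.sideSign σ δ i := by
  cases h : C.side δ i with
  | some l =>
    cases h' : C.side (!δ) i with
    | some l' =>
      rw [sideSign_of_side h, sideSign_of_side h']
      exact Bool.eq_not_of_ne (hσ.side_ne h h').symm
    | none => simp [sideSign, h, h']
  | none =>
    cases h' : C.side (!δ) i with
    | some l' => simp [sideSign, h, h']
    | none => simp [sideSign, h, h']

theorem sideSign_xor (hσ : IsLetterSign ρ σ) (δ t : Bool) (i : ℤ) :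
    C.sideSign σ (xor δ t) i = xor (C.sideSign σ δ i) t := by
  cases t
  · simp
  · simp [sideSign_not hσ]

variable (C D σ) in
/-- The comparison of a position of `C` with a position of `D`, by means of the half words of
the same sign. -/
def Below (i j : ℤ) : Prop :=
  C.vertex i = D.vertex j ∧ ∀ δ δ', C.sideSign σ δ i = D.sideSign σ δ' j →
    toLex (C.half δ i) ≤ toLex (D.half δ' j)

theorem exists_sideSign_eq (hσ : IsLetterSign ρ σ) (i : ℤ) (s : Bool) :
    ∃ δ, C.sideSign σ δ i = s := by
  refine ⟨xor true (xor (C.sideSign σ true i) s), ?_⟩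
  rw [sideSign_xor hσ]
  simp

theorem Below.trans (hσ : IsLetterSign ρ σ) {E : Word ρ} {i j l : ℤ} (h : Below C D σ i j)
    (h' : Below D E σ j l) : Below C E σ i l := by
  refine ⟨h.1.trans h'.1, fun δ δ'' hδ => ?_⟩
  obtain ⟨δ', hδ'⟩ := exists_sideSign_eq (C := D) hσ j (C.sideSign σ δ i)
  exact (h.2 δ δ' hδ'.symm).trans (h'.2 δ' δ'' (hδ'.trans hδ))

theorem Below.exists_flip (hσ : IsLetterSign ρ σ) {i j : ℤ} (h : Below C D σ i j)
    (h' : Below D C σ j i) : ∃ t : Bool, C.sideSign σ true i = D.sideSign σ (xor true t) j ∧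
      ∀ δ, C.half δ i = D.half (xor δ t) j := by
  obtain ⟨t, ht⟩ : ∃ t, C.sideSign σ true i = D.sideSign σ (xor true t) j :=
    ⟨xor (C.sideSign σ true i) (D.sideSign σ true j), by
      rw [sideSign_xor hσ, Bool.xor_comm (C.sideSign σ true i), ← Bool.xor_assoc]
      simp⟩
  have hs : ∀ δ, C.sideSign σ δ i = D.sideSign σ (xor δ t) j
    | true => ht
    | false => by
      have hC := sideSign_not (C := C) hσ true i
      have hD := sideSign_not (C := D) hσ (xor true t) j
      rw [← ht, ← hC] at hD
      simpa using hD.symm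
  exact ⟨t, ht, fun δ => toLex.injective
    (le_antisymm (h.2 δ _ (hs δ)) (h'.2 _ δ (hs δ).symm))⟩

theorem letter_eq_of_half_eq {i j : ℤ} (h : ∀ δ, C.half δ i = D.half δ j) (m : ℤ) :
    C.letter (i + m) = D.letter (j + m) := by
  rcases le_or_gt m 0 with hm | hm
  · have := congrFun (h false) (-m).toNat
    simp only [half, side, dirStep_false] at this
    rw [Int.toNat_of_nonneg (by omega)] at this
    have h' := congrArg (Option.map Letter.inv) this
    rw [Letter.map_inv_map_inv, Letter.map_inv_map_inv] at h'
    convert h' using 2 <;> ring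
  · have := congrFun (h true) (m - 1).toNat
    simp only [half, side, dirStep_true] at this
    rw [Int.toNat_of_nonneg (by omega)] at this
    convert this using 2 <;> ring

theorem letter_eq_of_half_eq_not {i j : ℤ} (h : ∀ δ, C.half δ i = D.half (!δ) j) (m : ℤ) :
    C.letter (i + m) = (D.letter (j + 1 - m)).map Letter.inv := by
  rcases le_or_gt m 0 with hm | hm
  · have := congrFun (h false) (-m).toNat
    simp only [half, side, dirStep_false, Bool.not_false, dirStep_true] at this
    rw [Int.toNat_of_nonneg (by omega)] at this
    have h' := congrArg (Option.map Letter.inv) this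
    rw [Letter.map_inv_map_inv] at h'
    convert h' using 2
    · ring
    · congr 1; ring
  · have := congrFun (h true) (m - 1).toNat
    simp only [half, side, dirStep_true, Bool.not_true, dirStep_false] at this
    rw [Int.toNat_of_nonneg (by omega)] at this
    convert this using 2
    · ring
    · congr 1; ring

theorem Below.equivalent (hσ : IsLetterSign ρ σ) {i j : ℤ} (hi : i ∈ C.shape.idx)
    (hj : j ∈ D.shape.idx) (h : Below C D σ i j) (h' : Below D C σ j i) : C.Equivalent D := by
  obtain ⟨t, -, ht⟩ := h.exists_flip hσ h'
  cases t
  · exact equivalent_of_letter_eq hi hj (letter_eq_of_half_eq fun δ => by simpa using ht δ) h.1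
  · have hl := letter_eq_of_half_eq_not (fun δ => by simpa using ht δ)
    refine equivalent_of_inv_equivalent
      (equivalent_of_letter_eq (i := C.shape.mirror - i) ?_ hj (fun m => ?_) ?_)
    · change _ ∈ C.shape.inv.idx
      rw [Shape.mem_idx_inv]
      simpa using hi
    · have h1 := hl (1 - m)
      simp only [inv]
      rw [show C.shape.mirror + 1 - (C.shape.mirror - i + m) = i + (1 - m) by ring, h1,
        Letter.map_inv_map_inv]
      congr 1; ring
    · rw [vertex_inv, h.1]

theorem not_forall_letter_eq_inv {i j : ℤ} (hi : i ∈ C.shape.idx) (hj : j ∈ C.shape.idx)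
    (hij : i ≠ j) :
    ¬ ∀ p q, p + q = i + j + 1 → C.letter p = (C.letter q).map Letter.inv := by
  intro h
  have hmem : ∀ p, min i j < p → p ≤ max i j → ∃ l, C.letter p = some l := by
    intro p h1 h2
    have hmin : min i j ∈ C.shape.idx := by rcases min_choice i j with h | h <;> rwa [h]
    have hmax : max i j ∈ C.shape.idx := by rcases max_choice i j with h | h <;> rwa [h]
    exact Option.isSome_iff_exists.1 ((C.letter_isSome p).2
      ⟨C.shape.ordConnected_idx.out hmin hmax ⟨h1.le, h2⟩,
        C.shape.ordConnected_idx.out hmin hmax ⟨by omega, by omega⟩⟩)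
  -- The centre of the reflection is either a letter, which would equal its own inverse, or lies
  -- between two letters, which would be inverse to each other.
  obtain ⟨p, hp | hp⟩ := Int.even_or_odd' (i + j + 1)
  · obtain ⟨l, hl⟩ := hmem p (by omega) (by omega)
    have hself := h p p (by omega)
    rw [hl] at hself
    exact l.inv_ne (Option.some.inj hself).symm
  · obtain ⟨l, hl⟩ := hmem (p + 1) (by omega) (by omega)
    have hnext := h p (p + 1) (by omega)
    rw [hl] at hnext
    exact C.reduced p _ _ hnext hl l.inv_inv

theorem Below.sameAt (hσ : IsLetterSign ρ σ) {i j : ℤ} (hi : i ∈ C.shape.idx)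
    (hj : j ∈ C.shape.idx) (h : Below C C σ i j) (h' : Below C C σ j i) : C.SameAt i j := by
  obtain ⟨t, hs, ht⟩ := h.exists_flip hσ h'
  cases t
  · exact ⟨hi, hj, letter_eq_of_half_eq fun δ => by simpa using ht δ⟩
  have hij : i ≠ j := by
    rintro rfl
    rw [Bool.xor_true, sideSign_not hσ] at hs
    simp at hs
  refine absurd (fun p q hpq => ?_) (not_forall_letter_eq_inv hi hj hij)
  have hp := letter_eq_of_half_eq_not (fun δ => by simpa using ht δ) (p - i)
  rwa [add_sub_cancel, show j + 1 - (p - i) = q by linarith] at hp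

end Word

end HalfWords

/-! ## Modules with coordinates indexed by the positions of a word -/

theorem Word.exists_transversal {Q : Type*} [Quiver Q] {ρ : Set (QPath Q)} {C : Word ρ} {i : ℤ}
    (hi : i ∈ C.shape.idx) :
    ∃ T : Set ℤ, i ∈ T ∧ T ⊆ C.shape.idx ∧ (∀ j ∈ T, ∀ l ∈ T, C.SameAt j l → j = l) ∧
      ∀ j ∈ C.shape.idx, ∃ t ∈ T, C.SameAt t j := by
  classical
  let s : Setoid C.shape.idx :=
    ⟨fun j l => C.SameAt j l, fun j => .refl j.2, fun h => h.symm, fun h h' => h.trans h'⟩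
  let rep : Quotient s → C.shape.idx := Function.update Quotient.out ⟦⟨i, hi⟩⟧ ⟨i, hi⟩
  have hrep (q : Quotient s) : ⟦rep q⟧ = q := by
    by_cases hq : q = ⟦⟨i, hi⟩⟧
    · rw [hq]
      simp only [rep, Function.update_self]
    · simp only [rep, Function.update_of_ne hq, Quotient.out_eq]
  refine ⟨Set.range fun q => (rep q : ℤ), ⟨⟦⟨i, hi⟩⟧, ?_⟩, ?_, ?_, fun j hj => ?_⟩
  · simp only [rep, Function.update_self]
  · rintro - ⟨q, rfl⟩
    exact (rep q).2
  · rintro - ⟨q, rfl⟩ - ⟨q', rfl⟩ h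
    rw [← hrep q, ← hrep q', Quotient.sound (s := s) h]
  · exact ⟨_, ⟨⟦⟨j, hj⟩⟧, rfl⟩, Quotient.exact (s := s) (hrep ⟦⟨j, hj⟩⟧)⟩

section Coordinates

open QuiverAlgebra

variable {k : Type*} [Field k] {Q : Type*} [Quiver Q] {ρ : Set (QPath Q)}

variable (k) in
/-- Coordinates on a `Λ`-module `M` with respect to a word `C` and a coefficient module `V`: maps
`β i : V → M`, where `β i v` behaves like a multiple of the basis element `b_i` of `M(C)`, and
coordinate functions `π i : M → V`. -/
structure WordCoord (C : Word ρ) (A V M : Type*) [CommRing A] [Algebra k A] [AddCommGroup V]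
    [Module A V] [AddCommGroup M] [Module (OneAdjoined k ρ) M] where
  β : ℤ → V →+ M
  π : ℤ → M →+ V
  π_β_self : ∀ {i}, i ∈ C.shape.idx → ∀ v, π i (β i v) = v
  β_of_notMem : ∀ {i}, i ∉ C.shape.idx → ∀ v, β i v = 0
  π_of_notMem : ∀ {i}, i ∉ C.shape.idx → ∀ z, π i z = 0
  span : AddSubmonoid.closure (Set.range fun p : ℤ × V => β p.1 p.2) = ⊤
  ext_zero : ∀ z, (∀ i, π i z = 0) → z = 0
  smul_β : ∀ (c : k) i v, (Unitization.inl c : OneAdjoined k ρ) • β i v =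
    β i (algebraMap k A c • v)
  π_smul : ∀ (c : k) i z, π i ((Unitization.inl c : OneAdjoined k ρ) • z) =
    algebraMap k A c • π i z
  idem_β_of_eq : ∀ {w i}, C.vertex i = some w → ∀ v, (idem k ρ w : OneAdjoined k ρ) • β i v = β i v
  idem_β_of_ne : ∀ {w i}, C.vertex i ≠ some w → ∀ v, (idem k ρ w : OneAdjoined k ρ) • β i v = 0
  arrow_β : ∀ {x δ i}, C.side δ i = some (Letter.inverse x) → ∀ v,
    (arrow k ρ x : OneAdjoined k ρ) • β i v = β (i + dirStep δ) v
  arrow_β_zero : ∀ {x i}, (∀ δ, C.side δ i ≠ some (Letter.inverse x)) → ∀ v,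
    (arrow k ρ x : OneAdjoined k ρ) • β i v = 0

namespace WordCoord

variable {C D : Word ρ} {A A' A'' V V' V'' M M' M'' : Type*}
  [CommRing A] [Algebra k A] [AddCommGroup V] [Module A V]
  [CommRing A'] [Algebra k A'] [AddCommGroup V'] [Module A' V']
  [CommRing A''] [Algebra k A''] [AddCommGroup V''] [Module A'' V'']
  [AddCommGroup M] [Module (OneAdjoined k ρ) M]
  [AddCommGroup M'] [Module (OneAdjoined k ρ) M']
  [AddCommGroup M''] [Module (OneAdjoined k ρ) M'']

theorem induction (B : WordCoord k C A V M) {P : M → Prop} (h0 : P 0)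
    (hadd : ∀ x y, P x → P y → P (x + y)) (hβ : ∀ i v, P (B.β i v)) (z : M) : P z := by
  have hz : z ∈ AddSubmonoid.closure (Set.range fun p : ℤ × V => B.β p.1 p.2) := by
    rw [B.span]; trivial
  induction hz using AddSubmonoid.closure_induction with
  | mem z hz => obtain ⟨p, rfl⟩ := hz; exact hβ p.1 p.2
  | zero => exact h0
  | add x y _ _ hx hy => exact hadd x y hx hy

theorem addHom_ext {N : Type*} [AddCommGroup N] (B : WordCoord k C A V M) {f g : M →+ N}
    (h : ∀ i v, f (B.β i v) = g (B.β i v)) (z : M) : f z = g z := by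
  induction z using B.induction with
  | h0 => rw [map_zero, map_zero]
  | hadd x y hx hy => rw [map_add, map_add, hx, hy]
  | hβ i v => exact h i v

theorem isUnitalModule (B : WordCoord k C A V M) : IsUnitalModule k ρ M := by
  intro z
  induction z using B.induction with
  | h0 => exact .of_forall fun _ => smul_zero _
  | hadd x y hx hy => filter_upwards [hx, hy] with S hx hy; rw [smul_add, hx, hy]
  | hβ i v =>
    by_cases hi : i ∈ C.shape.idx
    · obtain ⟨w, hw⟩ := C.exists_vertex hi
      filter_upwards [Filter.eventually_ge_atTop {w}] with S hS
      rw [localUnit_smul, Finset.sum_eq_single_of_mem w (Finset.singleton_subset_iff.1 hS),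
        B.idem_β_of_eq hw]
      exact fun u _ hu => B.idem_β_of_ne (fun h => hu (Option.some.inj (h.symm.trans hw))) v
    · exact .of_forall fun _ => by rw [B.β_of_notMem hi, smul_zero]

theorem nontrivial (B : WordCoord k C A V M) [Nontrivial V] : Nontrivial M := by
  obtain ⟨v, hv⟩ := exists_ne (0 : V)
  refine nontrivial_of_ne (B.β 0 v) 0 fun h => hv ?_
  rw [← B.π_β_self C.shape.zero_mem_idx v, h, map_zero]

/-- The transport of coordinates along an isomorphism of modules. -/
noncomputable def map (B : WordCoord k C A V M) (e : M ≃ₗ[OneAdjoined k ρ] M') :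
    WordCoord k C A V M' where
  β i := (e : M →+ M').comp (B.β i)
  π i := (B.π i).comp (e.symm : M' →+ M)
  π_β_self hi v := by simpa using B.π_β_self hi v
  β_of_notMem hi v := by simpa using B.β_of_notMem hi v
  π_of_notMem hi z := by simpa using B.π_of_notMem hi (e.symm z)
  span := by
    have h := congrArg (AddSubmonoid.map (e : M →+ M')) B.span
    rw [AddMonoidHom.map_mclosure, ← Set.range_comp] at h
    refine h.trans (eq_top_iff.2 fun z _ => ⟨e.symm z, trivial, by simp⟩)
  ext_zero z hz := by simpa using B.ext_zero (e.symm z) hz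
  smul_β c i v := by simpa using congrArg e (B.smul_β c i v)
  π_smul c i z := by simpa using B.π_smul c i (e.symm z)
  idem_β_of_eq h v := by simpa using congrArg e (B.idem_β_of_eq h v)
  idem_β_of_ne h v := by simpa using congrArg e (B.idem_β_of_ne h v)
  arrow_β h v := by simpa using congrArg e (B.arrow_β h v)
  arrow_β_zero h v := by simpa using congrArg e (B.arrow_β_zero h v)

/-- The transport of coordinates along an identification of words. -/
def reindex (B : WordCoord k D A V M) (e : Word.Match C D) : WordCoord k C A V M where
  β i := B.β (e.pos i)
  π i := B.π (e.pos i)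
  π_β_self hi v := B.π_β_self ((e.mem_iff _).1 hi) v
  β_of_notMem hi v := B.β_of_notMem (fun h => hi ((e.mem_iff _).2 h)) v
  π_of_notMem hi z := B.π_of_notMem (fun h => hi ((e.mem_iff _).2 h)) z
  span := by
    rw [← B.span]
    congr 1
    ext z
    constructor
    · rintro ⟨⟨i, v⟩, rfl⟩
      exact ⟨(e.pos i, v), rfl⟩
    · rintro ⟨⟨j, v⟩, rfl⟩
      obtain ⟨i, rfl⟩ := e.pos_surjective j
      exact ⟨(i, v), rfl⟩
  ext_zero z hz := B.ext_zero z fun j => by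
    obtain ⟨i, rfl⟩ := e.pos_surjective j
    exact hz i
  smul_β c i v := B.smul_β c _ v
  π_smul c i z := B.π_smul c _ z
  idem_β_of_eq h v := B.idem_β_of_eq ((e.vertex_eq _).symm.trans h) v
  idem_β_of_ne h v := B.idem_β_of_ne (fun h' => h ((e.vertex_eq _).trans h')) v
  arrow_β h v := by
    rw [e.pos_step]
    exact B.arrow_β ((e.side_eq _ _).symm.trans h) v
  arrow_β_zero {x i} h v := B.arrow_β_zero (fun δ h' => h (xor δ e.flip) (by
    rw [e.side_eq, Bool.xor_assoc, Bool.xor_self, Bool.xor_false]; exact h')) v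

theorem exists_addMonoidHom (B : WordCoord k C A V M) (B' : WordCoord k D A' V' M') (e : V ≃+ V')
    (he : ∀ i j v, B'.π j (B'.β i (e v)) = e (B.π j (B.β i v))) :
    ∃ f : M →+ M', ∀ i v, f (B.β i v) = B'.β i (e v) := by
  let Φ : (ℤ →₀ V) →+ M := Finsupp.liftAddHom B.β
  let Φ' : (ℤ →₀ V) →+ M' := Finsupp.liftAddHom fun i => (B'.β i).comp (e : V →+ V')
  have hΦ : ∀ i v, Φ (Finsupp.single i v) = B.β i v := Finsupp.liftAddHom_apply_single _
  have hΦ' : ∀ i v, Φ' (Finsupp.single i v) = B'.β i (e v) := Finsupp.liftAddHom_apply_single _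
  have hsurj : Function.Surjective Φ := fun z => by
    induction z using B.induction with
    | h0 => exact ⟨0, map_zero _⟩
    | hadd x y hx hy =>
      obtain ⟨a, rfl⟩ := hx
      obtain ⟨b, rfl⟩ := hy
      exact ⟨a + b, map_add _ _ _⟩
    | hβ i v => exact ⟨_, hΦ i v⟩
  have hπ : ∀ j w, B'.π j (Φ' w) = e (B.π j (Φ w)) := by
    intro j w
    induction w using Finsupp.induction_linear with
    | zero => simp only [map_zero]
    | add x y hx hy => simp only [map_add, hx, hy]
    | single i v => rw [hΦ, hΦ', he]
  have hker : Φ.ker ≤ Φ'.ker := fun w hw => by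
    rw [AddMonoidHom.mem_ker] at hw ⊢
    exact B'.ext_zero _ fun j => by rw [hπ, hw, map_zero, map_zero]
  refine ⟨Φ.liftOfSurjective hsurj ⟨Φ', hker⟩, fun i v => ?_⟩
  rw [← hΦ, ← hΦ']
  exact AddMonoidHom.liftOfRightInverse_comp_apply Φ _ _ ⟨Φ', hker⟩ _

theorem map_smul_of_forall_β (B : WordCoord k C A V M) (f : M →+ M') {r : OneAdjoined k ρ}
    (h : ∀ i v, f (r • B.β i v) = r • f (B.β i v)) (m : M) : f (r • m) = r • f m :=
  B.addHom_ext (f := f.comp (DistribSMul.toAddMonoidHom M r))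
    (g := (DistribSMul.toAddMonoidHom M' r).comp f) h m

theorem exists_linearMap (B : WordCoord k C A V M) (B' : WordCoord k C A' V' M') (e : V ≃+ V')
    (hc : ∀ (c : k) v, e (algebraMap k A c • v) = algebraMap k A' c • e v)
    (he : ∀ i j v, B'.π j (B'.β i (e v)) = e (B.π j (B.β i v))) :
    ∃ f : M →ₗ[OneAdjoined k ρ] M', ∀ i v, f (B.β i v) = B'.β i (e v) := by
  obtain ⟨f, hf⟩ := exists_addMonoidHom B B' e he
  refine ⟨⟨f, map_smul_of_generators f (fun c => ?_) (fun w => ?_) (fun x => ?_)⟩, hf⟩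
  · refine B.map_smul_of_forall_β f fun i v => ?_
    rw [B.smul_β, hf, hc, hf, B'.smul_β]
  · refine B.map_smul_of_forall_β f fun i v => ?_
    by_cases h : C.vertex i = some w
    · rw [B.idem_β_of_eq h, hf, B'.idem_β_of_eq h]
    · rw [B.idem_β_of_ne h, hf, B'.idem_β_of_ne h, map_zero]
  · refine B.map_smul_of_forall_β f fun i v => ?_
    by_cases h : ∃ δ, C.side δ i = some (Letter.inverse x)
    · obtain ⟨δ, h⟩ := h
      rw [B.arrow_β h, hf, hf, B'.arrow_β h]
    · rw [B.arrow_β_zero (not_exists.1 h), hf, B'.arrow_β_zero (not_exists.1 h), map_zero]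

theorem nonempty_linearEquiv (B : WordCoord k C A V M) (B' : WordCoord k C A' V' M') (e : V ≃+ V')
    (hc : ∀ (c : k) v, e (algebraMap k A c • v) = algebraMap k A' c • e v)
    (he : ∀ i j v, B'.π j (B'.β i (e v)) = e (B.π j (B.β i v))) :
    Nonempty (M ≃ₗ[OneAdjoined k ρ] M') := by
  obtain ⟨f, hf⟩ := exists_linearMap B B' e hc he
  obtain ⟨g, hg⟩ := exists_linearMap B' B e.symm
    (fun c v => e.injective (by simp [hc])) (fun i j v => e.injective (by simp [← he]))
  refine ⟨LinearEquiv.ofLinearMap f g (LinearMap.ext fun z => ?_) (LinearMap.ext fun z => ?_)⟩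
  · exact B'.addHom_ext (f := (f.comp g : M' →+ M')) (g := AddMonoidHom.id M')
      (fun i v => by simp [hf, hg]) z
  · exact B.addHom_ext (f := (g.comp f : M →+ M)) (g := AddMonoidHom.id M)
      (fun i v => by simp [hf, hg]) z

/-- Coordinates for which `β i` and `β j` are independent, unless `C` looks the same at `i` and
`j`. -/
structure Rigid (B : WordCoord k C A V M) : Prop where
  π_β_of_not : ∀ {i j}, ¬ C.SameAt i j → ∀ v, B.π i (B.β j v) = 0
  β_π_β : ∀ {i j}, C.SameAt i j → ∀ v, B.β i (B.π i (B.β j v)) = B.β j v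
  π_β_add_one : ∀ {i j}, C.SameAt i j → i + 1 ∈ C.shape.idx → j + 1 ∈ C.shape.idx → ∀ v,
    B.π (i + 1) (B.β (j + 1) v) = B.π i (B.β j v)

theorem Rigid.map {B : WordCoord k C A V M} (hB : B.Rigid) (e : M ≃ₗ[OneAdjoined k ρ] M') :
    (B.map e).Rigid where
  π_β_of_not h v := by simpa [WordCoord.map] using hB.π_β_of_not h v
  β_π_β h v := by simpa [WordCoord.map] using hB.β_π_β h v
  π_β_add_one h h1 h2 v := by simpa [WordCoord.map] using hB.π_β_add_one h h1 h2 v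

namespace Rigid

variable {B : WordCoord k C A V M} (hB : B.Rigid)

include hB

theorem π_β_step {i j : ℤ} (h : C.SameAt i j) {δ : Bool} {l : Letter Q}
    (hl : C.side δ i = some l) (v : V) :
    B.π (i + dirStep δ) (B.β (j + dirStep δ) v) = B.π i (B.β j v) := by
  have h' := h.step hl
  cases δ
  · have := hB.π_β_add_one h' (by simpa using h.1) (by simpa using h.2.1) v
    simpa using this.symm
  · exact hB.π_β_add_one h h'.1 h'.2.1 v

theorem π_arrow {x : Quiver.Total Q} {δ : Bool} {j : ℤ}
    (h : C.side δ j = some (Letter.direct x)) (z : M) :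
    B.π j ((arrow k ρ x : OneAdjoined k ρ) • z) = B.π (j + dirStep δ) z := by
  refine B.addHom_ext (f := (B.π j).comp (DistribSMul.toAddMonoidHom M _))
    (g := B.π (j + dirStep δ)) (fun i v => ?_) z
  simp only [AddMonoidHom.comp_apply, DistribSMul.toAddMonoidHom_apply]
  have h' : C.side (!δ) (j + dirStep δ) = some (Letter.inverse x) := Word.side_step_of_eq h
  by_cases hs : C.SameAt (j + dirStep δ) i
  · have hi : C.side (!δ) i = some (Letter.inverse x) := (hs.side _).symm.trans h'
    rw [B.arrow_β hi, ← hB.π_β_step hs h', dirStep_not, add_neg_cancel_right]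
  · rw [hB.π_β_of_not hs]
    by_cases hx : ∃ δ', C.side δ' i = some (Letter.inverse x)
    · obtain ⟨δ', hδ'⟩ := hx
      rw [B.arrow_β hδ']
      refine hB.π_β_of_not (fun hs' => hs ?_) v
      have h1 : C.side (!δ') (i + dirStep δ') = some (Letter.direct x) :=
        Word.side_step_of_eq hδ'
      have h2 : (!δ') = δ := Word.eq_of_side_eq h ((hs'.side _).trans h1)
      have h3 := hs'.step h
      rwa [← h2, dirStep_not, add_neg_cancel_right, ← dirStep_not, h2] at h3
    · rw [B.arrow_β_zero (not_exists.1 hx), map_zero]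

theorem π_arrow_zero {x : Quiver.Total Q} {j : ℤ}
    (h : ∀ δ, C.side δ j ≠ some (Letter.direct x)) (z : M) :
    B.π j ((arrow k ρ x : OneAdjoined k ρ) • z) = 0 := by
  refine B.addHom_ext (f := (B.π j).comp (DistribSMul.toAddMonoidHom M _))
    (g := 0) (fun i v => ?_) z
  simp only [AddMonoidHom.comp_apply, DistribSMul.toAddMonoidHom_apply, AddMonoidHom.zero_apply]
  by_cases hx : ∃ δ', C.side δ' i = some (Letter.inverse x)
  · obtain ⟨δ', hδ'⟩ := hx
    rw [B.arrow_β hδ']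
    exact hB.π_β_of_not (fun hs =>
      h (!δ') ((hs.side _).trans (Word.side_step_of_eq hδ'))) v
  · rw [B.arrow_β_zero (not_exists.1 hx), map_zero]

theorem π_idem_of_ne {w : Q} {j : ℤ} (h : C.vertex j ≠ some w) (z : M) :
    B.π j ((idem k ρ w : OneAdjoined k ρ) • z) = 0 := by
  refine B.addHom_ext (f := (B.π j).comp (DistribSMul.toAddMonoidHom M _))
    (g := 0) (fun i v => ?_) z
  simp only [AddMonoidHom.comp_apply, DistribSMul.toAddMonoidHom_apply, AddMonoidHom.zero_apply]
  by_cases hi : C.vertex i = some w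
  · rw [B.idem_β_of_eq hi]
    exact hB.π_β_of_not (fun hs => h (hs.vertex.trans hi)) v
  · rw [B.idem_β_of_ne hi, map_zero]

theorem π_β_π {i j : ℤ} (h : C.SameAt i j) (z : M) : B.π i (B.β j (B.π j z)) = B.π i z := by
  refine B.addHom_ext (f := ((B.π i).comp (B.β j)).comp (B.π j)) (g := B.π i) (fun l v => ?_) z
  simp only [AddMonoidHom.comp_apply]
  by_cases hs : C.SameAt j l
  · rw [hB.β_π_β hs]
  · rw [hB.π_β_of_not hs, map_zero, map_zero,
      hB.π_β_of_not fun h' => hs (h.symm.trans h')]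

theorem eventually_sum_eq {T : Set ℤ} (hinj : ∀ j ∈ T, ∀ l ∈ T, C.SameAt j l → j = l)
    (hsurj : ∀ j ∈ C.shape.idx, ∃ t ∈ T, C.SameAt t j) (z : M) :
    ∀ᶠ F : Finset T in Filter.atTop, ∑ j ∈ F, B.β j (B.π j z) = z := by
  induction z using B.induction with
  | h0 => exact .of_forall fun _ => by simp only [map_zero, Finset.sum_const_zero]
  | hadd x y hx hy =>
    filter_upwards [hx, hy] with F hx hy
    simp only [map_add, Finset.sum_add_distrib, hx, hy]
  | hβ l v =>
    by_cases hl : l ∈ C.shape.idx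
    · obtain ⟨t, ht, hs⟩ := hsurj l hl
      filter_upwards [Filter.eventually_ge_atTop {⟨t, ht⟩}] with F hF
      rw [Finset.sum_eq_single_of_mem ⟨t, ht⟩ (Finset.singleton_subset_iff.1 hF), hB.β_π_β hs]
      intro j _ hj
      rw [hB.π_β_of_not fun hjl => hj (Subtype.ext (hinj j j.2 t ht (hjl.trans hs.symm))),
        map_zero]
    · exact .of_forall fun _ => by simp only [B.β_of_notMem hl, map_zero, Finset.sum_const_zero]

theorem exists_eq_sum {i : ℤ} (hi : i ∈ C.shape.idx) (z : M) :
    ∃ F : Finset ℤ, i ∈ F ∧ (∀ j ∈ F, j ∈ C.shape.idx) ∧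
      (∀ j ∈ F, ∀ l ∈ F, C.SameAt j l → j = l) ∧ z = ∑ j ∈ F, B.β j (B.π j z) := by
  obtain ⟨T, hiT, hT, hinj, hsurj⟩ := Word.exists_transversal hi
  obtain ⟨F, hF, hiF⟩ :=
    ((hB.eventually_sum_eq hinj hsurj z).and (Filter.eventually_ge_atTop {⟨i, hiT⟩})).exists
  refine ⟨F.map (.subtype _), ?_, ?_, ?_, ?_⟩
  · exact Finset.mem_map.2 ⟨⟨i, hiT⟩, Finset.singleton_subset_iff.1 hiF, rfl⟩
  · exact fun j hj => hT (Finset.property_of_mem_map_subtype F hj)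
  · exact fun j hj l hl => hinj j (Finset.property_of_mem_map_subtype F hj) l
      (Finset.property_of_mem_map_subtype F hl)
  · rw [Finset.sum_map]
    exact hF.symm

end Rigid

theorem Rigid.reindex {B : WordCoord k D A V M} (hB : B.Rigid) (e : Word.Match C D) :
    (B.reindex e).Rigid := by
  have hs : ∀ {i j}, C.SameAt i j ↔ D.SameAt (e.pos i) (e.pos j) := e.sameAt_iff
  refine ⟨fun h v => hB.π_β_of_not (fun h' => h (hs.2 h')) v, fun h v => hB.β_π_β (hs.1 h) v,
    fun {i j} h h1 _ v => ?_⟩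
  obtain ⟨l, hl⟩ := C.exists_side (δ := true) h.1 h1
  have h3 := hB.π_β_step (hs.1 h) ((e.side_eq _ _).symm.trans hl) v
  rw [← e.pos_step, ← e.pos_step] at h3
  exact h3

end WordCoord

end Coordinates

/-! ## Homomorphisms are triangular -/

section Triangular

open QuiverAlgebra

variable {k : Type*} [Field k] {Q : Type*} [Quiver Q] {ρ : Set (QPath Q)}

theorem Word.half_isSome_of_le {C : Word ρ} {δ : Bool} {i : ℤ} (hi : i ∈ C.shape.idx) {r s : ℕ}
    (hrs : r ≤ s) {l : Letter Q} (h : C.half δ i s = some l) : ∃ l', C.half δ i r = some l' := by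
  have h1 := (Word.mem_of_side h).2
  have hconv : ∀ t : ℤ, 0 ≤ t → t ≤ s + 1 → i + dirStep δ * t ∈ C.shape.idx := by
    intro t h0 ht
    cases δ
    · simp only [dirStep_false] at h1 ⊢
      exact C.shape.ordConnected_idx.out h1 hi ⟨by omega, by omega⟩
    · simp only [dirStep_true] at h1 ⊢
      exact C.shape.ordConnected_idx.out hi h1 ⟨by omega, by omega⟩
  refine Word.exists_side (hconv r (by omega) (by omega)) ?_
  have := hconv (r + 1) (by omega) (by omega)
  rwa [mul_add, mul_one, ← add_assoc] at this

theorem Word.sideSign_step_eq {C D : Word ρ} {σ : Letter Q → Bool} (hσ : IsLetterSign ρ σ)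
    {i j : ℤ} {δ δ' : Bool} {l : Letter Q} (h : C.side δ i = some l) (h' : D.side δ' j = some l) :
    C.sideSign σ δ (i + dirStep δ) = D.sideSign σ δ' (j + dirStep δ') := by
  have hC := Word.sideSign_of_side (σ := σ) (Word.side_step_of_eq h)
  have hD := Word.sideSign_of_side (σ := σ) (Word.side_step_of_eq h')
  rw [Word.sideSign_not hσ] at hC hD
  exact Bool.not_inj (hC.trans hD.symm)

theorem Word.eq_of_side_of_sideSign {C : Word ρ} {σ : Letter Q → Bool} (hσ : IsLetterSign ρ σ)
    {i : ℤ} {δ δ' : Bool} {l : Letter Q} (h : C.side δ i = some l)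
    (h' : C.sideSign σ δ' i = σ l) : δ = δ' := by
  by_contra hne
  have hs := Word.sideSign_of_side (σ := σ) h
  rw [Bool.eq_not_of_ne hne, Word.sideSign_not hσ, h'] at hs
  simp at hs

theorem Word.exists_minimal_below {C : Word ρ} {σ : Letter Q → Bool} (hσ : IsLetterSign ρ σ)
    {G : Finset ℤ} (hG : G.Nonempty) :
    ∃ j ∈ G, ∀ l ∈ G, Word.Below C C σ l j → Word.Below C C σ j l := by
  let r : G → G → Prop := fun i j => Word.Below C C σ i j ∧ ¬ Word.Below C C σ j i
  have : IsTrans G r := ⟨fun a b c hab hbc =>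
    ⟨hab.1.trans hσ hbc.1, fun h => hab.2 (hbc.1.trans hσ h)⟩⟩
  have : Std.Irrefl r := ⟨fun a ha => ha.2 ha.1⟩
  obtain ⟨g, hg⟩ := hG
  obtain ⟨⟨j, hj⟩, -, hmin⟩ :=
    (Finite.wellFounded_of_trans_of_irrefl r).has_min Set.univ ⟨⟨g, hg⟩, trivial⟩
  exact ⟨j, hj, fun l hl hlj => not_not.1 fun hjl => hmin ⟨l, hl⟩ trivial ⟨hlj, hjl⟩⟩

namespace WordCoord

variable {C D : Word ρ} {A A' A'' V V' V'' M M' M'' : Type*}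
  [CommRing A] [Algebra k A] [AddCommGroup V] [Module A V]
  [CommRing A'] [Algebra k A'] [AddCommGroup V'] [Module A' V']
  [CommRing A''] [Algebra k A''] [AddCommGroup V''] [Module A'' V'']
  [AddCommGroup M] [Module (OneAdjoined k ρ) M]
  [AddCommGroup M'] [Module (OneAdjoined k ρ) M']
  [AddCommGroup M''] [Module (OneAdjoined k ρ) M'']

section

variable (B : WordCoord k C A V M) {B' : WordCoord k D A' V' M'} (hB' : B'.Rigid)
  (f : M →ₗ[OneAdjoined k ρ] M')

include hB'

theorem entry_step {i j : ℤ} {δ δ' : Bool} {l : Letter Q} (h : C.side δ i = some l)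
    (h' : D.side δ' j = some l) (v : V) :
    B'.π (j + dirStep δ') (f (B.β (i + dirStep δ) v)) = B'.π j (f (B.β i v)) := by
  have hs := Word.side_step_of_eq h
  have hs' := Word.side_step_of_eq h'
  cases l with
  | direct x =>
    have h1 := B.arrow_β hs v
    rw [dirStep_not, add_neg_cancel_right] at h1
    rw [← h1, map_smul, hB'.π_arrow h']
  | inverse x =>
    rw [← B.arrow_β h, map_smul, hB'.π_arrow hs', dirStep_not, add_neg_cancel_right]

theorem vertex_eq_of_entry_ne_zero {i j : ℤ} {v : V} (hne : B'.π j (f (B.β i v)) ≠ 0) :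
    C.vertex i = D.vertex j := by
  have hi : i ∈ C.shape.idx := by
    by_contra hi
    rw [B.β_of_notMem hi, map_zero, map_zero] at hne
    exact hne rfl
  obtain ⟨w, hw⟩ := C.exists_vertex hi
  by_contra hv
  refine hne ?_
  rw [← B.idem_β_of_eq hw, map_smul]
  exact hB'.π_idem_of_ne (fun h => hv (hw.trans h.symm)) _

variable {σ : Letter Q → Bool} (hσ : IsLetterSign ρ σ)

include hσ

theorem side_eq_of_direct {i j : ℤ} {δ δ' : Bool} {v : V} (hne : B'.π j (f (B.β i v)) ≠ 0)
    (hs : C.sideSign σ δ i = D.sideSign σ δ' j) {x : Quiver.Total Q}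
    (h : C.side δ i = some (Letter.direct x)) : D.side δ' j = some (Letter.direct x) := by
  have h1 := B.arrow_β (Word.side_step_of_eq h) v
  rw [dirStep_not, add_neg_cancel_right] at h1
  rw [← h1, map_smul] at hne
  by_contra hD
  refine hne (hB'.π_arrow_zero (fun δ'' h'' => hD ?_) _)
  rwa [Word.eq_of_side_of_sideSign hσ h'' (hs.symm.trans (Word.sideSign_of_side h))] at h''

theorem side_eq_of_inverse {i j : ℤ} {δ δ' : Bool} {v : V} (hne : B'.π j (f (B.β i v)) ≠ 0)
    (hs : C.sideSign σ δ i = D.sideSign σ δ' j) {x : Quiver.Total Q}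
    (h : D.side δ' j = some (Letter.inverse x)) : C.side δ i = some (Letter.inverse x) := by
  by_contra hC
  refine hne ?_
  have h1 := hB'.π_arrow (Word.side_step_of_eq h) (f (B.β i v))
  rw [dirStep_not, add_neg_cancel_right] at h1
  rw [← h1, ← map_smul, B.arrow_β_zero, map_zero, map_zero]
  intro δ'' h''
  refine hC ?_
  rwa [Word.eq_of_side_of_sideSign hσ h'' (hs.trans (Word.sideSign_of_side h))] at h''

theorem entry_walk {i j : ℤ} {δ δ' : Bool} (hs : C.sideSign σ δ i = D.sideSign σ δ' j) (r : ℕ)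
    (h : ∀ s < r, ∃ l, C.half δ i s = some l ∧ D.half δ' j s = some l) (v : V) :
    B'.π (j + dirStep δ' * r) (f (B.β (i + dirStep δ * r) v)) = B'.π j (f (B.β i v)) ∧
      C.sideSign σ δ (i + dirStep δ * r) = D.sideSign σ δ' (j + dirStep δ' * r) := by
  induction r with
  | zero => simpa using hs
  | succ r ih =>
    obtain ⟨l, hl, hl'⟩ := h r (by omega)
    push_cast
    simp only [mul_add, mul_one, ← add_assoc]
    exact ⟨(entry_step B hB' f hl hl' v).trans (ih fun s hs => h s (by omega)).1,
      Word.sideSign_step_eq hσ hl hl'⟩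

-- A nonzero entry is carried along the common part of two half words; where they part, a direct
-- letter of `C` or an inverse letter of `D` would have to be a letter of both.
theorem below_of_entry_ne_zero {i j : ℤ} {v : V} (hne : B'.π j (f (B.β i v)) ≠ 0) :
    Word.Below C D σ i j := by
  have hi : i ∈ C.shape.idx := not_imp_comm.1 (fun hi => by
    rw [B.β_of_notMem hi, map_zero, map_zero]) hne
  have hj : j ∈ D.shape.idx := not_imp_comm.1 (fun hj => B'.π_of_notMem hj _) hne
  refine ⟨vertex_eq_of_entry_ne_zero B hB' f hne, fun δ δ' hs =>
    toLex_le_of_forall_eq_imp_le fun r hr => ?_⟩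
  by_cases heq : C.half δ i r = D.half δ' j r
  · exact heq.le
  have hcommon : ∀ s < r, ∃ l, C.half δ i s = some l ∧ D.half δ' j s = some l := fun s hsr => by
    obtain ⟨l, hl⟩ : ∃ l, C.half δ i s = some l := by
      cases hC : C.half δ i r with
      | some l => exact Word.half_isSome_of_le hi hsr.le hC
      | none =>
        obtain ⟨l, hD⟩ := Option.ne_none_iff_exists'.1 fun hD => heq (hC.trans hD.symm)
        rw [hr s hsr]
        exact Word.half_isSome_of_le hj hsr.le hD
    exact ⟨l, hl, (hr s hsr).symm.trans hl⟩
  obtain ⟨hentry, hsign⟩ := entry_walk B hB' f hσ hs r hcommon v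
  rw [← hentry] at hne
  exact letter_le_of_imp (fun _ => side_eq_of_direct B hB' f hσ hne hsign)
    (fun _ => side_eq_of_inverse B hB' f hσ hne hsign)

end

variable {σ : Letter Q → Bool} (hσ : IsLetterSign ρ σ)

include hσ in
theorem equivalent_of_linearEquiv [Nontrivial V] {B : WordCoord k C A V M} (hB : B.Rigid)
    {B' : WordCoord k D A' V' M'} (hB' : B'.Rigid) (φ : M ≃ₗ[OneAdjoined k ρ] M') :
    C.Equivalent D := by
  obtain ⟨v, hv⟩ := exists_ne (0 : V)
  have h0 := C.shape.zero_mem_idx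
  obtain ⟨F, -, hF, -, hsum⟩ := hB'.exists_eq_sum D.shape.zero_mem_idx (φ (B.β 0 v))
  have h1 : ∑ j ∈ F, B.π 0 (φ.symm (B'.β j (B'.π j (φ (B.β 0 v))))) = v := by
    rw [← map_sum, ← map_sum, ← hsum, LinearEquiv.symm_apply_apply, B.π_β_self h0]
  obtain ⟨j, hj, hne⟩ := Finset.exists_ne_zero_of_sum_ne_zero (h1.trans_ne hv)
  have hne' : B'.π j (φ (B.β 0 v)) ≠ 0 := fun h => hne (by
    rw [h, map_zero, map_zero, map_zero])
  exact (below_of_entry_ne_zero B hB' (φ : M →ₗ[OneAdjoined k ρ] M') hσ hne').equivalent hσ h0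
    (hF j hj) (below_of_entry_ne_zero B' hB (φ.symm : M' →ₗ[OneAdjoined k ρ] M) hσ hne)

section Diagonal

variable {B : WordCoord k C A V M} (hB : B.Rigid) {B' : WordCoord k C A' V' M'} (hB' : B'.Rigid)
  {B'' : WordCoord k C A'' V'' M''} (hB'' : B''.Rigid)

variable (B B') in
/-- The diagonal entry of a homomorphism at the position `0`. -/
noncomputable def diag (f : M →ₗ[OneAdjoined k ρ] M') : V →+ V' :=
  ((B'.π 0).comp (f : M →+ M')).comp (B.β 0)

theorem diag_apply (f : M →ₗ[OneAdjoined k ρ] M') (v : V) :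
    diag B B' f v = B'.π 0 (f (B.β 0 v)) := rfl

theorem diag_smul (f : M →ₗ[OneAdjoined k ρ] M') (c : k) (v : V) :
    diag B B' f (algebraMap k A c • v) = algebraMap k A' c • diag B B' f v := by
  rw [diag_apply, diag_apply, ← B.smul_β, map_smul, B'.π_smul]

include hB' in
theorem entry_self_eq_diag (f : M →ₗ[OneAdjoined k ρ] M') {i : ℤ} (hi : i ∈ C.shape.idx) (v : V) :
    B'.π i (f (B.β i v)) = diag B B' f v := by
  have key : ∀ δ : Bool, ∀ n : ℕ, dirStep δ * n ∈ C.shape.idx →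
      B'.π (dirStep δ * n) (f (B.β (dirStep δ * n) v)) = diag B B' f v := by
    intro δ n
    induction n with
    | zero => intro _; simp [diag_apply]
    | succ n ih =>
      intro h
      have h' : dirStep δ * (n : ℤ) ∈ C.shape.idx :=
        Word.dirStep_mul_mem_of_le (by positivity) (by push_cast; omega) h
      have e : dirStep δ * ((n + 1 : ℕ) : ℤ) = dirStep δ * n + dirStep δ := by push_cast; ring
      rw [e] at h ⊢
      obtain ⟨l, hl⟩ := Word.exists_side h' h
      rw [entry_step B hB' f hl hl, ih h']
  rcases Int.eq_nat_or_neg i with ⟨n, rfl | rfl⟩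
  · simpa using key true n (by simpa using hi)
  · simpa using key false n (by simpa using hi)

include hB hB' in
theorem diag_π_β (f : M →ₗ[OneAdjoined k ρ] M') {i j : ℤ} (h : C.SameAt i j) (v : V) :
    diag B B' f (B.π i (B.β j v)) = B'.π i (B'.β j (diag B B' f v)) := by
  rw [← entry_self_eq_diag hB' f h.1, ← entry_self_eq_diag hB' f h.2.1, hB.β_π_β h, hB'.π_β_π h]

include hB' hB'' hσ in
theorem diag_comp (g : M' →ₗ[OneAdjoined k ρ] M'') (f : M →ₗ[OneAdjoined k ρ] M') (v : V) :
    diag B B'' (g.comp f) v = diag B' B'' g (diag B B' f v) := by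
  have h0 := C.shape.zero_mem_idx
  obtain ⟨F, h0F, hF, hFF, hsum⟩ := hB'.exists_eq_sum h0 (f (B.β 0 v))
  have h1 : diag B B'' (g.comp f) v =
      ∑ j ∈ F, B''.π 0 (g (B'.β j (B'.π j (f (B.β 0 v))))) := by
    rw [← map_sum, ← map_sum, ← hsum]; rfl
  rw [h1, Finset.sum_eq_single_of_mem 0 h0F]
  · rfl
  · intro j hj hj0
    by_contra hne
    have hne' : B'.π j (f (B.β 0 v)) ≠ 0 := fun h => hne (by
      rw [h, map_zero, map_zero, map_zero])
    exact hj0 (hFF j hj 0 h0F ((below_of_entry_ne_zero B' hB'' g hσ hne).sameAt hσ (hF j hj) h0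
      (below_of_entry_ne_zero B hB' f hσ hne')))

include hB hσ in
theorem eq_zero_of_diag_eq_zero (f : M →ₗ[OneAdjoined k ρ] M) (hf : diag B B f = 0) {z : M}
    (hz : f z = z) : z = 0 := by
  classical
  obtain ⟨F, -, hF, hFF, hsum⟩ := hB.exists_eq_sum C.shape.zero_mem_idx z
  by_contra hne
  have hG : (F.filter fun j => B.π j z ≠ 0).Nonempty := by
    rw [hsum] at hne
    obtain ⟨j, hj, hjz⟩ := Finset.exists_ne_zero_of_sum_ne_zero hne
    exact ⟨j, Finset.mem_filter.2 ⟨hj, fun h => hjz (by rw [h, map_zero])⟩⟩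
  -- Only positions below `j` contribute to the component of `f z` at a minimal position `j`.
  obtain ⟨j, hj, hmin⟩ := Word.exists_minimal_below (C := C) hσ hG
  obtain ⟨hjF, hjz⟩ := Finset.mem_filter.1 hj
  have hsumj : B.π j z = ∑ l ∈ F, B.π j (f (B.β l (B.π l z))) := by
    rw [← map_sum, ← map_sum, ← hsum, hz]
  rw [hsumj] at hjz
  obtain ⟨l, hl, hentry⟩ := Finset.exists_ne_zero_of_sum_ne_zero hjz
  have hlz : B.π l z ≠ 0 := fun h => hentry (by rw [h, map_zero, map_zero, map_zero])
  have hlj := below_of_entry_ne_zero B hB f hσ hentry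
  have hjl := hmin l (Finset.mem_filter.2 ⟨hl, hlz⟩) hlj
  obtain rfl := hFF l hl j hjF (hlj.sameAt hσ (hF l hl) (hF j hjF) hjl)
  rw [entry_self_eq_diag hB f (hF l hl), hf] at hentry
  exact hentry rfl

include hB hσ in
theorem isIndecomposableModule [Nontrivial V]
    (hV : ∀ d : V →+ V, (∀ (c : k) v, d (algebraMap k A c • v) = algebraMap k A c • d v) →
      (∀ i j v, C.SameAt i j → d (B.π i (B.β j v)) = B.π i (B.β j (d v))) →
      (∀ v, d (d v) = d v) → d = 0 ∨ d = AddMonoidHom.id V) :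
    IsIndecomposableModule (OneAdjoined k ρ) M := by
  refine ⟨B.nontrivial, fun N N' hN => ?_⟩
  have hid : ∀ {N N' : Submodule (OneAdjoined k ρ) M} (h : IsCompl N N'),
      diag B B (N.projection N' h) = 0 → N = ⊥ := by
    intro N N' h hd
    refine (Submodule.eq_bot_iff _).2 fun z hz => eq_zero_of_diag_eq_zero hσ hB _ hd ?_
    exact Submodule.projection_apply_of_mem_left h hz
  rcases hV (diag B B (N.projection N' hN)) (diag_smul _)
    (fun i j v h => diag_π_β hB hB _ h v) (fun v => by
      rw [← diag_comp hσ hB hB]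
      congr 2
      ext z
      simp) with h | h
  · exact Or.inl (hid hN h)
  · refine Or.inr (hid hN.symm (AddMonoidHom.ext fun v => ?_))
    have h1 := congrArg (B.π 0) (Submodule.projection_add_projection_eq_self hN (B.β 0 v))
    rw [map_add, ← diag_apply, ← diag_apply, h, B.π_β_self C.shape.zero_mem_idx] at h1
    simpa using h1

include hB hB' hσ in
theorem exists_addEquiv (φ : M ≃ₗ[OneAdjoined k ρ] M') :
    ∃ d : V ≃+ V', (∀ (c : k) v, d (algebraMap k A c • v) = algebraMap k A' c • d v) ∧
      ∀ i j v, C.SameAt i j → d (B.π i (B.β j v)) = B'.π i (B'.β j (d v)) := by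
  have h0 := C.shape.zero_mem_idx
  refine ⟨{ diag B B' (φ : M →ₗ[OneAdjoined k ρ] M') with
    invFun := diag B' B (φ.symm : M' →ₗ[OneAdjoined k ρ] M)
    left_inv := fun v => ?_
    right_inv := fun v => ?_ }, diag_smul _, fun i j v h => diag_π_β hB hB' _ h v⟩
  · refine (diag_comp hσ hB' hB _ _ v).symm.trans ?_
    simp [diag_apply, B.π_β_self h0]
  · refine (diag_comp hσ hB hB' _ _ v).symm.trans ?_
    simp [diag_apply, B'.π_β_self h0]

end Diagonal

end WordCoord

end Triangular

/-! ## Coordinates on string and band modules -/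

section StringBandCoordinates

open QuiverAlgebra

variable {k : Type*} [Field k] {Q : Type*} [Quiver Q] {ρ : Set (QPath Q)} {C : Word ρ}

namespace StringModule

theorem idem_smul (v : Q) (m : StringModule k C) :
    (idem k ρ v : OneAdjoined k ρ) • m = vertexOp k C v m := by
  rw [inr_smul, action, idem, QuiverAlgebra.lift_mk, PathAlgebra.lift_ofPath]
  rfl

theorem arrowOp_mul_vertexOp (x : Quiver.Total Q) :
    arrowOp k C x * vertexOp k C x.left = arrowOp k C x := by
  refine hom_ext fun i => ?_
  rw [Module.End.mul_apply]
  by_cases h : C.letter i = some (Letter.direct x)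
  · rw [vertexOp_b_of_eq]
    exact Word.vertex_of_letter h
  · by_cases h' : C.letter (i + 1) = some (Letter.inverse x)
    · rw [vertexOp_b_of_eq]
      exact Word.vertex_of_letter_succ h'
    · rw [arrowOp_b_zero h h']
      by_cases hv : C.vertex i = some x.left
      · rw [vertexOp_b_of_eq hv, arrowOp_b_zero h h']
      · rw [vertexOp_b_of_ne hv, map_zero]

theorem arrow_smul (x : Quiver.Total Q) (m : StringModule k C) :
    (arrow k ρ x : OneAdjoined k ρ) • m = arrowOp k C x m := by
  rw [inr_smul, action, arrow, QuiverAlgebra.lift_mk, PathAlgebra.lift_ofPath]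
  conv_rhs => rw [← arrowOp_mul_vertexOp]
  rfl

variable (k C) in
open Classical in
/-- The basis element `b_i` if `i` is in `I`, and otherwise zero. -/
noncomputable def bOrZero (i : ℤ) : StringModule k C :=
  if h : i ∈ C.shape.idx then b k ⟨i, h⟩ else 0

theorem bOrZero_of_mem {i : ℤ} (h : i ∈ C.shape.idx) : bOrZero k C i = b k ⟨i, h⟩ := dif_pos h

theorem bOrZero_of_notMem {i : ℤ} (h : i ∉ C.shape.idx) : bOrZero k C i = 0 := dif_neg h

theorem bOrZero_coe (i : C.shape.idx) : bOrZero k C i = b k i := bOrZero_of_mem i.2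

theorem idem_smul_bOrZero_of_eq {w : Q} {i : ℤ} (h : C.vertex i = some w) :
    (idem k ρ w : OneAdjoined k ρ) • bOrZero k C i = bOrZero k C i := by
  by_cases hi : i ∈ C.shape.idx
  · rw [bOrZero_of_mem hi, idem_smul]
    exact vertexOp_b_of_eq h
  · rw [bOrZero_of_notMem hi, smul_zero]

theorem idem_smul_bOrZero_of_ne {w : Q} {i : ℤ} (h : C.vertex i ≠ some w) :
    (idem k ρ w : OneAdjoined k ρ) • bOrZero k C i = 0 := by
  by_cases hi : i ∈ C.shape.idx
  · rw [bOrZero_of_mem hi, idem_smul]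
    exact vertexOp_b_of_ne h
  · rw [bOrZero_of_notMem hi, smul_zero]

theorem arrow_smul_bOrZero {x : Quiver.Total Q} {δ : Bool} {i : ℤ}
    (h : C.side δ i = some (Letter.inverse x)) :
    (arrow k ρ x : OneAdjoined k ρ) • bOrZero k C i = bOrZero k C (i + dirStep δ) := by
  have hm := Word.mem_of_side h
  rw [bOrZero_of_mem hm.1, bOrZero_of_mem hm.2, arrow_smul]
  cases δ
  · obtain ⟨l, hl, hl'⟩ := Option.map_eq_some_iff.1 h
    have : l = Letter.direct x := by
      rw [← l.inv_inv, hl']; rfl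
    subst this
    exact arrowOp_b_direct (i := ⟨i, hm.1⟩) hl
  · exact arrowOp_b_inverse (i := ⟨i, hm.1⟩) h

theorem arrow_smul_bOrZero_zero {x : Quiver.Total Q} {i : ℤ}
    (h : ∀ δ, C.side δ i ≠ some (Letter.inverse x)) :
    (arrow k ρ x : OneAdjoined k ρ) • bOrZero k C i = 0 := by
  by_cases hi : i ∈ C.shape.idx
  · rw [bOrZero_of_mem hi, arrow_smul]
    refine arrowOp_b_zero (i := ⟨i, hi⟩) (fun h' => h false ?_) (h true)
    simp only [Word.side, h']
    rfl
  · rw [bOrZero_of_notMem hi, smul_zero]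

theorem bOrZero_induction {P : StringModule k C → Prop} (h0 : P 0)
    (hadd : ∀ x y, P x → P y → P (x + y)) (hb : ∀ (c : k) i, P (c • bOrZero k C i))
    (z : StringModule k C) : P z := by
  induction z using Finsupp.induction_linear with
  | zero => exact h0
  | add x y hx hy => exact hadd x y hx hy
  | single i c =>
    have h : (Finsupp.single i c : StringModule k C) = c • bOrZero k C i := by
      rw [bOrZero_coe]
      refine (?_ : Finsupp.single i c = c • Finsupp.single i (1 : k))
      simp
    rw [h]
    exact hb c i

/-- The coefficient at `b_i`. -/
noncomputable def coeffAt (i : C.shape.idx) : StringModule k C →+ k := Finsupp.applyAddHom i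

variable (k C) in
open Classical in
/-- The coefficient at `b_i`, and zero if `i` is not in `I`. -/
noncomputable def coeffHom (i : ℤ) : StringModule k C →+ k :=
  if h : i ∈ C.shape.idx then coeffAt ⟨i, h⟩ else 0

theorem coeffHom_of_mem {i : ℤ} (h : i ∈ C.shape.idx) (z : StringModule k C) :
    coeffHom k C i z = coeffAt ⟨i, h⟩ z := by
  rw [coeffHom, dif_pos h]

theorem coeffHom_of_notMem {i : ℤ} (h : i ∉ C.shape.idx) (z : StringModule k C) :
    coeffHom k C i z = 0 := by
  rw [coeffHom, dif_neg h]; rfl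

theorem coeffHom_smul (c : k) (i : ℤ) (z : StringModule k C) :
    coeffHom k C i (c • z) = c * coeffHom k C i z := by
  by_cases h : i ∈ C.shape.idx
  · rw [coeffHom_of_mem h, coeffHom_of_mem h]; rfl
  · rw [coeffHom_of_notMem h, coeffHom_of_notMem h, mul_zero]

theorem coeffHom_bOrZero_self {i : ℤ} (h : i ∈ C.shape.idx) :
    coeffHom k C i (bOrZero k C i) = 1 := by
  rw [coeffHom_of_mem h, bOrZero_of_mem h]
  exact Finsupp.single_eq_same

theorem coeffHom_bOrZero_of_ne {i j : ℤ} (h : i ≠ j) : coeffHom k C i (bOrZero k C j) = 0 := by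
  by_cases hi : i ∈ C.shape.idx
  · by_cases hj : j ∈ C.shape.idx
    · rw [coeffHom_of_mem hi, bOrZero_of_mem hj]
      exact Finsupp.single_eq_of_ne fun h' => h (congrArg Subtype.val h')
    · rw [bOrZero_of_notMem hj, map_zero]
  · exact coeffHom_of_notMem hi _

theorem coeffHom_ext {z : StringModule k C} (h : ∀ i, coeffHom k C i z = 0) : z = 0 :=
  Finsupp.ext fun i => (coeffHom_of_mem i.2 z).symm.trans (h i)

variable (k C) in
/-- The coordinates on the string module `M(C)` given by its basis. -/
noncomputable def coord : WordCoord k C k k (StringModule k C) where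
  β i := (LinearMap.toSpanSingleton k (StringModule k C) (bOrZero k C i)).toAddMonoidHom
  π i := coeffHom k C i
  π_β_self hi v := by
    change coeffHom k C _ (v • bOrZero k C _) = v
    rw [coeffHom_smul, coeffHom_bOrZero_self hi, mul_one]
  β_of_notMem hi v := by
    change v • bOrZero k C _ = 0
    rw [bOrZero_of_notMem hi, smul_zero]
  π_of_notMem hi z := coeffHom_of_notMem hi z
  span := by
    refine eq_top_iff.2 fun z _ => ?_
    induction z using bOrZero_induction with
    | h0 => exact zero_mem _
    | hadd x y hx hy => exact add_mem (hx trivial) (hy trivial)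
    | hb c i => exact AddSubmonoid.subset_closure ⟨(i, c), rfl⟩
  ext_zero z hz := coeffHom_ext hz
  smul_β c i v := by
    change (Unitization.inl c : OneAdjoined k ρ) • v • bOrZero k C i = (c • v) • bOrZero k C i
    rw [inl_smul, smul_assoc]
  π_smul c i z := by
    rw [inl_smul, coeffHom_smul]; rfl
  idem_β_of_eq h v := by
    change (idem k ρ _ : OneAdjoined k ρ) • v • bOrZero k C _ = v • bOrZero k C _
    rw [smul_comm, idem_smul_bOrZero_of_eq h]
  idem_β_of_ne h v := by
    change (idem k ρ _ : OneAdjoined k ρ) • v • bOrZero k C _ = 0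
    rw [smul_comm, idem_smul_bOrZero_of_ne h, smul_zero]
  arrow_β h v := by
    change (arrow k ρ _ : OneAdjoined k ρ) • v • bOrZero k C _ = v • bOrZero k C _
    rw [smul_comm, arrow_smul_bOrZero h]
  arrow_β_zero h v := by
    change (arrow k ρ _ : OneAdjoined k ρ) • v • bOrZero k C _ = 0
    rw [smul_comm, arrow_smul_bOrZero_zero h, smul_zero]

theorem coord_π_β (i j : ℤ) (c : k) :
    (coord k C).π i ((coord k C).β j c) = c * coeffHom k C i (bOrZero k C j) :=
  coeffHom_smul c i _

theorem coord_rigid (hC : ¬ C.IsPeriodic) : (coord k C).Rigid := by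
  have heq : ∀ {i j}, C.SameAt i j → i = j := fun h => by
    by_contra hne
    exact hC (h.isPeriodic hne)
  refine ⟨fun {i j} h v => ?_, fun {i j} h v => ?_, fun {i j} h hi _ v => ?_⟩
  · rw [coord_π_β]
    by_cases hij : i = j
    · subst hij
      rw [coeffHom_of_notMem fun hi => h (Word.SameAt.refl hi), mul_zero]
    · rw [coeffHom_bOrZero_of_ne hij, mul_zero]
  · obtain rfl := heq h
    rw [(coord k C).π_β_self h.1]
  · obtain rfl := heq h
    rw [(coord k C).π_β_self h.1, (coord k C).π_β_self hi]

end StringModule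

namespace Word

theorem shift_eq_self_iff (hC : C.shape = Shape.int) (n : ℤ) :
    C.shift n = C ↔ ∀ i, C.letter (i + n) = C.letter i := by
  constructor
  · intro h i
    have h' := congrFun (congrArg Word.letter h) i
    simpa [Word.shift, hC, Shape.offset] using h'
  · intro h
    ext1
    · rfl
    · funext i
      simp only [Word.shift, hC, Shape.offset, h i]
    · rfl

theorem IsPeriodic.period_pos (hC : C.IsPeriodic) : 0 < C.period := (Nat.sInf_mem hC.2).1

theorem IsPeriodic.sameAt_iff (hC : C.IsPeriodic) {i j : ℤ} :
    C.SameAt i j ↔ (C.period : ℤ) ∣ i - j := by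
  constructor
  · intro h
    by_contra hdvd
    have hpos : (0 : ℤ) < C.period := by exact_mod_cast hC.period_pos
    set d := (i - j) % C.period with hd
    have hd0 : d ≠ 0 := fun h0 => hdvd (Int.dvd_of_emod_eq_zero h0)
    have hd1 : 0 ≤ d := Int.emod_nonneg _ hpos.ne'
    have hd2 : d < C.period := Int.emod_lt_of_pos _ hpos
    have hdiv : i - j = d + (i - j) / C.period * C.period := by
      rw [hd]; exact (Int.emod_add_ediv_mul _ _).symm
    have hper : ∀ m, C.letter (m + d) = C.letter m := fun m => by
      rw [← PeriodicStringModule.letter_add_mul_period hC (m + d) ((i - j) / C.period),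
        add_assoc, ← hdiv]
      have := h.2.2 (m - j)
      rw [show i + (m - j) = m + (i - j) by ring, show j + (m - j) = m by ring] at this
      exact this
    have hle : C.period ≤ d.toNat := Nat.sInf_le ⟨by omega, by
      rw [shift_eq_self_iff hC.1, Int.toNat_of_nonneg hd1]
      exact hper⟩
    omega
  · rintro ⟨m, hm⟩
    refine ⟨PeriodicStringModule.mem_idx hC i, PeriodicStringModule.mem_idx hC j, fun r => ?_⟩
    rw [← PeriodicStringModule.letter_add_mul_period hC (j + r) m]
    congr 1
    linarith

end Word

namespace PeriodicStringModule

variable (hC : C.IsPeriodic)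

/-- The basis element `b_i` of `M(C)`. -/
noncomputable def basisVec (i : ℤ) : PeriodicStringModule k hC := StringModule.bOrZero k C i

theorem T_smul (m : ℤ) (z : PeriodicStringModule k hC) :
    (LaurentPolynomial.T m : k[T;T⁻¹]) • z = shiftEnd k hC m z := by
  change laurentHom k hC (LaurentPolynomial.T m) z = _
  rw [laurentHom, LaurentPolynomial.T, AddMonoidAlgebra.lift_single, one_smul]
  rfl

theorem C_smul (a : k) (z : PeriodicStringModule k hC) :
    (LaurentPolynomial.C a : k[T;T⁻¹]) • z = a • z := by
  change laurentHom k hC (LaurentPolynomial.C a) z = _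
  rw [LaurentPolynomial.C_eq_algebraMap, AlgHom.commutes]
  rfl

theorem T_smul_basisVec (m i : ℤ) :
    (LaurentPolynomial.T m : k[T;T⁻¹]) • basisVec (k := k) hC i =
      basisVec hC (i - m * C.period) := by
  rw [T_smul, basisVec, basisVec, StringModule.bOrZero_of_mem (mem_idx hC _),
    StringModule.bOrZero_of_mem (mem_idx hC _)]
  exact shiftLin_b (hC := hC) m _

theorem basisVec_induction {P : PeriodicStringModule k hC → Prop} (h0 : P 0)
    (hadd : ∀ x y, P x → P y → P (x + y)) (hb : ∀ (c : k) i, P (c • basisVec hC i))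
    (z : PeriodicStringModule k hC) : P z :=
  StringModule.bOrZero_induction (P := P) h0 hadd hb z

open Classical in
/-- The coefficients at the `b_j` with `j` congruent to `i` modulo the period of `C`, as a
`k`-linear map to Laurent polynomials. -/
noncomputable def coeffLin (i : ℤ) : PeriodicStringModule k hC →ₗ[k] k[T;T⁻¹] :=
  StringModule.linExt k C fun j =>
    if (C.period : ℤ) ∣ i - j then LaurentPolynomial.T ((i - j) / C.period) else 0

theorem coeffLin_of_dvd {i j : ℤ} (h : (C.period : ℤ) ∣ i - j) :
    coeffLin hC i (basisVec (k := k) hC j) = LaurentPolynomial.T ((i - j) / C.period) := by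
  rw [basisVec, StringModule.bOrZero_of_mem (mem_idx hC _)]
  refine (StringModule.linExt_b _ _).trans ?_
  rw [if_pos h]

theorem coeffLin_of_not_dvd {i j : ℤ} (h : ¬ (C.period : ℤ) ∣ i - j) :
    coeffLin hC i (basisVec (k := k) hC j) = 0 := by
  rw [basisVec, StringModule.bOrZero_of_mem (mem_idx hC _)]
  refine (StringModule.linExt_b _ _).trans ?_
  rw [if_neg h]

theorem coeffLin_T_smul (i m : ℤ) (z : PeriodicStringModule k hC) :
    coeffLin hC i ((LaurentPolynomial.T m : k[T;T⁻¹]) • z) =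
      LaurentPolynomial.T m * coeffLin hC i z := by
  have hpos : (C.period : ℤ) ≠ 0 := by exact_mod_cast hC.period_pos.ne'
  induction z using basisVec_induction with
  | h0 => rw [smul_zero, map_zero, mul_zero]
  | hadd x y hx hy => rw [smul_add, map_add, map_add, mul_add, hx, hy]
  | hb c j =>
    rw [← C_smul, smul_comm, C_smul, C_smul, T_smul_basisVec, map_smul, map_smul, mul_smul_comm]
    congr 1
    have hij : i - (j - m * C.period) = i - j + m * C.period := by ring
    by_cases h : (C.period : ℤ) ∣ i - j
    · have h' : (C.period : ℤ) ∣ i - (j - m * C.period) := by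
        rw [hij]; exact dvd_add h (dvd_mul_left _ _)
      rw [coeffLin_of_dvd hC h, coeffLin_of_dvd hC h', ← LaurentPolynomial.T_add, hij,
        Int.add_mul_ediv_right _ _ hpos, add_comm]
    · have h' : ¬ (C.period : ℤ) ∣ i - (j - m * C.period) := by
        rw [hij]; exact fun h' => h ((dvd_add_left (dvd_mul_left _ _)).1 h')
      rw [coeffLin_of_not_dvd hC h, coeffLin_of_not_dvd hC h', mul_zero]

/-- The map `coeffLin`, as a linear map over Laurent polynomials. -/
noncomputable def coeffLaurent (i : ℤ) : PeriodicStringModule k hC →ₗ[k[T;T⁻¹]] k[T;T⁻¹] where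
  toFun := coeffLin hC i
  map_add' := map_add _
  map_smul' f z := by
    rw [RingHom.id_apply, smul_eq_mul]
    induction f using LaurentPolynomial.induction_on' with
    | add p q hp hq => rw [add_smul, map_add, hp, hq, add_mul]
    | C_mul_T m a =>
      rw [mul_smul, C_smul, map_smul, coeffLin_T_smul, LaurentPolynomial.C_eq_algebraMap,
        mul_assoc, ← Algebra.smul_def]

end PeriodicStringModule

namespace BandModule

open PeriodicStringModule

variable (hC : C.IsPeriodic) {V : Type*} [AddCommGroup V] [Module k[T;T⁻¹] V]

/-- The map `v ↦ b_i ⊗ v`. -/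
noncomputable def incl (i : ℤ) : V →ₗ[k[T;T⁻¹]] BandModule k hC V :=
  TensorProduct.mk k[T;T⁻¹] (PeriodicStringModule k hC) V (basisVec hC i)

/-- The coordinate of an element of `M(C, V)` at `b_i`. -/
noncomputable def proj (i : ℤ) : BandModule k hC V →ₗ[k[T;T⁻¹]] V :=
  (TensorProduct.lid k[T;T⁻¹] V).toLinearMap.comp ((coeffLaurent hC i).rTensor V)

theorem proj_incl_of_dvd {i j : ℤ} (h : (C.period : ℤ) ∣ i - j) (v : V) :
    proj (k := k) hC i (incl hC j v) =
      (LaurentPolynomial.T ((i - j) / C.period) : k[T;T⁻¹]) • v := by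
  change coeffLin (k := k) hC i (basisVec hC j) • v = _
  rw [coeffLin_of_dvd hC h]

theorem proj_incl_of_not_dvd {i j : ℤ} (h : ¬ (C.period : ℤ) ∣ i - j) (v : V) :
    proj (k := k) hC i (incl hC j v) = 0 := by
  change coeffLin (k := k) hC i (basisVec hC j) • v = _
  rw [coeffLin_of_not_dvd hC h, zero_smul]

theorem incl_T_smul (i m : ℤ) (v : V) :
    incl (k := k) hC i ((LaurentPolynomial.T m : k[T;T⁻¹]) • v) =
      incl hC (i - m * C.period) v := by
  change basisVec hC i ⊗ₜ (_ • v) = basisVec hC _ ⊗ₜ v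
  rw [← TensorProduct.smul_tmul, T_smul_basisVec]

theorem incl_proj_incl {i j : ℤ} (h : (C.period : ℤ) ∣ i - j) (v : V) :
    incl (k := k) hC i (proj (k := k) hC i (incl hC j v)) = incl hC j v := by
  rw [proj_incl_of_dvd hC h, incl_T_smul, Int.ediv_mul_cancel h, sub_sub_cancel]

theorem incl_induction {P : BandModule k hC V → Prop} (h0 : P 0)
    (hadd : ∀ x y, P x → P y → P (x + y)) (hb : ∀ i v, P (incl hC i v))
    (z : BandModule k hC V) : P z := by
  induction z using TensorProduct.induction_on with
  | zero => exact h0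
  | add x y hx hy => exact hadd x y hx hy
  | tmul m v =>
    induction m using basisVec_induction with
    | h0 => rw [TensorProduct.zero_tmul]; exact h0
    | hadd x y hx hy => rw [TensorProduct.add_tmul]; exact hadd _ _ hx hy
    | hb c i =>
      rw [← C_smul, TensorProduct.smul_tmul]
      exact hb i _

theorem sum_incl_proj (z : BandModule k hC V) :
    ∑ i ∈ Finset.Ico (0 : ℤ) C.period, incl hC i (proj hC i z) = z := by
  have hpos : (0 : ℤ) < C.period := by exact_mod_cast hC.period_pos
  induction z using incl_induction with
  | h0 => simp
  | hadd x y hx hy => simp only [map_add, Finset.sum_add_distrib, hx, hy]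
  | hb j v =>
    have hdvd : (C.period : ℤ) ∣ j % C.period - j :=
      dvd_sub_comm.1 (Int.dvd_self_sub_emod)
    rw [Finset.sum_eq_single_of_mem (j % C.period)
      (Finset.mem_Ico.2 ⟨Int.emod_nonneg _ hpos.ne', Int.emod_lt_of_pos _ hpos⟩),
      incl_proj_incl hC hdvd]
    intro i hi hne
    rw [proj_incl_of_not_dvd, map_zero]
    intro h
    rw [Finset.mem_Ico] at hi
    exact hne (by rw [← Int.emod_eq_emod_iff_emod_sub_eq_zero.2 (Int.emod_eq_zero_of_dvd h),
      Int.emod_eq_of_lt hi.1 hi.2])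

theorem smul_incl (r : OneAdjoined k ρ) (i : ℤ) (v : V) :
    r • incl (k := k) hC i v = (r • basisVec (k := k) hC i) ⊗ₜ v :=
  TensorProduct.smul_tmul' r _ v

theorem inl_smul_incl (c : k) (i : ℤ) (v : V) :
    (Unitization.inl c : OneAdjoined k ρ) • incl (k := k) hC i v =
      incl hC i (algebraMap k k[T;T⁻¹] c • v) := by
  have h : (Unitization.inl c : OneAdjoined k ρ) • basisVec (k := k) hC i =
      c • basisVec (k := k) hC i := StringModule.inl_smul c _
  rw [smul_incl, h, ← C_smul, TensorProduct.smul_tmul, LaurentPolynomial.C_eq_algebraMap]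
  rfl

theorem proj_inl_smul (c : k) (i : ℤ) (z : BandModule k hC V) :
    proj hC i ((Unitization.inl c : OneAdjoined k ρ) • z) =
      algebraMap k k[T;T⁻¹] c • proj hC i z := by
  induction z using incl_induction with
  | h0 => rw [smul_zero, map_zero, smul_zero]
  | hadd x y hx hy => rw [smul_add, map_add, map_add, hx, hy, smul_add]
  | hb j v => rw [inl_smul_incl, map_smul, map_smul]

theorem idem_smul_incl_of_eq {w : Q} {i : ℤ} (h : C.vertex i = some w) (v : V) :
    (idem k ρ w : OneAdjoined k ρ) • incl (k := k) hC i v = incl hC i v := by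
  rw [smul_incl]
  exact congrArg (fun m : PeriodicStringModule k hC => m ⊗ₜ[k[T;T⁻¹]] v)
    (StringModule.idem_smul_bOrZero_of_eq h)

theorem idem_smul_incl_of_ne {w : Q} {i : ℤ} (h : C.vertex i ≠ some w) (v : V) :
    (idem k ρ w : OneAdjoined k ρ) • incl (k := k) hC i v = 0 := by
  rw [smul_incl]
  exact (congrArg (fun m : PeriodicStringModule k hC => m ⊗ₜ[k[T;T⁻¹]] v)
    (StringModule.idem_smul_bOrZero_of_ne h)).trans (TensorProduct.zero_tmul _ _)

theorem arrow_smul_incl {x : Quiver.Total Q} {δ : Bool} {i : ℤ}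
    (h : C.side δ i = some (Letter.inverse x)) (v : V) :
    (arrow k ρ x : OneAdjoined k ρ) • incl (k := k) hC i v = incl hC (i + dirStep δ) v := by
  rw [smul_incl]
  exact congrArg (fun m : PeriodicStringModule k hC => m ⊗ₜ[k[T;T⁻¹]] v)
    (StringModule.arrow_smul_bOrZero h)

theorem arrow_smul_incl_zero {x : Quiver.Total Q} {i : ℤ}
    (h : ∀ δ, C.side δ i ≠ some (Letter.inverse x)) (v : V) :
    (arrow k ρ x : OneAdjoined k ρ) • incl (k := k) hC i v = 0 := by
  rw [smul_incl]
  exact (congrArg (fun m : PeriodicStringModule k hC => m ⊗ₜ[k[T;T⁻¹]] v)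
    (StringModule.arrow_smul_bOrZero_zero h)).trans (TensorProduct.zero_tmul _ _)

variable (V) in
/-- The coordinates on `M(C, V)`. -/
noncomputable def coord : WordCoord k C k[T;T⁻¹] V (BandModule k hC V) where
  β i := (incl hC i).toAddMonoidHom
  π i := (proj hC i).toAddMonoidHom
  π_β_self {i} _ v := by
    change proj hC i (incl hC i v) = v
    rw [proj_incl_of_dvd hC (by simp)]
    simp
  β_of_notMem hi v := absurd (mem_idx hC _) hi
  π_of_notMem hi z := absurd (mem_idx hC _) hi
  span := by
    refine eq_top_iff.2 fun z _ => ?_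
    induction z using incl_induction with
    | h0 => exact zero_mem _
    | hadd x y hx hy => exact add_mem (hx trivial) (hy trivial)
    | hb i v => exact AddSubmonoid.subset_closure ⟨(i, v), rfl⟩
  ext_zero z hz := by
    rw [← sum_incl_proj hC z]
    refine Finset.sum_eq_zero fun i _ => ?_
    have h : proj hC i z = 0 := hz i
    rw [h, map_zero]
  smul_β := inl_smul_incl hC
  π_smul := proj_inl_smul hC
  idem_β_of_eq := idem_smul_incl_of_eq hC
  idem_β_of_ne := idem_smul_incl_of_ne hC
  arrow_β := arrow_smul_incl hC
  arrow_β_zero := arrow_smul_incl_zero hC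

theorem coord_rigid : (coord (k := k) hC V).Rigid where
  π_β_of_not h v := proj_incl_of_not_dvd hC (fun h' => h (hC.sameAt_iff.2 h')) v
  β_π_β h v := incl_proj_incl hC (hC.sameAt_iff.1 h) v
  π_β_add_one {i j} h _ _ v := by
    have h' := hC.sameAt_iff.1 h
    have e : i + 1 - (j + 1) = i - j := by ring
    refine (proj_incl_of_dvd hC (by rwa [e]) v).trans ?_
    rw [e]
    exact (proj_incl_of_dvd hC h' v).symm

theorem coord_π_β_sub (i m : ℤ) (v : V) :
    (coord (k := k) hC V).π i ((coord (k := k) hC V).β (i - m * C.period) v) =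
      (LaurentPolynomial.T m : k[T;T⁻¹]) • v := by
  have e : i - (i - m * C.period) = m * C.period := by ring
  refine (proj_incl_of_dvd hC (by rw [e]; exact dvd_mul_left _ _) v).trans ?_
  rw [e, Int.mul_ediv_cancel _ (by exact_mod_cast hC.period_pos.ne')]

variable (k) in
/-- The string module of a periodic word is `M(C) ⊗ k[T, T⁻¹]`. -/
noncomputable def ridEquiv : BandModule k hC k[T;T⁻¹] ≃ₗ[OneAdjoined k ρ] StringModule k C :=
  { (TensorProduct.rid k[T;T⁻¹] (PeriodicStringModule k hC)).toAddEquiv with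
    map_smul' := fun r z => by
      change TensorProduct.rid k[T;T⁻¹] (PeriodicStringModule k hC) (r • z) =
        r • TensorProduct.rid k[T;T⁻¹] (PeriodicStringModule k hC) z
      induction z using TensorProduct.induction_on with
      | zero => simp
      | add x y hx hy => rw [smul_add, map_add, map_add, hx, hy, smul_add]
      | tmul m v =>
        rw [TensorProduct.smul_tmul', TensorProduct.rid_tmul, TensorProduct.rid_tmul,
          smul_comm] }

end BandModule

end StringBandCoordinates

/-! ## Indecomposability and isomorphisms -/

section Classification

open QuiverAlgebra LaurentPolynomial

variable {k : Type*} [Field k] {Q : Type*} [Quiver Q] {ρ : Set (QPath Q)} {C D : Word ρ}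

theorem map_smul_of_map_T_smul {V U : Type*} [AddCommGroup V] [Module k[T;T⁻¹] V]
    [AddCommGroup U] [Module k[T;T⁻¹] U] (θ : k[T;T⁻¹] →ₐ[k] k[T;T⁻¹]) (d : V →+ U)
    (hc : ∀ (c : k) v, d (algebraMap k k[T;T⁻¹] c • v) = algebraMap k k[T;T⁻¹] c • d v)
    (hT : ∀ m v, d ((T m : k[T;T⁻¹]) • v) = θ (T m) • d v) (f : k[T;T⁻¹]) (v : V) :
    d (f • v) = θ f • d v := by
  induction f using LaurentPolynomial.induction_on' with
  | add p q hp hq => rw [add_smul, map_add, map_add, add_smul, hp, hq]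
  | C_mul_T m a =>
    rw [mul_smul, C_eq_algebraMap, hc, hT, map_mul, AlgHom.commutes, mul_smul]

variable (k) in
theorem not_moduleFinite_laurentPolynomial : ¬ Module.Finite k k[T;T⁻¹] := by
  intro h
  have := Module.Finite.finite_basis
    (Module.Basis.ofRepr (AddMonoidAlgebra.coeffLinearEquiv (S := k) (M := ℤ) k))
  exact not_finite ℤ

theorem isIndecomposableModule_self {A : Type*} [CommRing A] [IsDomain A] :
    IsIndecomposableModule A A := by
  refine ⟨inferInstance, fun N N' h => ?_⟩
  by_contra! hne
  obtain ⟨a, ha, ha0⟩ := Submodule.exists_mem_ne_zero_of_ne_bot hne.1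
  obtain ⟨b, hb, hb0⟩ := Submodule.exists_mem_ne_zero_of_ne_bot hne.2
  have hab : a * b ∈ N ⊓ N' := ⟨by rw [mul_comm]; exact N.smul_mem b ha, N'.smul_mem a hb⟩
  rw [h.inf_eq_bot, Submodule.mem_bot] at hab
  exact mul_ne_zero ha0 hb0 hab

theorem IsIndecomposableModule.eq_zero_or_eq_id {A V : Type*} [Ring A] [AddCommGroup V]
    [Module A V] (hV : IsIndecomposableModule A V) (e : V →ₗ[A] V) (he : ∀ v, e (e v) = e v) :
    e = 0 ∨ e = LinearMap.id := by
  have hid : IsIdempotentElem e := LinearMap.ext he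
  rcases hV.2 _ _ (LinearMap.IsIdempotentElem.isCompl hid) with h | h
  · exact Or.inl (LinearMap.range_eq_bot.1 h)
  · exact Or.inr (LinearMap.ext fun v => LinearMap.ker_eq_bot.1 h (he v))

namespace WordCoord

variable {V U M M' : Type*} [AddCommGroup V] [Module k[T;T⁻¹] V] [AddCommGroup U]
  [Module k[T;T⁻¹] U] [AddCommGroup M] [Module (OneAdjoined k ρ) M] [AddCommGroup M']
  [Module (OneAdjoined k ρ) M']

/-- The condition that translating positions by the period of the word amounts to the action of
`θ(T)` on coefficients, which determines the `k[T, T⁻¹]`-module structure of the coefficients. -/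
def HasMonodromy (B : WordCoord k C k[T;T⁻¹] V M) (θ : k[T;T⁻¹] →ₐ[k] k[T;T⁻¹]) : Prop :=
  ∀ i m v, B.π i (B.β (i - m * C.period) v) = θ (T m) • v

theorem HasMonodromy.map {B : WordCoord k C k[T;T⁻¹] V M} {θ : k[T;T⁻¹] →ₐ[k] k[T;T⁻¹]}
    (hB : B.HasMonodromy θ) (e : M ≃ₗ[OneAdjoined k ρ] M') : (B.map e).HasMonodromy θ :=
  fun i m v => by simpa [WordCoord.map] using hB i m v

variable {σ : Letter Q → Bool} (hσ : IsLetterSign ρ σ)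

include hσ in
theorem isIndecomposableModule_of_hasMonodromy (hC : C.IsPeriodic)
    {B : WordCoord k C k[T;T⁻¹] V M} (hB : B.Rigid) (hT : B.HasMonodromy (AlgHom.id k _))
    (hV : IsIndecomposableModule k[T;T⁻¹] V) : IsIndecomposableModule (OneAdjoined k ρ) M := by
  have := hV.1
  refine isIndecomposableModule hσ hB fun d hc hd hdd => ?_
  have hlin := map_smul_of_map_T_smul (AlgHom.id k _) d hc fun m v => by
    have h := hd 0 (0 - m * C.period) v (hC.sameAt_iff.2 (by simp))
    rwa [hT, hT] at h
  let e : V →ₗ[k[T;T⁻¹]] V := { d with map_smul' := hlin }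
  exact (hV.eq_zero_or_eq_id e hdd).imp (fun h => AddMonoidHom.ext (LinearMap.congr_fun h))
    (fun h => AddMonoidHom.ext (LinearMap.congr_fun h))

include hσ in
theorem nonempty_linearEquiv_iff_of_hasMonodromy (hC : C.IsPeriodic)
    {B : WordCoord k C k[T;T⁻¹] V M} (hB : B.Rigid) (hT : B.HasMonodromy (AlgHom.id k _))
    {B' : WordCoord k C k[T;T⁻¹] U M'} (hB' : B'.Rigid) {θ : k[T;T⁻¹] →ₐ[k] k[T;T⁻¹]}
    (hT' : B'.HasMonodromy θ) :
    Nonempty (M ≃ₗ[OneAdjoined k ρ] M') ↔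
      ∃ d : V ≃+ U, ∀ (f : k[T;T⁻¹]) v, d (f • v) = θ f • d v := by
  constructor
  · rintro ⟨φ⟩
    obtain ⟨d, hc, hd⟩ := exists_addEquiv hσ hB hB' φ
    refine ⟨d, map_smul_of_map_T_smul θ (d : V →+ U) hc fun m v => ?_⟩
    have h := hd 0 (0 - m * C.period) v (hC.sameAt_iff.2 (by simp))
    rwa [hT, hT'] at h
  · rintro ⟨d, hd⟩
    refine nonempty_linearEquiv B B' d (fun c v => by rw [hd, AlgHom.commutes]) fun i j v => ?_
    by_cases h : C.SameAt j i
    · obtain ⟨m, hm⟩ := hC.sameAt_iff.1 h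
      obtain rfl : i = j - m * C.period := by linarith
      rw [hT, hT', hd, AlgHom.id_apply]
    · rw [hB.π_β_of_not h, hB'.π_β_of_not h, map_zero]

end WordCoord

theorem Word.Match.isPeriodic (e : Word.Match C D) (hD : D.IsPeriodic) : C.IsPeriodic := by
  obtain ⟨i, hi⟩ := e.pos_surjective 0
  obtain ⟨j, hj⟩ := e.pos_surjective D.period
  have h : D.SameAt (e.pos i) (e.pos j) := hD.sameAt_iff.2 (by rw [hi, hj]; simp)
  refine (e.sameAt_iff.2 h).isPeriodic fun hij => ?_
  have hpos := hD.period_pos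
  rw [hij, hj] at hi
  omega

theorem Word.Match.period_eq (e : Word.Match C D) (hC : C.IsPeriodic) (hD : D.IsPeriodic) :
    D.period = C.period := by
  have h : ∀ m : ℤ, (C.period : ℤ) ∣ m ↔ (D.period : ℤ) ∣ m := fun m => by
    have h1 := e.sameAt_iff (i := 0 + m) (j := 0)
    rw [hC.sameAt_iff, hD.sameAt_iff, e.pos_add, add_sub_cancel_left, add_sub_cancel_left] at h1
    rw [h1]
    cases e.flip <;> simp
  exact Nat.dvd_antisymm (Int.natCast_dvd_natCast.1 ((h _).1 dvd_rfl))
    (Int.natCast_dvd_natCast.1 ((h _).2 dvd_rfl))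

namespace BandModule

variable (hC : C.IsPeriodic) (hD : D.IsPeriodic) (V : Type*) [AddCommGroup V]
  [Module k[T;T⁻¹] V]

theorem coord_hasMonodromy : (coord (k := k) hC V).HasMonodromy (AlgHom.id k _) :=
  fun i m v => coord_π_β_sub hC i m v

include hC in
theorem reindex_hasMonodromy (e : Word.Match C D) (he : e.flip = false) :
    ((coord (k := k) hD V).reindex e).HasMonodromy (AlgHom.id k _) := by
  intro i m v
  have h := coord_π_β_sub (k := k) hD (e.pos i) m v
  rw [e.period_eq hC hD] at h
  rw [AlgHom.id_apply, ← h]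
  change (coord hD V).π (e.pos i) ((coord hD V).β (e.pos (i - m * C.period)) v) = _
  rw [sub_eq_add_neg, e.pos_add, he]
  simp [sub_eq_add_neg]

include hC in
theorem reindex_hasMonodromy_invert (e : Word.Match C D) (he : e.flip = true) :
    ((coord (k := k) hD V).reindex e).HasMonodromy (invert (R := k) : k[T;T⁻¹] →ₐ[k] k[T;T⁻¹]) := by
  intro i m v
  have h := coord_π_β_sub (k := k) hD (e.pos i) (-m) v
  rw [e.period_eq hC hD] at h
  change (coord hD V).π (e.pos i) ((coord hD V).β (e.pos (i - m * C.period)) v) =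
    invert (R := k) (T m) • v
  rw [invert_T, ← h, sub_eq_add_neg, e.pos_add, he]
  simp

variable {σ : Letter Q → Bool} (hσ : IsLetterSign ρ σ)

include hσ in
theorem isIndecomposableModule {V} [AddCommGroup V] [Module k[T;T⁻¹] V]
    (hV : IsIndecomposableModule k[T;T⁻¹] V) :
    IsIndecomposableModule (OneAdjoined k ρ) (BandModule k hC V) :=
  WordCoord.isIndecomposableModule_of_hasMonodromy hσ hC (coord_rigid hC)
    (coord_hasMonodromy hC V) hV

end BandModule

namespace StringModule

variable (k) in
/-- The coordinates on the string module of a periodic word with coefficients in `k[T, T⁻¹]`. -/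
noncomputable def laurentCoord (hC : C.IsPeriodic) :
    WordCoord k C k[T;T⁻¹] k[T;T⁻¹] (StringModule k C) :=
  (BandModule.coord hC k[T;T⁻¹]).map (BandModule.ridEquiv k hC)

theorem laurentCoord_rigid (hC : C.IsPeriodic) : (laurentCoord k hC).Rigid :=
  (BandModule.coord_rigid hC).map _

variable {σ : Letter Q → Bool} (hσ : IsLetterSign ρ σ)

include hσ

theorem isIndecomposableModule (C : Word ρ) :
    IsIndecomposableModule (OneAdjoined k ρ) (StringModule k C) := by
  by_cases hC : C.IsPeriodic
  · exact WordCoord.isIndecomposableModule_of_hasMonodromy hσ hC (laurentCoord_rigid hC)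
      ((BandModule.coord_hasMonodromy hC _).map _) isIndecomposableModule_self
  · refine WordCoord.isIndecomposableModule hσ (coord_rigid hC) fun d hc _ hdd => ?_
    let e : k →ₗ[k] k := { d with map_smul' := hc }
    exact (isIndecomposableModule_self.eq_zero_or_eq_id e hdd).imp
      (fun h => AddMonoidHom.ext (LinearMap.congr_fun h))
      (fun h => AddMonoidHom.ext (LinearMap.congr_fun h))

theorem equivalent_of_rigid {A V M : Type*} [CommRing A] [Algebra k A] [AddCommGroup V]
    [Module A V] [AddCommGroup M] [Module (OneAdjoined k ρ) M] {B : WordCoord k D A V M}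
    (hB : B.Rigid) (φ : StringModule k C ≃ₗ[OneAdjoined k ρ] M) : C.Equivalent D := by
  by_cases hC : C.IsPeriodic
  · exact WordCoord.equivalent_of_linearEquiv hσ (laurentCoord_rigid hC) hB φ
  · exact WordCoord.equivalent_of_linearEquiv hσ (coord_rigid hC) hB φ

theorem nonempty_linearEquiv_iff (C D : Word ρ) :
    Nonempty (StringModule k C ≃ₗ[OneAdjoined k ρ] StringModule k D) ↔ C.Equivalent D := by
  constructor
  · rintro ⟨φ⟩
    by_cases hD : D.IsPeriodic
    · exact equivalent_of_rigid hσ (laurentCoord_rigid hD) φ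
    · exact equivalent_of_rigid hσ (coord_rigid hD) φ
  · intro h
    obtain ⟨e⟩ := h.nonempty_match
    refine WordCoord.nonempty_linearEquiv (coord k C) ((coord k D).reindex e) (AddEquiv.refl k)
      (fun c v => rfl) fun i j c => ?_
    change (coord k D).π (e.pos j) ((coord k D).β (e.pos i) c) =
      (coord k C).π j ((coord k C).β i c)
    rw [coord_π_β, coord_π_β]
    congr 1
    by_cases hij : j = i
    · subst hij
      by_cases hj : j ∈ C.shape.idx
      · rw [coeffHom_bOrZero_self hj, coeffHom_bOrZero_self ((e.mem_iff_pos j).1 hj)]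
      · rw [coeffHom_of_notMem hj, coeffHom_of_notMem fun h => hj ((e.mem_iff_pos j).2 h)]
    · rw [coeffHom_bOrZero_of_ne hij, coeffHom_bOrZero_of_ne fun h => hij (e.pos_injective h)]

theorem isEmpty_linearEquiv_bandModule (C D : Word ρ) (hD : D.IsPeriodic) (U : Type*)
    [AddCommGroup U] [Module k[T;T⁻¹] U] [Module.Finite k (RestrictScalars k k[T;T⁻¹] U)] :
    IsEmpty (StringModule k C ≃ₗ[OneAdjoined k ρ] BandModule k hD U) := by
  refine ⟨fun φ => ?_⟩
  obtain ⟨e⟩ := (equivalent_of_rigid hσ (BandModule.coord_rigid hD) φ).nonempty_match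
  have hC := e.isPeriodic hD
  obtain ⟨d, hd, -⟩ := WordCoord.exists_addEquiv hσ (laurentCoord_rigid hC)
    ((BandModule.coord_rigid hD).reindex e) φ
  let d' : k[T;T⁻¹] ≃ₗ[k] RestrictScalars k k[T;T⁻¹] U :=
    { d with
      map_smul' := fun c f => by
        rw [Algebra.smul_def]
        exact hd c f }
  exact not_moduleFinite_laurentPolynomial k (Module.Finite.equiv d'.symm)

end StringModule

namespace BandModule

variable {σ : Letter Q → Bool} (hσ : IsLetterSign ρ σ) (hC : C.IsPeriodic) (hD : D.IsPeriodic)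
  (V : Type*) [AddCommGroup V] [Module k[T;T⁻¹] V] (U : Type*) [AddCommGroup U]
  [Module k[T;T⁻¹] U]

include hσ

theorem nonempty_linearEquiv_iff_of_match (e : Word.Match C D) (he : e.flip = false) :
    Nonempty (BandModule k hC V ≃ₗ[OneAdjoined k ρ] BandModule k hD U) ↔
      Nonempty (U ≃ₗ[k[T;T⁻¹]] V) := by
  rw [WordCoord.nonempty_linearEquiv_iff_of_hasMonodromy hσ hC (coord_rigid hC)
    (coord_hasMonodromy hC V) ((coord_rigid hD).reindex e) (reindex_hasMonodromy hC hD U e he)]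
  exact ⟨fun ⟨d, hd⟩ => ⟨({ d with map_smul' := hd } : V ≃ₗ[k[T;T⁻¹]] U).symm⟩,
    fun ⟨φ⟩ => ⟨φ.symm.toAddEquiv, φ.symm.map_smul⟩⟩

theorem nonempty_linearEquiv_iff_of_flip_match (e : Word.Match C D) (he : e.flip = true) :
    Nonempty (BandModule k hC V ≃ₗ[OneAdjoined k ρ] BandModule k hD U) ↔
      Nonempty (U ≃ₗ[k[T;T⁻¹]] InvModule V) := by
  have hinv (f : k[T;T⁻¹]) : invert (R := k) (invert (R := k) f) = f := involutive_invert f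
  rw [WordCoord.nonempty_linearEquiv_iff_of_hasMonodromy hσ hC (coord_rigid hC)
    (coord_hasMonodromy hC V) ((coord_rigid hD).reindex e)
    (reindex_hasMonodromy_invert hC hD U e he)]
  constructor
  · rintro ⟨d, hd⟩
    refine ⟨({ d with map_smul' := fun f v => ?_ } : InvModule V ≃ₗ[k[T;T⁻¹]] U).symm⟩
    exact (hd (invert (R := k) f) v).trans (congrArg (· • d v) (hinv f))
  · rintro ⟨φ⟩
    refine ⟨(φ.symm.toAddEquiv : V ≃+ U), fun f v => ?_⟩
    exact (congrArg φ.symm (congrArg (· • (v : V)) (hinv f).symm)).trans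
      (φ.symm.map_smul (invert (R := k) f) v)

theorem nonempty_linearEquiv_iff [Nontrivial V] :
    Nonempty (BandModule k hC V ≃ₗ[OneAdjoined k ρ] BandModule k hD U) ↔
      ((∃ n : ℤ, D = C.shift n) ∧ Nonempty (U ≃ₗ[k[T;T⁻¹]] V)) ∨
      ((∃ n : ℤ, D = C.inv.shift n) ∧ Nonempty (U ≃ₗ[k[T;T⁻¹]] InvModule V)) := by
  constructor
  · rintro ⟨φ⟩
    obtain ⟨n, rfl | rfl⟩ := WordCoord.equivalent_of_linearEquiv hσ (coord_rigid hC)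
      (coord_rigid hD) φ
    · exact .inl ⟨⟨n, rfl⟩,
        (nonempty_linearEquiv_iff_of_match hσ hC hD V U (.shift C n) rfl).1 ⟨φ⟩⟩
    · exact .inr ⟨⟨n, rfl⟩,
        (nonempty_linearEquiv_iff_of_flip_match hσ hC hD V U (.invShift C n) rfl).1 ⟨φ⟩⟩
  · rintro (⟨⟨n, rfl⟩, h⟩ | ⟨⟨n, rfl⟩, h⟩)
    · exact (nonempty_linearEquiv_iff_of_match hσ hC hD V U (.shift C n) rfl).2 h
    · exact (nonempty_linearEquiv_iff_of_flip_match hσ hC hD V U (.invShift C n) rfl).2 h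

end BandModule

end Classification

/-! ## Finiteness conditions -/

section Finiteness

open Filter QuiverAlgebra

variable {k : Type*} [Field k] {Q : Type*} [Quiver Q] {ρ : Set (QPath Q)} {C : Word ρ}

theorem finite_setOf_pos_and_iff (P : ℤ → Prop) :
    {i : ℤ | 0 < i ∧ P i}.Finite ↔ ∀ᶠ i in atTop, ¬ P i := by
  constructor
  · intro h
    obtain ⟨b, hb⟩ := h.bddAbove
    filter_upwards [eventually_gt_atTop 0, eventually_gt_atTop b] with i h0 hbi hP
    exact hbi.not_ge (hb ⟨h0, hP⟩)
  · intro h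
    obtain ⟨n, hn⟩ := eventually_atTop.1 h
    refine (Set.finite_Ioo 0 n).subset fun i hi => ⟨hi.1, ?_⟩
    by_contra! hni
    exact hn i hni hi.2

theorem eventually_atTop_add_iff (P : ℤ → Prop) (a : ℤ) :
    (∀ᶠ i in atTop, P (i + a)) ↔ ∀ᶠ i in atTop, P i := by
  conv_rhs => rw [← (OrderIso.addRight a).map_atTop, eventually_map]
  rfl

namespace Word

variable (C) in
/-- Far out in the direction `δ`, the word `C` has no direct letters. -/
def EventuallyInverseAt (δ : Bool) : Prop :=
  ∀ᶠ i : ℤ in atTop, ∀ x, C.side δ (dirStep δ * i) ≠ some (Letter.direct x)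

variable (C) in
/-- Far out in the direction `δ`, the word `C` does not pass through `v`. -/
def LeavesAt (δ : Bool) (v : Q) : Prop :=
  ∀ᶠ i : ℤ in atTop, dirStep δ * i ∈ C.shape.idx → C.vertex (dirStep δ * i) ≠ some v

theorem eventuallyInverse_iff : C.EventuallyInverse ↔ C.EventuallyInverseAt true := by
  rw [EventuallyInverse, finite_setOf_pos_and_iff, ← eventually_atTop_add_iff _ 1]
  simp only [EventuallyInverseAt, side, dirStep_true, one_mul, not_exists, ne_eq]

theorem eventuallyInverse_inv_iff : C.inv.EventuallyInverse ↔ C.EventuallyInverseAt false := by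
  have hletter (i : ℤ) : C.inv.letter (i + (C.shape.mirror + 1)) = C.side false (-1 * i) := by
    change C.side false (C.shape.mirror + 1 - (i + (C.shape.mirror + 1))) = _
    congr 1
    ring
  rw [EventuallyInverse, finite_setOf_pos_and_iff,
    ← eventually_atTop_add_iff _ (C.shape.mirror + 1)]
  simp only [EventuallyInverseAt, hletter, dirStep_false, not_exists, ne_eq]

theorem vertexFinite_iff : C.VertexFinite ↔ ∀ v, C.LeavesAt true v := by
  refine forall_congr' fun v => ?_
  rw [finite_setOf_pos_and_iff]
  simp only [LeavesAt, dirStep_true, one_mul, not_and, ne_eq]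

theorem vertexFinite_inv_iff : C.inv.VertexFinite ↔ ∀ v, C.LeavesAt false v := by
  have hsub (i : ℤ) : C.shape.mirror - (i + C.shape.mirror) = -1 * i := by ring
  have hmem (i : ℤ) : i + C.shape.mirror ∈ C.inv.shape.idx ↔ -1 * i ∈ C.shape.idx := by
    rw [← hsub]
    exact C.shape.mem_idx_inv _
  have hvertex (i : ℤ) : C.inv.vertex (i + C.shape.mirror) = C.vertex (-1 * i) := by
    rw [← vertex_inv (C := C), neg_one_mul, sub_neg_eq_add, add_comm]
  refine forall_congr' fun v => ?_
  rw [finite_setOf_pos_and_iff, ← eventually_atTop_add_iff _ C.shape.mirror]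
  simp only [hmem, hvertex, LeavesAt, dirStep_false, not_and, ne_eq]

end Word

namespace StringModule

variable (k C) in
/-- The `k`-span of the `b_i` up to the position `n` in the direction `δ`. -/
noncomputable def initialPart (δ : Bool) (n : ℤ) : Submodule k (StringModule k C) :=
  Submodule.span k ((fun i => bOrZero k C (dirStep δ * i)) '' Set.Iic n)

theorem bOrZero_mem_initialPart {δ : Bool} {n i : ℤ} (h : i ≤ n) :
    bOrZero k C (dirStep δ * i) ∈ initialPart k C δ n :=
  Submodule.subset_span ⟨i, h, rfl⟩

theorem initialPart_mono (δ : Bool) : Monotone (initialPart k C δ) :=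
  fun _ _ h => Submodule.span_mono (Set.image_mono (Set.Iic_subset_Iic.2 h))

theorem exists_mem_initialPart (δ : Bool) (z : StringModule k C) :
    ∃ n, z ∈ initialPart k C δ n := by
  induction z using bOrZero_induction with
  | h0 => exact ⟨0, zero_mem _⟩
  | hadd x y hx hy =>
    obtain ⟨a, ha⟩ := hx
    obtain ⟨b, hb⟩ := hy
    exact ⟨max a b, add_mem (initialPart_mono δ (le_max_left a b) ha)
      (initialPart_mono δ (le_max_right a b) hb)⟩
  | hb c j =>
    have h := bOrZero_mem_initialPart (k := k) (C := C) (δ := δ) (le_refl (dirStep δ * j))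
    rw [← mul_assoc, dirStep_mul_self, one_mul] at h
    exact ⟨dirStep δ * j, Submodule.smul_mem _ c h⟩

theorem coeffHom_of_mem_initialPart {δ : Bool} {n i : ℤ} (h : n < i) {z : StringModule k C}
    (hz : z ∈ initialPart k C δ n) : coeffHom k C (dirStep δ * i) z = 0 := by
  induction hz using Submodule.span_induction with
  | mem z hz =>
    obtain ⟨j, hj, rfl⟩ := hz
    refine coeffHom_bOrZero_of_ne fun hij => ?_
    have : i = j := by cases δ <;> simpa using hij
    exact (this ▸ h).not_ge hj
  | zero => exact map_zero _
  | add x y _ _ hx hy => rw [map_add, hx, hy, add_zero]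
  | smul c x _ hx => rw [coeffHom_smul, hx, mul_zero]

theorem smul_mem_initialPart_of_forall {δ : Bool} {n : ℤ} {r : OneAdjoined k ρ}
    (hr : ∀ i ≤ n, r • bOrZero k C (dirStep δ * i) ∈ initialPart k C δ n) :
    ∀ z ∈ initialPart k C δ n, r • z ∈ initialPart k C δ n := by
  intro z hz
  induction hz using Submodule.span_induction with
  | mem z hz =>
    obtain ⟨i, hi, rfl⟩ := hz
    exact hr i hi
  | zero => rw [smul_zero]; exact zero_mem _
  | add x y _ _ hx hy => rw [smul_add]; exact add_mem hx hy
  | smul c x _ hx => rw [smul_comm]; exact Submodule.smul_mem _ c hx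

theorem arrow_smul_mem_initialPart {δ : Bool} {n : ℤ} {x : Quiver.Total Q}
    (h : C.side δ (dirStep δ * n) = some (Letter.direct x)) (y : Quiver.Total Q) {i : ℤ}
    (hi : i ≤ n) :
    (arrow k ρ y : OneAdjoined k ρ) • bOrZero k C (dirStep δ * i) ∈ initialPart k C δ n := by
  by_cases hy : ∃ δ', C.side δ' (dirStep δ * i) = some (Letter.inverse y)
  · obtain ⟨δ', hy⟩ := hy
    rw [arrow_smul_bOrZero hy]
    by_cases hδ : δ' = δ
    · subst hδ
      have hin : i ≠ n := by
        rintro rfl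
        rw [h] at hy
        cases hy
      rw [show dirStep δ' * i + dirStep δ' = dirStep δ' * (i + 1) by ring]
      exact bOrZero_mem_initialPart (by omega)
    · rw [Bool.eq_not_of_ne hδ, dirStep_not,
        show dirStep δ * i + -dirStep δ = dirStep δ * (i - 1) by ring]
      exact bOrZero_mem_initialPart (by omega)
  · rw [arrow_smul_bOrZero_zero (not_exists.1 hy)]
    exact zero_mem _

theorem smul_mem_initialPart {δ : Bool} {n : ℤ} {x : Quiver.Total Q}
    (h : C.side δ (dirStep δ * n) = some (Letter.direct x)) (r : OneAdjoined k ρ) :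
    ∀ z ∈ initialPart k C δ n, r • z ∈ initialPart k C δ n := by
  refine smul_mem_of_generators (initialPart k C δ n).toAddSubgroup (fun c z hz => ?_)
    (fun v => smul_mem_initialPart_of_forall fun i hi => ?_)
    (fun y => smul_mem_initialPart_of_forall fun i hi => arrow_smul_mem_initialPart h y hi) r
  · rw [inl_smul]
    exact Submodule.smul_mem _ c hz
  · by_cases hv : C.vertex (dirStep δ * i) = some v
    · rw [idem_smul_bOrZero_of_eq hv]
      exact bOrZero_mem_initialPart hi
    · rw [idem_smul_bOrZero_of_ne hv]
      exact zero_mem _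

theorem eventually_bOrZero_notMem_of_fg {δ : Bool} (h : ¬ C.EventuallyInverseAt δ)
    {N : Submodule (OneAdjoined k ρ) (StringModule k C)} (hN : N.FG) :
    ∀ᶠ i : ℤ in atTop, dirStep δ * i ∈ C.shape.idx → bOrZero k C (dirStep δ * i) ∉ N := by
  obtain ⟨S, rfl⟩ := hN
  choose b hb using exists_mem_initialPart (k := k) (C := C) δ
  obtain ⟨m, hm⟩ := (S.image b).bddAbove
  have hfreq : ∃ᶠ i : ℤ in atTop, ∃ x, C.side δ (dirStep δ * i) = some (Letter.direct x) := by
    simpa [Word.EventuallyInverseAt, Filter.Frequently] using h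
  obtain ⟨n, ⟨x, hx⟩, hmn⟩ := (hfreq.and_eventually (eventually_ge_atTop m)).exists
  let P : Submodule (OneAdjoined k ρ) (StringModule k C) :=
    { initialPart k C δ n with smul_mem' := fun r z => smul_mem_initialPart hx r z }
  have hP : Submodule.span (OneAdjoined k ρ) (S : Set (StringModule k C)) ≤ P :=
    Submodule.span_le.2 fun s hs =>
      initialPart_mono δ ((hm (Finset.mem_coe.2 (Finset.mem_image_of_mem b hs))).trans hmn) (hb s)
  filter_upwards [eventually_gt_atTop n] with i hi hmem hN
  have h0 := coeffHom_of_mem_initialPart hi (hP hN)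
  rw [coeffHom_bOrZero_self hmem] at h0
  exact one_ne_zero h0

theorem bOrZero_mem_of_le {δ : Bool} {n : ℤ} (hn : 0 ≤ n)
    (h : ∀ i, n ≤ i → ∀ x, C.side δ (dirStep δ * i) ≠ some (Letter.direct x))
    {N : Submodule (OneAdjoined k ρ) (StringModule k C)}
    (hN : bOrZero k C (dirStep δ * n) ∈ N) {i : ℤ} (hi : n ≤ i) :
    bOrZero k C (dirStep δ * i) ∈ N := by
  induction i, hi using Int.leInduction with
  | base => exact hN
  | succ i hi ih =>
    by_cases hmem : dirStep δ * (i + 1) ∈ C.shape.idx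
    · have hmem' := Word.dirStep_mul_mem_of_le (hn.trans hi) (by omega) hmem
      rw [mul_add, mul_one] at hmem ⊢
      obtain ⟨l, hl⟩ := Word.exists_side hmem' hmem
      cases l with
      | direct x => exact absurd hl (h i hi x)
      | inverse x =>
        rw [← arrow_smul_bOrZero hl]
        exact N.smul_mem _ ih
    · rw [bOrZero_of_notMem hmem]
      exact N.zero_mem

variable (k C) in
theorem exists_fg_forall_bOrZero_mem (δ : Bool) (n : ℤ) :
    ∃ N : Submodule (OneAdjoined k ρ) (StringModule k C), N.FG ∧
      ∀ i, 0 ≤ i → i ≤ n → bOrZero k C (dirStep δ * i) ∈ N :=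
  ⟨_, Submodule.fg_span ((Set.finite_Icc 0 n).image fun i => bOrZero k C (dirStep δ * i)),
    fun i h0 hn => Submodule.subset_span ⟨i, ⟨h0, hn⟩, rfl⟩⟩

theorem exists_fg_of_eventuallyInverseAt {δ : Bool} (h : C.EventuallyInverseAt δ) :
    ∃ N : Submodule (OneAdjoined k ρ) (StringModule k C), N.FG ∧
      ∀ i, 0 ≤ i → bOrZero k C (dirStep δ * i) ∈ N := by
  obtain ⟨n, hn⟩ := eventually_atTop.1 h
  obtain ⟨N, hN, hmem⟩ := exists_fg_forall_bOrZero_mem k C δ (max 0 n)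
  refine ⟨N, hN, fun i h0 => (le_total i (max 0 n)).elim (hmem i h0) fun hi => ?_⟩
  exact bOrZero_mem_of_le (le_max_left 0 n) (fun j hj => hn j ((le_max_right 0 n).trans hj))
    (hmem _ (le_max_left 0 n) le_rfl) hi

theorem exists_fg_of_leavesAt {δ : Bool} {v : Q} (h : C.LeavesAt δ v) :
    ∃ N : Submodule (OneAdjoined k ρ) (StringModule k C), N.FG ∧
      ∀ i, 0 ≤ i → C.vertex (dirStep δ * i) = some v → bOrZero k C (dirStep δ * i) ∈ N := by
  obtain ⟨n, hn⟩ := eventually_atTop.1 h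
  obtain ⟨N, hN, hmem⟩ := exists_fg_forall_bOrZero_mem k C δ n
  refine ⟨N, hN, fun i h0 hv => (le_total i n).elim (hmem i h0) fun hi => ?_⟩
  rw [bOrZero_of_notMem fun hi' => hn i hi hi' hv]
  exact N.zero_mem

theorem exists_dirStep_mul_eq (j : ℤ) : ∃ δ i, 0 ≤ i ∧ dirStep δ * i = j := by
  rcases le_total 0 j with hj | hj
  · exact ⟨true, j, hj, one_mul j⟩
  · exact ⟨false, -j, by omega, by simp⟩

theorem isUnitalModule (C : Word ρ) : IsUnitalModule k ρ (StringModule k C) :=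
  (coord k C).isUnitalModule

theorem isFinitelyGenerated_iff (C : Word ρ) : IsFinitelyGenerated k ρ (StringModule k C) ↔
    ∀ δ, C.EventuallyInverseAt δ := by
  rw [(isUnitalModule C).isFinitelyGenerated_iff, Module.finite_def]
  constructor
  · intro h δ
    by_contra hδ
    refine hδ ((eventually_bOrZero_notMem_of_fg hδ h).mono fun i hi x hx => ?_)
    exact hi (Word.mem_of_side hx).1 trivial
  · intro h
    choose N hN hmem using fun δ => exists_fg_of_eventuallyInverseAt (k := k) (h δ)
    have htop : ⨆ δ, N δ = ⊤ := by
      refine eq_top_iff.2 fun z _ => ?_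
      induction z using bOrZero_induction with
      | h0 => exact zero_mem _
      | hadd x y hx hy => exact add_mem (hx trivial) (hy trivial)
      | hb c j =>
        obtain ⟨δ, i, h0, rfl⟩ := exists_dirStep_mul_eq j
        exact Submodule.smul_of_tower_mem _ c (Submodule.mem_iSup_of_mem δ (hmem δ i h0))
    exact htop ▸ Submodule.fg_iSup N hN

theorem isFinitelyControlled_iff (C : Word ρ) : IsFinitelyControlled k ρ (StringModule k C) ↔
    ∀ δ, C.EventuallyInverseAt δ ∨ ∀ v, C.LeavesAt δ v := by
  rw [(isUnitalModule C).isFinitelyControlled_iff]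
  constructor
  · refine fun h δ => or_iff_not_imp_left.2 fun hδ v => ?_
    obtain ⟨N, hN, hvN⟩ := h v
    refine (eventually_bOrZero_notMem_of_fg hδ hN).mono fun i hi hmem hvi => hi hmem ?_
    have hbase := hvN (bOrZero k C (dirStep δ * i))
    rwa [idem_smul_bOrZero_of_eq hvi] at hbase
  · intro h v
    have hex (δ : Bool) : ∃ N : Submodule (OneAdjoined k ρ) (StringModule k C), N.FG ∧
        ∀ i, 0 ≤ i → C.vertex (dirStep δ * i) = some v → bOrZero k C (dirStep δ * i) ∈ N := by
      rcases h δ with hinv | hleaves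
      · obtain ⟨N, hN, hmem⟩ := exists_fg_of_eventuallyInverseAt (k := k) hinv
        exact ⟨N, hN, fun i h0 _ => hmem i h0⟩
      · exact exists_fg_of_leavesAt (hleaves v)
    choose N hN hmem using hex
    refine ⟨⨆ δ, N δ, Submodule.fg_iSup N hN, fun z => ?_⟩
    induction z using bOrZero_induction with
    | h0 => rw [smul_zero]; exact zero_mem _
    | hadd x y hx hy => rw [smul_add]; exact add_mem hx hy
    | hb c j =>
      rw [smul_comm]
      refine Submodule.smul_of_tower_mem _ c ?_
      by_cases hv : C.vertex j = some v
      · rw [idem_smul_bOrZero_of_eq hv]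
        obtain ⟨δ, i, h0, rfl⟩ := exists_dirStep_mul_eq j
        exact Submodule.mem_iSup_of_mem δ (hmem δ i h0 hv)
      · rw [idem_smul_bOrZero_of_ne hv]
        exact zero_mem _

theorem isFinitelyGenerated_iff_eventuallyInverse (C : Word ρ) :
    IsFinitelyGenerated k ρ (StringModule k C) ↔
      C.EventuallyInverse ∧ C.inv.EventuallyInverse := by
  rw [isFinitelyGenerated_iff, Bool.forall_bool, Word.eventuallyInverse_iff,
    Word.eventuallyInverse_inv_iff, and_comm]

theorem isFinitelyControlled_iff_eventuallyInverse_or_vertexFinite (C : Word ρ) :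
    IsFinitelyControlled k ρ (StringModule k C) ↔ (C.EventuallyInverse ∨ C.VertexFinite) ∧
      (C.inv.EventuallyInverse ∨ C.inv.VertexFinite) := by
  rw [isFinitelyControlled_iff, Bool.forall_bool, Word.eventuallyInverse_iff,
    Word.eventuallyInverse_inv_iff, Word.vertexFinite_iff, Word.vertexFinite_inv_iff, and_comm]

end StringModule

namespace BandModule

variable (hC : C.IsPeriodic) (V : Type*) [AddCommGroup V] [Module k[T;T⁻¹] V]

theorem isUnitalModule : IsUnitalModule k ρ (BandModule k hC V) :=
  (coord hC V).isUnitalModule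

theorem moduleFinite [Module.Finite k (RestrictScalars k k[T;T⁻¹] V)] :
    Module.Finite (OneAdjoined k ρ) (BandModule k hC V) := by
  obtain ⟨S, hS⟩ := Module.Finite.fg_top (R := k) (M := RestrictScalars k k[T;T⁻¹] V)
  let G : Set (BandModule k hC V) := Set.image2 (fun (i : ℤ) (v : V) => incl hC i v)
    (Finset.Ico (0 : ℤ) C.period) (show Set V from (S : Set (RestrictScalars k k[T;T⁻¹] V)))
  have hG : G.Finite := Set.Finite.image2 _ (Finset.finite_toSet _) (Finset.finite_toSet S)
  have hmem (i : ℤ) (hi : i ∈ Finset.Ico (0 : ℤ) C.period) (v : RestrictScalars k k[T;T⁻¹] V) :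
      incl hC i (show V from v) ∈ Submodule.span (OneAdjoined k ρ) G := by
    have hv : v ∈ Submodule.span k (S : Set (RestrictScalars k k[T;T⁻¹] V)) :=
      hS ▸ Submodule.mem_top
    induction hv using Submodule.span_induction with
    | mem v hv => exact Submodule.subset_span ⟨i, hi, v, hv, rfl⟩
    | zero => exact (map_zero (incl (k := k) (V := V) hC i)).symm ▸ zero_mem _
    | add v w _ _ hv hw =>
      exact (map_add (incl (k := k) (V := V) hC i) v w).symm ▸ add_mem hv hw
    | smul c v _ hv =>
      exact inl_smul_incl (ρ := ρ) (V := V) hC c i v ▸ Submodule.smul_mem _ _ hv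
  refine ⟨⟨hG.toFinset, eq_top_iff.2 fun z _ => ?_⟩⟩
  rw [Set.Finite.coe_toFinset, ← sum_incl_proj hC z]
  exact Submodule.sum_mem _ fun i hi => hmem i hi _

end BandModule

section DirectSum

variable {R ι : Type*} [Ring R] {N : ι → Type*} [∀ i, AddCommGroup (N i)] [∀ i, Module R (N i)]

theorem exists_finset_of_fg_directSum {P : Submodule R (⨁ i, N i)} (hP : P.FG) :
    ∃ F : Finset ι, ∀ z ∈ P, ∀ i ∉ F, z i = 0 := by
  classical
  obtain ⟨S, rfl⟩ := hP
  refine ⟨S.biUnion fun s => DFinsupp.support s, fun z hz i hi => ?_⟩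
  have h : Submodule.span R (S : Set (⨁ i, N i)) ≤ LinearMap.ker (DirectSum.component R ι N i) := by
    refine Submodule.span_le.2 fun s hs => ?_
    by_contra hne
    exact hi (Finset.mem_biUnion.2 ⟨s, hs, DFinsupp.mem_support_iff.2 hne⟩)
  exact h hz

theorem moduleFinite_directSum_iff [∀ i, Nontrivial (N i)] :
    Module.Finite R (⨁ i, N i) ↔ (∀ i, Module.Finite R (N i)) ∧ Finite ι := by
  classical
  constructor
  · intro h
    refine ⟨fun i => Module.Finite.of_surjective (DirectSum.component R ι N i) fun z =>
      ⟨DirectSum.lof R ι N i z, DirectSum.component.lof_self R i z⟩, ?_⟩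
    obtain ⟨F, hF⟩ := exists_finset_of_fg_directSum h.fg_top
    refine Set.finite_univ_iff.1 (F.finite_toSet.subset fun i _ => ?_)
    by_contra hi
    obtain ⟨z, hz⟩ := exists_ne (0 : N i)
    have := hF (DirectSum.lof R ι N i z) trivial i hi
    exact hz ((DirectSum.component.lof_self R i z).symm.trans this)
  · rintro ⟨h, hι⟩
    have := Fintype.ofFinite ι
    exact Module.Finite.equiv (DirectSum.linearEquivFunOnFintype R ι N).symm

end DirectSum

section FinitelyControlled

variable {ι : Type*} {N : ι → Type*} [∀ i, AddCommGroup (N i)]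
  [∀ i, Module (OneAdjoined k ρ) (N i)]

theorem isFinitelyGenerated_directSum_iff (hN : ∀ i, IsUnitalModule k ρ (N i))
    [∀ i, Nontrivial (N i)] :
    IsFinitelyGenerated k ρ (⨁ i, N i) ↔ (∀ i, IsFinitelyGenerated k ρ (N i)) ∧ Finite ι := by
  rw [(IsUnitalModule.directSum hN).isFinitelyGenerated_iff, moduleFinite_directSum_iff]
  exact and_congr_left fun _ => forall_congr' fun i => (hN i).isFinitelyGenerated_iff.symm

theorem isFinitelyControlled_directSum_iff (hN : ∀ i, IsUnitalModule k ρ (N i)) :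
    IsFinitelyControlled k ρ (⨁ i, N i) ↔
      (∀ i, IsFinitelyControlled k ρ (N i)) ∧ ∀ v : Q, {i | IsSupportedAt k ρ (N i) v}.Finite := by
  classical
  rw [(IsUnitalModule.directSum hN).isFinitelyControlled_iff]
  constructor
  · refine fun h => ⟨fun i => (hN i).isFinitelyControlled_iff.2 fun v => ?_, fun v => ?_⟩
    · obtain ⟨P, hP, hv⟩ := h v
      refine ⟨P.map (DirectSum.component (OneAdjoined k ρ) ι N i), hP.map _, fun m =>
        ⟨_, hv (DirectSum.lof (OneAdjoined k ρ) ι N i m), ?_⟩⟩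
      rw [map_smul, DirectSum.component.lof_self]
    · obtain ⟨P, hP, hv⟩ := h v
      obtain ⟨F, hF⟩ := exists_finset_of_fg_directSum hP
      refine F.finite_toSet.subset fun i ⟨m, hm⟩ => ?_
      by_contra hi
      have h0 := hF _ (hv (DirectSum.lof (OneAdjoined k ρ) ι N i m)) i hi
      rw [← map_smul] at h0
      exact hm ((DirectSum.component.lof_self (OneAdjoined k ρ) i _).symm.trans h0)
  · rintro ⟨h, hfin⟩ v
    choose P hP hv using fun i => (hN i).isFinitelyControlled_iff.1 (h i) v
    refine ⟨⨆ i ∈ (hfin v).toFinset, (P i).map (DirectSum.lof (OneAdjoined k ρ) ι N i),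
      Submodule.fg_biSup _ _ fun i _ => (hP i).map _, fun z => ?_⟩
    induction z using DirectSum.induction_on with
    | zero => rw [smul_zero]; exact zero_mem _
    | add x y hx hy => rw [smul_add]; exact add_mem hx hy
    | of i m =>
      rw [← DirectSum.lof_eq_of (OneAdjoined k ρ), ← map_smul]
      by_cases hi : IsSupportedAt k ρ (N i) v
      · exact Submodule.mem_iSup_of_mem i (Submodule.mem_iSup_of_mem
          ((Set.Finite.mem_toFinset _).2 hi) ⟨_, hv i m, rfl⟩)
      · rw [not_not.1 (not_exists.1 hi m), map_zero]
        exact zero_mem _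

end FinitelyControlled

section Summands

variable {M : Type*} [AddCommGroup M] [Module (OneAdjoined k ρ) M]

theorem IsUnitalModule.isFinitelyControlled (hM : IsUnitalModule k ρ M)
    (h : IsFinitelyGenerated k ρ M) : IsFinitelyControlled k ρ M :=
  hM.isFinitelyControlled_iff.2 fun _ =>
    ⟨⊤, (hM.isFinitelyGenerated_iff.1 h).fg_top, fun _ => trivial⟩

theorem IsStringModule.isUnitalModule (h : IsStringModule k ρ M) : IsUnitalModule k ρ M := by
  obtain ⟨C, ⟨e⟩⟩ := h
  exact (StringModule.isUnitalModule C).of_linearEquiv e.symm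

theorem IsStringModule.nontrivial (h : IsStringModule k ρ M) : Nontrivial M := by
  obtain ⟨C, ⟨e⟩⟩ := h
  have := (StringModule.coord k C).nontrivial
  exact e.toEquiv.nontrivial

theorem IsBandModule.isUnitalModule (h : IsBandModule k ρ M) : IsUnitalModule k ρ M := by
  obtain ⟨C, hC, V, _, _, -, ⟨e⟩⟩ := h
  exact (BandModule.isUnitalModule hC V).of_linearEquiv e.symm

theorem IsBandModule.nontrivial (h : IsBandModule k ρ M) : Nontrivial M := by
  obtain ⟨C, hC, V, _, _, hV, ⟨e⟩⟩ := h
  have := hV.2.1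
  have := (BandModule.coord (k := k) hC V).nontrivial
  exact e.toEquiv.nontrivial

theorem IsBandModule.isFinitelyGenerated (h : IsBandModule k ρ M) :
    IsFinitelyGenerated k ρ M := by
  rw [h.isUnitalModule.isFinitelyGenerated_iff]
  obtain ⟨C, hC, V, _, _, hV, ⟨e⟩⟩ := h
  have := hV.1
  have := BandModule.moduleFinite (k := k) (ρ := ρ) hC V
  exact Module.Finite.equiv e.symm

end Summands

end Finiteness

theorem theoremt_general {k : Type*} [Field k] {Q : Type*} [Quiver Q] (ρ : Set (QPath Q)) :
    (∀ σ, IsLetterSign ρ σ →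
      ((∀ C : Word ρ, IsIndecomposableModule (OneAdjoined k ρ) (StringModule k C)) ∧
        (∀ (C : Word ρ) (hC : C.IsPeriodic) (V : Type*) [AddCommGroup V] [Module k[T;T⁻¹] V],
          IsIndecomposableModule k[T;T⁻¹] V →
            IsIndecomposableModule (OneAdjoined k ρ) (BandModule k hC V))) ∧
      ((∀ C D : Word ρ,
          Nonempty (StringModule k C ≃ₗ[OneAdjoined k ρ] StringModule k D) ↔ C.Equivalent D) ∧
        (∀ (C D : Word ρ) (hC : C.IsPeriodic) (hD : D.IsPeriodic)
          (V : Type*) [AddCommGroup V] [Module k[T;T⁻¹] V]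
          (U : Type*) [AddCommGroup U] [Module k[T;T⁻¹] U], Nontrivial V →
            (Nonempty (BandModule k hC V ≃ₗ[OneAdjoined k ρ] BandModule k hD U) ↔
              ((∃ n : ℤ, D = C.shift n) ∧ Nonempty (U ≃ₗ[k[T;T⁻¹]] V)) ∨
              ((∃ n : ℤ, D = C.inv.shift n) ∧ Nonempty (U ≃ₗ[k[T;T⁻¹]] InvModule V)))) ∧
        (∀ (C D : Word ρ) (hD : D.IsPeriodic)
          (U : Type*) [AddCommGroup U] [Module k[T;T⁻¹] U],
          Module.Finite k (RestrictScalars k k[T;T⁻¹] U) →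
            IsEmpty (StringModule k C ≃ₗ[OneAdjoined k ρ] BandModule k hD U)))) ∧
    (∀ C : Word ρ,
      (IsFinitelyGenerated k ρ (StringModule k C) ↔
        C.EventuallyInverse ∧ C.inv.EventuallyInverse) ∧
      (IsFinitelyControlled k ρ (StringModule k C) ↔
        (C.EventuallyInverse ∨ C.VertexFinite) ∧
          (C.inv.EventuallyInverse ∨ C.inv.VertexFinite))) ∧
    (∀ (ι : Type*) (N : ι → Type*) [∀ i, AddCommGroup (N i)]
      [∀ i, Module (OneAdjoined k ρ) (N i)],
      (∀ i, IsUnitalModule k ρ (N i)) →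
      (∀ i, IsStringModule k ρ (N i) ∨ IsFinitelyGenerated k ρ (N i)) →
        ((∀ i, Nontrivial (N i)) → (IsFinitelyGenerated k ρ (⨁ i, N i) ↔
          (∀ i, IsStringModule k ρ (N i) → IsFinitelyGenerated k ρ (N i)) ∧ Finite ι)) ∧
        (IsFinitelyControlled k ρ (⨁ i, N i) ↔
          (∀ i, IsStringModule k ρ (N i) → IsFinitelyControlled k ρ (N i)) ∧
            ∀ v : Q, {i | IsSupportedAt k ρ (N i) v}.Finite)) := by
  refine ⟨fun σ hσ => ⟨⟨StringModule.isIndecomposableModule hσ,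
      fun C hC V _ _ hV => BandModule.isIndecomposableModule hC hσ hV⟩,
      StringModule.nonempty_linearEquiv_iff hσ,
      fun C D hC hD V _ _ U _ _ _ => BandModule.nonempty_linearEquiv_iff hσ hC hD V U,
      fun C D hD U _ _ _ => StringModule.isEmpty_linearEquiv_bandModule hσ C D hD U⟩,
    fun C => ⟨StringModule.isFinitelyGenerated_iff_eventuallyInverse C,
      StringModule.isFinitelyControlled_iff_eventuallyInverse_or_vertexFinite C⟩,
    fun ι N _ _ hunit hN => ⟨fun _ => ?_, ?_⟩⟩
  · rw [isFinitelyGenerated_directSum_iff hunit]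
    exact and_congr_left fun _ => forall_congr' fun i =>
      ⟨fun h _ => h, fun h => (hN i).elim h id⟩
  · rw [isFinitelyControlled_directSum_iff hunit]
    exact and_congr_left fun _ => forall_congr' fun i =>
      ⟨fun h _ => h, fun h => (hN i).elim h (hunit i).isFinitelyControlled⟩

theorem theoremt {k : Type*} [Field k] {Q : Type*} [Quiver Q] (ρ : Set (QPath Q))
    (hρ : IsStringAlgebra ρ) :
    -- (i) string and band modules are indecomposable
    ((∀ C : Word ρ, IsIndecomposableModule (OneAdjoined k ρ) (StringModule k C)) ∧
      (∀ (C : Word ρ) (hC : C.IsPeriodic) (V : Type*) [AddCommGroup V] [Module k[T;T⁻¹] V],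
        IsBandCoefficient k V →
          IsIndecomposableModule (OneAdjoined k ρ) (BandModule k hC V))) ∧
    -- (ii) the isomorphisms between string and band modules
    ((∀ C D : Word ρ,
        Nonempty (StringModule k C ≃ₗ[OneAdjoined k ρ] StringModule k D) ↔ C.Equivalent D) ∧
      (∀ (C D : Word ρ) (hC : C.IsPeriodic) (hD : D.IsPeriodic)
        (V : Type*) [AddCommGroup V] [Module k[T;T⁻¹] V]
        (U : Type*) [AddCommGroup U] [Module k[T;T⁻¹] U],
        IsBandCoefficient k V → IsBandCoefficient k U →
          (Nonempty (BandModule k hC V ≃ₗ[OneAdjoined k ρ] BandModule k hD U) ↔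
            ((∃ n : ℤ, D = C.shift n) ∧ Nonempty (U ≃ₗ[k[T;T⁻¹]] V)) ∨
            ((∃ n : ℤ, D = C.inv.shift n) ∧ Nonempty (U ≃ₗ[k[T;T⁻¹]] InvModule V)))) ∧
      (∀ (C D : Word ρ) (hD : D.IsPeriodic)
        (U : Type*) [AddCommGroup U] [Module k[T;T⁻¹] U],
        IsBandCoefficient k U →
          IsEmpty (StringModule k C ≃ₗ[OneAdjoined k ρ] BandModule k hD U))) ∧
    -- (iii) finiteness conditions for string modules
    (∀ C : Word ρ,
      (IsFinitelyGenerated k ρ (StringModule k C) ↔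
        C.EventuallyInverse ∧ C.inv.EventuallyInverse) ∧
      (IsFinitelyControlled k ρ (StringModule k C) ↔
        (C.EventuallyInverse ∨ C.VertexFinite) ∧
          (C.inv.EventuallyInverse ∨ C.inv.VertexFinite))) ∧
    -- (iv) finiteness conditions for direct sums of string and band modules
    (∀ (ι : Type*) (N : ι → Type*) [∀ i, AddCommGroup (N i)]
      [∀ i, Module (OneAdjoined k ρ) (N i)],
      (∀ i, IsStringModule k ρ (N i) ∨ IsBandModule k ρ (N i)) →
        (IsFinitelyGenerated k ρ (⨁ i, N i) ↔
          (∀ i, IsStringModule k ρ (N i) → IsFinitelyGenerated k ρ (N i)) ∧ Finite ι) ∧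
        (IsFinitelyControlled k ρ (⨁ i, N i) ↔
          (∀ i, IsStringModule k ρ (N i) → IsFinitelyControlled k ρ (N i)) ∧
            ∀ v : Q, {i | IsSupportedAt k ρ (N i) v}.Finite)) := by
  obtain ⟨σ, hσ⟩ := hρ.exists_isLetterSign
  obtain ⟨hiso, hfin, hsum⟩ := theoremt_general (k := k) ρ
  obtain ⟨⟨hS, hB⟩, hSS, hBB, hSB⟩ := hiso σ hσ
  refine ⟨⟨hS, fun C hC V _ _ hV => hB C hC V hV.2⟩,
    ⟨hSS, fun C D hC hD V _ _ U _ _ hV _ => hBB C D hC hD V U hV.2.1,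
      fun C D hD U _ _ hU => hSB C D hD U hU.1⟩, hfin, fun ι N _ _ hN => ?_⟩
  have hsumN := hsum ι N
    (fun i => (hN i).elim IsStringModule.isUnitalModule IsBandModule.isUnitalModule)
    fun i => (hN i).imp_right IsBandModule.isFinitelyGenerated
  exact ⟨hsumN.1 fun i => (hN i).elim IsStringModule.nontrivial IsBandModule.nontrivial, hsumN.2⟩
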